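/- Let $N\ge 1$ and let $B_1$ be the open unit ball of $\mathbb R^N$. Let $A$ be a real $N\times N$ matrix with $Av\cdot v\ge 0$ for all $v$, let $B\in\mathbb R^N$, and let $J:\mathbb R^N\setminus\{0\}\to(0,\infty)$ be a $C^1$ kernel with $\int(1\wedge|y|^2)J(y)\,dy<\infty$ and $J(y)=e^{-|y|\omega(y)}$, where $\omega(y)\to 1$ as $|y|\to\infty$. Define, with values in $(-\infty,+\infty]$, $$H(p)=\mathrm{Tr}(A\,p\otimes p)+B\cdot p+\int_{\mathbb R^N}\big(e^{p\cdot y}-1-(p\cdot y)\mathbf 1_{\{|y|<1\}}\big)J(y)\,dy,\qquad L(q)=\sup_{p\in\mathbb R^N}\{p\cdot q-H(p)\}.$$ Let $Q=B_1\times(0,\infty)$ and $\partial_PQ=(\partial B_1\times[0,\infty))\cup(B_1\times\{0\})$. Let $F(u_t,Du)$ be either $u_t+H(Du)$ or $\max(u_t+H(Du);|Du|-1)$. An u.s.c. function $u$ on $\overline Q$ is a viscosity subsolution of $F=0$ with data $f$ on $\partial_PQ$ if, whenever $\varphi$ is smooth and $u-\varphi$ has a local maximum relative to $\overline Q$ at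 $z_0$, one has $F(\varphi_t,D\varphi)\le 0$ at $z_0$ if $z_0\in Q$, and $\min(F(\varphi_t,D\varphi);u-f)\le 0$ at $z_0$ if $z_0\in\partial_PQ$. An l.s.c. function is a supersolution if the same holds with minima, reversed inequalities, and $\max$ in place of $\min$. A function $u:Q\to\mathbb R$ that is locally bounded up to the boundary is a viscosity solution if its u.s.c. and l.s.c. envelopes on $\overline Q$ (the $\limsup$ and $\liminf$ of $u$ at points of $\overline Q$, taken along $Q$) are respectively a subsolution and a supersolution. **(1) Initial trace.** Let $f$ be continuous on $\partial_PQ$ and let $u$ be a viscosity solution of $\max(u_t+H(Du);|Du|-1)=0$ with data $f$. Then $u$ has an initial trace: for every $x\in B_1$ the limit $u(0)(x)$ of $u(y,s)$ as $Q\ni(y,s)\to(x,0)$ exists. The function $u(0)$ is continuous on $B_1$ and solves, in the viscosity sense in $B_1$, the obstacle problem $$\max\big(u(0)-f(\cdot,0);\,|Du(0)|-1\big)=0 .$$ **(2) Lagrangian.** $L$ is finite and differentiable on $\mathbb R^N$, and $L(q)\sim|q|$ as $|q|\to\infty$. If the domain $\{H<\infty\}$ is exactly the open ball $B_1$, then $|DL(q)|<1$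 for all $q$. **(3) Rate function.** Suppose moreover that everything is radially symmetric: $J(y)$ depends only on $|y|$, $A=\alpha\,\mathrm{Id}$ for some $\alpha\in\mathbb R$, and $B=0$. Then $L(q)=\underline L(|q|)$ for some function $\underline L$. Put $$I(x,t)=t\,\underline L\Big(\frac{\mathrm{dist}(x;\partial B_1)}{t}\Big),\qquad (x,t)\in Q.$$ (a) $I$ is the unique viscosity solution in $Q$ of $u_t+H(Du)=0$ with data $\mathrm{dist}(x;\partial B_1)$ on $B_1\times\{0\}$ and $0$ on $\partial B_1\times[0,\infty)$. (b) For every $a>0$ there is exactly one viscosity solution $I^a$ in $Q$ of $\max(u_t+H(Du);|Du|-1)=0$ with data $a$ on $B_1\times\{0\}$ and $0$ on $\partial B_1\times[0,\infty)$. The limit rate function is $I$: $\lim_{a\to\infty}I^a(x,t)=I(x,t)$ for all $(x,t)\in Q$. -/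

import Mathlib

open Filter Topology MeasureTheory
open scoped ContDiff

noncomputable section

namespace CriticalHJ

/-- Euclidean space `ℝ^N`. -/
abbrev E (N : ℕ) : Type := EuclideanSpace ℝ (Fin N)

variable {N : ℕ}

/-- Critical kernels (normalised to the exponential rate `1`): `J` is `C¹` away from the origin (it
may be singular there), `∫ (1 ∧ |y|²) J(y) dy < ∞`, and `J(y) = exp(-|y| w(y))` with
`w(y) → 1` as `|y| → ∞`. -/
structure IsCriticalKernel (J : E N → ℝ) : Prop where
  contDiffOn : ContDiffOn ℝ 1 J {0}ᶜ
  integrable : Integrable (fun y : E N => min 1 (‖y‖ ^ 2) * J y)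
  exists_omega : ∃ w : E N → ℝ, (∀ y, y ≠ 0 → J y = Real.exp (-(‖y‖ * w y))) ∧
    Tendsto w (Bornology.cobounded (E N)) (𝓝 1)

/-- The integrand `(e^{p·y} - 1 - (p·y) 1_{|y|<1}) J(y)` of the Hamiltonian. -/
def integrand (J : E N → ℝ) (p y : E N) : ℝ :=
  (Real.exp (inner ℝ p y) - 1 - (Metric.ball (0 : E N) 1).indicator (fun y => inner ℝ p y) y) * J y

open Classical in
/-- The Hamiltonian
`H(p) = Tr(A p⊗p) + B·p + ∫ (e^{p·y} - 1 - (p·y) 1_{|y|<1}) J(y) dy`, with values in `(-∞, +∞]`.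
The negative part of the integrand is always integrable for the kernels considered here, so that
the integral is `+∞` exactly when the integrand is not integrable. -/
def hamiltonian (A : Matrix (Fin N) (Fin N) ℝ) (B : E N) (J : E N → ℝ) (p : E N) : EReal :=
  if Integrable (integrand J p) then
    (((A * Matrix.vecMulVec (fun i => p i) (fun i => p i)).trace + inner ℝ B p
      + ∫ y, integrand J p y : ℝ) : EReal)
  else ⊤

/-- The Lagrangian `L(q) = sup_p {p·q - H(p)}`. -/
def lagrangian (H : E N → EReal) (q : E N) : EReal :=
  ⨆ p : E N, ((inner ℝ p q : ℝ) : EReal) - H p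

/-- The open cylinder `Q = B_1 × (0,∞)`. -/
def cyl (N : ℕ) : Set (E N × ℝ) := Metric.ball 0 1 ×ˢ Set.Ioi 0

/-- The closed cylinder. -/
def closedCyl (N : ℕ) : Set (E N × ℝ) := Metric.closedBall 0 1 ×ˢ Set.Ici 0

/-- The parabolic boundary `(∂B_1 × [0,∞)) ∪ (B_1 × {0})`. -/
def parBdry (N : ℕ) : Set (E N × ℝ) :=
  (Metric.sphere 0 1 ×ˢ Set.Ici 0) ∪ (Metric.ball 0 1 ×ˢ {0})

/-- The left-hand side `τ + H(p)` of `u_t + H(Du) = 0`. -/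
def hjOp (H : E N → EReal) (τ : ℝ) (p : E N) : EReal := (τ : EReal) + H p

/-- The left-hand side of the modified equation `max (u_t + H(Du); |Du| - 1) = 0`. -/
def modOp (H : E N → EReal) (τ : ℝ) (p : E N) : EReal :=
  max ((τ : EReal) + H p) ((‖p‖ - 1 : ℝ) : EReal)

/-- Time derivative of a test function. -/
def timeDeriv (φ : E N × ℝ → ℝ) (z : E N × ℝ) : ℝ := deriv (fun s => φ (z.1, s)) z.2

/-- Spatial gradient of a test function. -/
def spaceGrad (φ : E N × ℝ → ℝ) (z : E N × ℝ) : E N := gradient (fun y => φ (y, z.2)) z.1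

/-- Viscosity subsolutions of `F(u_t, Du) = 0` in `Q` with data `f` on the parabolic boundary, the
data being taken in the viscosity (relaxed) sense. -/
def IsSubsolution (F : ℝ → E N → EReal) (f u : E N × ℝ → ℝ) : Prop :=
  UpperSemicontinuousOn u (closedCyl N) ∧
  ∀ φ : E N × ℝ → ℝ, ContDiff ℝ ∞ φ → ∀ z ∈ closedCyl N,
    IsLocalMaxOn (fun w => u w - φ w) (closedCyl N) z →
      (z ∈ cyl N → F (timeDeriv φ z) (spaceGrad φ z) ≤ 0) ∧
      (z ∈ parBdry N →
        min (F (timeDeriv φ z) (spaceGrad φ z)) ((u z - f z : ℝ) : EReal) ≤ 0)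

/-- Viscosity supersolutions of `F(u_t, Du) = 0` in `Q` with data `f` on the parabolic boundary, the
data being taken in the viscosity (relaxed) sense. -/
def IsSupersolution (F : ℝ → E N → EReal) (f u : E N × ℝ → ℝ) : Prop :=
  LowerSemicontinuousOn u (closedCyl N) ∧
  ∀ φ : E N × ℝ → ℝ, ContDiff ℝ ∞ φ → ∀ z ∈ closedCyl N,
    IsLocalMinOn (fun w => u w - φ w) (closedCyl N) z →
      (z ∈ cyl N → 0 ≤ F (timeDeriv φ z) (spaceGrad φ z)) ∧
      (z ∈ parBdry N →
        0 ≤ max (F (timeDeriv φ z) (spaceGrad φ z)) ((u z - f z : ℝ) : EReal))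

/-- Upper semicontinuous envelope, on the closed cylinder, of a function given on `Q`. -/
def upperEnv (u : E N × ℝ → ℝ) (z : E N × ℝ) : ℝ := limsup u (𝓝[cyl N] z)

/-- Lower semicontinuous envelope, on the closed cylinder, of a function given on `Q`. -/
def lowerEnv (u : E N × ℝ → ℝ) (z : E N × ℝ) : ℝ := liminf u (𝓝[cyl N] z)

/-- Viscosity solutions of `F(u_t, Du) = 0` in `Q` with data `f` on the parabolic boundary: the
function `u` on `Q` (its values off `Q` play no role) is locally bounded up to the boundary, its
upper envelope is a subsolution and its lower envelope a supersolution. -/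
def IsViscositySolution (F : ℝ → E N → EReal) (f u : E N × ℝ → ℝ) : Prop :=
  (∀ z ∈ closedCyl N, ∃ C : ℝ, ∀ᶠ w in 𝓝[cyl N] z, |u w| ≤ C) ∧
  IsSubsolution F f (upperEnv u) ∧ IsSupersolution F f (lowerEnv u)

/-- Continuous viscosity solutions `v` in `B_1` of the obstacle problem
`max (v - g; |Dv| - 1) = 0`. -/
def IsObstacleSolution (g v : E N → ℝ) : Prop :=
  ContinuousOn v (Metric.ball 0 1) ∧
  ∀ φ : E N → ℝ, ContDiff ℝ ∞ φ → ∀ x ∈ Metric.ball (0 : E N) 1,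
    (IsLocalMax (fun y => v y - φ y) x → max (v x - g x) (‖gradient φ x‖ - 1) ≤ 0) ∧
    (IsLocalMin (fun y => v y - φ y) x → 0 ≤ max (v x - g x) (‖gradient φ x‖ - 1))

/-- `dist(x; ∂B_1)`. -/
def distBdry (x : E N) : ℝ := Metric.infDist x (Metric.sphere 0 1)

open Classical in
/-- The data equal to `dist(x; ∂B_1)` at `t = 0` and to `0` on `∂B_1 × [0,∞)`. -/
def distData (z : E N × ℝ) : ℝ := if z.1 ∈ Metric.ball (0 : E N) 1 then distBdry z.1 else 0

open Classical in
/-- The data equal to the constant `a` on `B_1 × {0}` and to `0` on `∂B_1 × [0,∞)`. -/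
def constData (a : ℝ) (z : E N × ℝ) : ℝ := if z.1 ∈ Metric.ball (0 : E N) 1 then a else 0

end CriticalHJ

end

/-!
# Initial traces, Lagrangian and rate function for a critical Hamilton–Jacobi equation

No general comparison principle is needed: every comparison is made with an explicit smooth barrier.

**Hamiltonian and Lagrangian.** For a critical kernel, `H` is strictly convex on its effective
domain `D`, which lies between the open and the closed unit ball, its epigraph is closed (Fatou), it
is bounded below, and it is bounded above on smaller balls. These properties are collected in
`IsCriticalHamiltonian`; everything else uses only them. The supremum defining `L` is attained, at a
unique point by strict convexity, and this point depends continuously on `q` by compactness; hence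
it is the gradient of `L` (`hasGradientAt_realLag`), and it belongs to `D`.

**Initial trace.** Let `v` be the largest `1`-Lipschitz function below the initial data on the
closed ball (`lipEnvelope`). The gradient constraint forces subsolutions to be `1`-Lipschitz in
space, so the upper envelope of a solution is at most `v` at time `0` (`subsolution_le_cone`).
Conversely, a smooth function of slope less than `1` below the data, minus `C t` with `C` large, is
a strict subsolution, and `v` is a limit of such functions, by contraction and mollification
(`le_supersolution_initial`). So both envelopes equal `v` at time `0`, which is the existence of the
trace, and `v` solves the obstacle problem (`isObstacleSolution_lipEnvelope`).

**Rate function.** In the radial case the solution with data `a` and `0` is `min (a, I)`, and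
`I ≤ dist ≤ 1`, so that this solution is `I` as soon as `a ≥ 1`. A solution of `u_t + H(Du) = 0`
also solves the modified equation, because `H = +∞` off the closed unit ball; so one comparison
result, `viscositySolution_eq`, gives all the uniqueness statements.
* From below, `I` is the supremum over `r` of the conical waves `r (1 - |x|) - t H(r)`, which become
  classical subsolutions after regularisation (`wave_le_supersolution`).
* From above, a function transported with the velocity `q` of a straight path, increased by
  `t L(q)`, is a classical supersolution by the Fenchel inequality; the straight path from the
  nearest lateral boundary point yields `I` (`subsolution_le_rateFn`).
* That `min (a, I)` is a solution follows from the same two descriptions, applied at a point of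
  contact with a test function (`supergradient_rateFn`, `subgradient_rateFn`).
-/

noncomputable section

namespace CriticalHJ

variable {N : ℕ}

/-! ### Integrability of the Lévy integrand -/

/-- The factor `e^{p·y} - 1 - (p·y) 1_{|y|<1}` of the integrand. -/
def levyFactor (p y : E N) : ℝ :=
  Real.exp (inner ℝ p y) - 1 - (Metric.ball (0 : E N) 1).indicator (fun y => inner ℝ p y) y

/-- The restriction of the kernel to `{|y| ≥ 1}`. -/
def kernelTail (J : E N → ℝ) : E N → ℝ := (Metric.ball (0 : E N) 1)ᶜ.indicator J

lemma levyFactor_of_lt {p y : E N} (hy : ‖y‖ < 1) :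
    levyFactor p y = Real.exp (inner ℝ p y) - 1 - inner ℝ p y := by
  simp [levyFactor, Set.indicator, hy]

lemma levyFactor_of_le {p y : E N} (hy : 1 ≤ ‖y‖) :
    levyFactor p y = Real.exp (inner ℝ p y) - 1 := by
  simp [levyFactor, Set.indicator, not_lt.2 hy]

lemma kernelTail_of_lt {J : E N → ℝ} {y : E N} (hy : ‖y‖ < 1) : kernelTail J y = 0 := by
  simp [kernelTail, Set.indicator, not_le.2 hy]

lemma kernelTail_of_le {J : E N → ℝ} {y : E N} (hy : 1 ≤ ‖y‖) : kernelTail J y = J y := by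
  simp [kernelTail, Set.indicator, hy]

lemma levyFactor_zero_right (p : E N) : levyFactor p 0 = 0 := by
  simp [levyFactor]

lemma integrand_eq (J : E N → ℝ) (p y : E N) : integrand J p y = levyFactor p y * J y := rfl

lemma min_one_norm_sq_of_le {y : E N} (hy : 1 ≤ ‖y‖) : min 1 (‖y‖ ^ 2) = 1 :=
  min_eq_left (by nlinarith)

lemma min_one_norm_sq_of_lt {y : E N} (hy : ‖y‖ < 1) : min 1 (‖y‖ ^ 2) = ‖y‖ ^ 2 :=
  min_eq_right (by nlinarith [norm_nonneg y])

/-- Dominates the integrand uniformly in `|p| ≤ ρ`. -/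
def domBound (J : E N → ℝ) (ρ : ℝ) (y : E N) : ℝ :=
  min 1 (‖y‖ ^ 2) * J y + (Metric.ball (0 : E N) 1)ᶜ.indicator (fun y => Real.exp (ρ * ‖y‖) * J y) y

/-- Exponentials of the norm with a negative rate are integrable. -/
lemma integrable_exp_neg_norm {c : ℝ} (hc : 0 < c) :
    Integrable (fun y : E N => Real.exp (-(c * ‖y‖))) := by
  set n := Module.finrank ℝ (E N)
  have hlit := isLittleO_rpow_exp_pos_mul_atTop (n + 1 : ℝ) hc
  have h1 : Integrable (fun y : E N => (1 + ‖y‖) ^ (-((n : ℝ) + 1))) :=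
    integrable_one_add_norm (by simp [n])
  have hb : ∃ R : ℝ, ∀ x ≥ R, x ^ ((n : ℝ) + 1) ≤ Real.exp (c * x) := by
    have := hlit.bound (one_pos)
    rw [eventually_atTop] at this
    obtain ⟨R, hR⟩ := this
    refine ⟨max R 0, fun x hx => ?_⟩
    have := hR x (le_trans (le_max_left _ _) hx)
    simpa [abs_of_nonneg (Real.rpow_nonneg (le_trans (le_max_right _ _) hx) _)] using this
  obtain ⟨R, hR⟩ := hb
  set R' := max R 1
  -- beyond `R'` the exponential is dominated by the polynomial weight, below it by a constant
  set K := Real.exp c * (1 + (1 + R') ^ ((n : ℝ) + 1))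
  refine Integrable.mono' (h1.const_mul K) (by fun_prop) (Eventually.of_forall fun y => ?_)
  have hy0 := norm_nonneg y
  have hpos : 0 < (1 + ‖y‖) ^ ((n : ℝ) + 1) := Real.rpow_pos_of_pos (by linarith) _
  rw [Real.norm_eq_abs, abs_of_pos (Real.exp_pos _), Real.rpow_neg (by linarith),
    ← div_eq_mul_inv, le_div_iff₀ hpos]
  have hR1 : 0 ≤ (1 + R') ^ ((n : ℝ) + 1) :=
    Real.rpow_nonneg (by linarith [le_max_right R 1]) _
  have hec : 1 ≤ Real.exp c := Real.one_le_exp hc.le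
  rcases le_or_gt ‖y‖ R' with h | h
  · have h2 : (1 + ‖y‖) ^ ((n : ℝ) + 1) ≤ (1 + R') ^ ((n : ℝ) + 1) :=
      Real.rpow_le_rpow (by linarith) (by linarith) (by positivity)
    have h3 : Real.exp (-(c * ‖y‖)) ≤ 1 := Real.exp_le_one_iff.2 (by
      have := mul_nonneg hc.le hy0; linarith)
    calc _ ≤ 1 * (1 + R') ^ ((n : ℝ) + 1) :=
          mul_le_mul h3 h2 hpos.le zero_le_one
      _ ≤ K := by
          refine mul_le_mul hec (by linarith) hR1 (by linarith)
  · have h2 := hR (1 + ‖y‖) (by linarith [le_max_left R 1])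
    calc _ ≤ Real.exp (-(c * ‖y‖)) * Real.exp (c * (1 + ‖y‖)) := by gcongr
      _ = Real.exp c * 1 := by rw [← Real.exp_add, mul_one]; congr 1; ring
      _ ≤ K := by
          refine mul_le_mul_of_nonneg_left (by linarith) (by linarith)

namespace IsCriticalKernel

variable {J : E N → ℝ} (hJ : IsCriticalKernel J)
include hJ

lemma pos {y : E N} (hy : y ≠ 0) : 0 < J y := by
  obtain ⟨w, hw, -⟩ := hJ.exists_omega
  rw [hw y hy]; exact Real.exp_pos _

lemma integrable_kernelTail : Integrable (kernelTail J) := by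
  refine (hJ.integrable.indicator (measurableSet_ball (x := (0 : E N)) (ε := 1)).compl).congr
    (Eventually.of_forall fun y => ?_)
  by_cases hy : ‖y‖ < 1
  · simp [kernelTail, Set.indicator, hy]
  · push Not at hy
    rw [kernelTail_of_le hy, Set.indicator_of_mem (by simpa using hy), min_one_norm_sq_of_le hy,
      one_mul]

lemma neg_kernelTail_le_integrand (p y : E N) : -kernelTail J y ≤ integrand J p y := by
  rw [integrand_eq]
  rcases eq_or_ne y 0 with rfl | h0
  · simp [levyFactor_zero_right, kernelTail]
  have := hJ.pos h0
  rcases lt_or_ge ‖y‖ 1 with hy | hy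
  · rw [kernelTail_of_lt hy, levyFactor_of_lt hy, neg_zero]
    have := Real.add_one_le_exp (inner ℝ p y)
    exact mul_nonneg (by linarith) (by linarith)
  · rw [kernelTail_of_le hy, levyFactor_of_le hy]
    nlinarith [mul_pos (Real.exp_pos (inner ℝ p y)) this]

lemma aestronglyMeasurable_integrand (p : E N) : AEStronglyMeasurable (integrand J p) := by
  have h1 : integrand J p =
      fun y => (levyFactor p y / min 1 (‖y‖ ^ 2)) * (min 1 (‖y‖ ^ 2) * J y) := by
    ext y
    rw [integrand_eq]
    rcases eq_or_ne y 0 with rfl | h0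
    · simp [levyFactor_zero_right]
    have : (min 1 (‖y‖ ^ 2) : ℝ) ≠ 0 := (lt_min one_pos (by positivity)).ne'
    field_simp
  rw [h1]
  refine AEStronglyMeasurable.mul ?_ hJ.integrable.aestronglyMeasurable
  have hm : Measurable (levyFactor p) := by
    unfold levyFactor
    refine ((by fun_prop : Measurable fun y : E N => Real.exp (inner ℝ p y) - 1)).sub ?_
    exact Measurable.indicator (by fun_prop) measurableSet_ball
  exact (hm.div (by fun_prop)).aestronglyMeasurable

/-- `ρ < 1` is below the exponential rate of decay of the kernel. -/
lemma integrable_exp_mul_tail {ρ : ℝ} (h0 : 0 ≤ ρ) (hρ : ρ < 1) :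
    Integrable ((Metric.ball (0 : E N) 1)ᶜ.indicator (fun y => Real.exp (ρ * ‖y‖) * J y)) := by
  obtain ⟨w, hw, hlim⟩ := hJ.exists_omega
  have hev : ∀ᶠ y in Bornology.cobounded (E N), (1 + ρ) / 2 < w y :=
    hlim.eventually (lt_mem_nhds (by linarith))
  rw [← comap_norm_atTop, eventually_comap, eventually_atTop] at hev
  obtain ⟨R, hR⟩ := hev
  have hc : 0 < (1 - ρ) / 2 := by linarith
  have hmeas : AEStronglyMeasurable
      ((Metric.ball (0 : E N) 1)ᶜ.indicator (fun y => Real.exp (ρ * ‖y‖) * J y)) := by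
    have : ((Metric.ball (0 : E N) 1)ᶜ.indicator (fun y => Real.exp (ρ * ‖y‖) * J y)) =
        fun y => Real.exp (ρ * ‖y‖) * kernelTail J y := by
      ext y; simp [kernelTail, Set.indicator]
    rw [this]
    exact AEStronglyMeasurable.mul (by fun_prop) hJ.integrable_kernelTail.aestronglyMeasurable
  refine Integrable.mono' ((hJ.integrable_kernelTail.const_mul (Real.exp (ρ * R))).add
    (integrable_exp_neg_norm hc)) hmeas (Eventually.of_forall fun y => ?_)
  simp only [Pi.add_apply]
  rcases lt_or_ge ‖y‖ 1 with hy | hy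
  · rw [kernelTail_of_lt hy, Set.indicator_of_notMem (by simpa using hy)]
    simp; positivity
  have hy0 : y ≠ 0 := by rintro rfl; simp at hy; linarith
  have hp := hJ.pos hy0
  rw [kernelTail_of_le hy, Set.indicator_of_mem (by simpa using hy), Real.norm_eq_abs,
    abs_of_pos (by positivity)]
  rcases le_or_gt ‖y‖ R with h | h
  · have : Real.exp (ρ * ‖y‖) * J y ≤ Real.exp (ρ * R) * J y := by gcongr
    linarith [Real.exp_pos (-((1 - ρ) / 2 * ‖y‖))]
  · have h1 := hR ‖y‖ h.le y rfl
    have : Real.exp (ρ * ‖y‖) * J y ≤ Real.exp (-((1 - ρ) / 2 * ‖y‖)) := by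
      rw [hw y hy0, ← Real.exp_add]
      refine Real.exp_le_exp.2 ?_
      nlinarith [mul_le_mul_of_nonneg_left h1.le (norm_nonneg y)]
    have : 0 < Real.exp (ρ * R) * J y := by positivity
    linarith

lemma integrable_domBound {ρ : ℝ} (h0 : 0 ≤ ρ) (hρ : ρ < 1) : Integrable (domBound J ρ) :=
  hJ.integrable.add (hJ.integrable_exp_mul_tail h0 hρ)

lemma abs_integrand_le {ρ : ℝ} (hρ : ρ < 1) {p : E N} (hp : ‖p‖ ≤ ρ) (y : E N) :
    |integrand J p y| ≤ domBound J ρ y := by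
  rw [integrand_eq]
  rcases eq_or_ne y 0 with rfl | h0
  · simp [levyFactor_zero_right, domBound]
  have hJy := hJ.pos h0
  have hin : |(inner ℝ p y : ℝ)| ≤ ρ * ‖y‖ :=
    (abs_real_inner_le_norm p y).trans (by gcongr)
  rw [abs_mul, abs_of_pos hJy, domBound]
  rcases lt_or_ge ‖y‖ 1 with hy | hy
  · rw [Set.indicator_of_notMem (by simpa using hy), add_zero, levyFactor_of_lt hy,
      min_one_norm_sq_of_lt hy]
    have h1 : |(inner ℝ p y : ℝ)| ≤ ‖y‖ := hin.trans (by nlinarith [norm_nonneg y])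
    have := Real.abs_exp_sub_one_sub_id_le (h1.trans hy.le)
    have h2 : (inner ℝ p y : ℝ) ^ 2 ≤ ‖y‖ ^ 2 := sq_le_sq' (by linarith [(abs_le.1 h1).1])
      (abs_le.1 h1).2
    gcongr
    linarith
  · rw [Set.indicator_of_mem (by simpa using hy), levyFactor_of_le hy, min_one_norm_sq_of_le hy,
      ← add_mul]
    gcongr
    have h1 : Real.exp (inner ℝ p y) ≤ Real.exp (ρ * ‖y‖) :=
      Real.exp_le_exp.2 (abs_le.1 hin).2
    rw [abs_le]
    constructor <;> linarith [Real.exp_pos (inner ℝ p y), Real.exp_pos (ρ * ‖y‖)]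

lemma integrable_integrand {p : E N} (hp : ‖p‖ < 1) : Integrable (integrand J p) :=
  Integrable.mono' (hJ.integrable_domBound (norm_nonneg p) hp)
    (hJ.aestronglyMeasurable_integrand p)
    (Eventually.of_forall fun y => hJ.abs_integrand_le hp le_rfl y)

/-- Beyond the critical rate the integrand is unbounded on unit balls centred far away in the
direction of `p`, hence not integrable. -/
lemma not_integrable_integrand {p : E N} (hp : 1 < ‖p‖) : ¬ Integrable (integrand J p) := by
  intro hint
  obtain ⟨w, hw, hlim⟩ := hJ.exists_omega
  set G : E N → ℝ := fun y => integrand J p y + kernelTail J y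
  have hG : Integrable G := hint.add hJ.integrable_kernelTail
  have hG0 : ∀ y, 0 ≤ G y := fun y => by
    have := hJ.neg_kernelTail_le_integrand p y
    simp only [G]; linarith
  set K := ∫ y, G y
  set v := volume.real (Metric.ball (0 : E N) 1)
  have hv : 0 < v := by
    rw [show v = (volume (Metric.ball (0 : E N) 1)).toReal from rfl]
    exact ENNReal.toReal_pos (Metric.measure_ball_pos _ _ one_pos).ne' measure_ball_lt_top.ne
  have hev : ∀ᶠ y in Bornology.cobounded (E N), w y < (1 + ‖p‖) / 2 :=
    hlim.eventually (gt_mem_nhds (by linarith))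
  rw [← comap_norm_atTop, eventually_comap, eventually_atTop] at hev
  obtain ⟨R, hR⟩ := hev
  -- `X` is a level that Markov's inequality forbids
  set X := K / v + 1
  have hX : K < X * v := by simp only [X]; field_simp; linarith
  have hK : 0 ≤ K := integral_nonneg hG0
  have hXpos : 0 < X := by positivity
  set b := Real.log X
  set ε := (‖p‖ - 1) / 2
  have hε : 0 < ε := by simp only [ε]; linarith
  obtain ⟨n, hn1, hn2, hn3⟩ : ∃ n : ℝ, R + 1 ≤ n ∧ 2 ≤ n ∧ b + ‖p‖ + (1 + ‖p‖) / 2 ≤ ε * n := by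
    refine ⟨max (max (R + 1) 2) ((b + ‖p‖ + (1 + ‖p‖) / 2) / ε), ?_, ?_, ?_⟩
    · exact (le_max_left _ _).trans (le_max_left _ _)
    · exact (le_max_right _ _).trans (le_max_left _ _)
    · rw [mul_comm, ← div_le_iff₀ hε]; exact le_max_right _ _
  have hp0 : ‖p‖ ≠ 0 := by linarith
  set e : E N := (n / ‖p‖) • p
  have he : ‖e‖ = n := by
    rw [norm_smul, norm_div, norm_norm, Real.norm_eq_abs, abs_of_pos (by linarith)]
    field_simp
  have hpe : (inner ℝ p e : ℝ) = ‖p‖ * n := by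
    simp only [e, inner_smul_right, real_inner_self_eq_norm_sq]; field_simp
  have hsub : Metric.ball e 1 ⊆ {y | X ≤ G y} := by
    intro y hy
    rw [Metric.mem_ball, dist_eq_norm] at hy
    have hy1 : n - 1 ≤ ‖y‖ := by
      have := norm_sub_norm_le e y
      rw [norm_sub_rev] at this; linarith
    have hy2 : ‖y‖ ≤ n + 1 := by
      have := norm_sub_norm_le y e
      linarith
    have hyy : 1 ≤ ‖y‖ := by linarith
    have hy0 : y ≠ 0 := by rintro rfl; simp at hyy; linarith
    have hin : ‖p‖ * (n - 1) ≤ (inner ℝ p y : ℝ) := by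
      have h1 : (inner ℝ p y : ℝ) = inner ℝ p e + inner ℝ p (y - e) := by
        rw [← inner_add_right]; congr 1; abel
      have h2 := (abs_le.1 (abs_real_inner_le_norm p (y - e))).1
      have : ‖p‖ * ‖y - e‖ ≤ ‖p‖ * 1 := by gcongr
      rw [h1, hpe]; linarith
    have hwy := hR ‖y‖ (by linarith) y rfl
    have hGy : G y = Real.exp (inner ℝ p y) * J y := by
      simp only [G, integrand_eq, levyFactor_of_le hyy, kernelTail_of_le hyy]; ring
    change X ≤ G y
    rw [hGy, hw y hy0, ← Real.exp_add, ← Real.exp_log hXpos]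
    refine Real.exp_le_exp.2 ?_
    have h3 : ‖y‖ * w y ≤ (n + 1) * ((1 + ‖p‖) / 2) := by
      calc ‖y‖ * w y ≤ ‖y‖ * ((1 + ‖p‖) / 2) := by gcongr
        _ ≤ _ := by gcongr
    simp only [ε] at hn3
    nlinarith
  have h1 := mul_meas_ge_le_integral_of_nonneg (Eventually.of_forall hG0) hG X
  have h2 : v ≤ volume.real {y | X ≤ G y} := by
    have : v = volume.real (Metric.ball e 1) := by
      simp only [v, measureReal_def, Measure.addHaar_ball_center]
    rw [this]
    exact measureReal_mono hsub (hG.measure_ge_lt_top hXpos).ne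
  have : X * v ≤ X * volume.real {y | X ≤ G y} := by gcongr
  linarith

end IsCriticalKernel

/-! ### The Hamiltonian -/

/-- The effective domain `{H < ∞}`. -/
def effDom (J : E N → ℝ) : Set (E N) := {p | Integrable (integrand J p)}

/-- The drift and diffusion part `Tr(A p⊗p) + B·p` of the Hamiltonian. -/
def quadPart (A : Matrix (Fin N) (Fin N) ℝ) (B : E N) (p : E N) : ℝ :=
  (A * Matrix.vecMulVec (fun i => p i) (fun i => p i)).trace + inner ℝ B p

/-- The Hamiltonian as a real function, meaningful on its effective domain. -/
def realHam (A : Matrix (Fin N) (Fin N) ℝ) (B : E N) (J : E N → ℝ) (p : E N) : ℝ :=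
  quadPart A B p + ∫ y, integrand J p y

variable {A : Matrix (Fin N) (Fin N) ℝ} {B : E N} {J : E N → ℝ}

lemma hamiltonian_of_mem {p : E N} (hp : p ∈ effDom J) :
    hamiltonian A B J p = (realHam A B J p : EReal) := by
  rw [hamiltonian, if_pos (show Integrable (integrand J p) volume from hp)]; rfl

lemma hamiltonian_of_notMem {p : E N} (hp : p ∉ effDom J) : hamiltonian A B J p = ⊤ :=
  if_neg hp

lemma quadPart_eq (A : Matrix (Fin N) (Fin N) ℝ) (B p : E N) :
    quadPart A B p = (fun i => p i) ⬝ᵥ A.mulVec (fun i => p i) + inner ℝ B p := by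
  rw [quadPart, Matrix.mul_vecMulVec, Matrix.trace_vecMulVec, dotProduct_comm]

lemma continuous_quadPart : Continuous (quadPart A B) := by
  have : quadPart A B = fun p => (fun i => p i) ⬝ᵥ A.mulVec (fun i => p i) + inner ℝ B p :=
    funext (quadPart_eq A B)
  rw [this]
  unfold dotProduct Matrix.mulVec dotProduct
  fun_prop

/-- The quadratic part is convex, as its second-order part is positive semidefinite (no symmetry is
needed). -/
lemma quadPart_convex (hA : ∀ v : Fin N → ℝ, 0 ≤ v ⬝ᵥ A.mulVec v) (p q : E N) {a b : ℝ}
    (ha : 0 ≤ a) (hb : 0 ≤ b) (hab : a + b = 1) :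
    quadPart A B (a • p + b • q) ≤ a * quadPart A B p + b * quadPart A B q := by
  simp only [quadPart_eq]
  set x : Fin N → ℝ := fun i => p i
  set y : Fin N → ℝ := fun i => q i
  have h1 : (fun i => (a • p + b • q) i) = a • x + b • y := by
    ext i; simp [x, y]
  rw [h1]
  have h2 := mul_nonneg (mul_nonneg ha hb) (hA (x - y))
  have hb' : b = 1 - a := by linarith
  simp only [Matrix.mulVec_add, Matrix.mulVec_smul, add_dotProduct, dotProduct_add,
    smul_dotProduct, dotProduct_smul, smul_eq_mul, inner_add_right, inner_smul_right,
    Matrix.mulVec_sub, sub_dotProduct, dotProduct_sub] at h2 ⊢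
  subst hb'
  nlinarith

lemma neg_norm_le_quadPart (hA : ∀ v : Fin N → ℝ, 0 ≤ v ⬝ᵥ A.mulVec v) (p : E N) :
    -(‖B‖ * ‖p‖) ≤ quadPart A B p := by
  rw [quadPart_eq]
  have := (abs_le.1 (abs_real_inner_le_norm B p)).1
  have := hA (fun i => p i)
  linarith

lemma quadPart_zero : quadPart A B 0 = 0 := by
  simp [quadPart_eq, dotProduct]

lemma integrand_zero : integrand J (0 : E N) = 0 := by
  ext y; simp [integrand, Set.indicator]

lemma realHam_zero : realHam A B J 0 = 0 := by
  simp [realHam, integrand_zero, quadPart_zero]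

namespace IsCriticalKernel

variable (hJ : IsCriticalKernel J)
include hJ

lemma mem_effDom {p : E N} (hp : ‖p‖ < 1) : p ∈ effDom J := hJ.integrable_integrand hp

lemma norm_le_one_of_mem {p : E N} (hp : p ∈ effDom J) : ‖p‖ ≤ 1 := by
  by_contra! h
  exact hJ.not_integrable_integrand h hp

/-- The positive semidefinite diffusion and the convexity of the exponential leave only the drift
and the mass of the kernel on `{|y| ≥ 1}` as negative contributions. -/
lemma exists_le_realHam (hA : ∀ v : Fin N → ℝ, 0 ≤ v ⬝ᵥ A.mulVec v) :
    ∃ c : ℝ, ∀ p ∈ effDom J, c ≤ realHam A B J p := by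
  refine ⟨-‖B‖ - ∫ y, kernelTail J y, fun p hp => ?_⟩
  have h1 : ∫ y, -kernelTail J y ≤ ∫ y, integrand J p y :=
    integral_mono hJ.integrable_kernelTail.neg hp (fun y => hJ.neg_kernelTail_le_integrand p y)
  rw [integral_neg] at h1
  have h2 := neg_norm_le_quadPart (B := B) hA p
  have h3 : ‖B‖ * ‖p‖ ≤ ‖B‖ * 1 := by gcongr; exact hJ.norm_le_one_of_mem hp
  rw [realHam]; linarith

lemma exists_realHam_le {ρ : ℝ} (hρ : ρ < 1) :
    ∃ C : ℝ, ∀ p : E N, ‖p‖ ≤ ρ → realHam A B J p ≤ C := by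
  rcases lt_or_ge ρ 0 with h0 | h0
  · exact ⟨0, fun p hp => absurd (norm_nonneg p) (by linarith)⟩
  obtain ⟨C, hC⟩ := (isCompact_closedBall (0 : E N) ρ).bddAbove_image
    (continuous_quadPart (A := A) (B := B)).continuousOn
  refine ⟨C + ∫ y, domBound J ρ y, fun p hp => ?_⟩
  have h1 : quadPart A B p ≤ C := hC ⟨p, by simpa using hp, rfl⟩
  have h2 : ∫ y, integrand J p y ≤ ∫ y, domBound J ρ y :=
    integral_mono (hJ.mem_effDom (by linarith)) (hJ.integrable_domBound h0 hρ)
      (fun y => (le_abs_self _).trans (hJ.abs_integrand_le hρ hp y))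
  rw [realHam]; linarith

lemma integrand_convex (p q y : E N) {a b : ℝ} (ha : 0 < a) (hb : 0 < b) (hab : a + b = 1) :
    integrand J (a • p + b • q) y ≤ a * integrand J p y + b * integrand J q y ∧
    (inner ℝ (p - q) y ≠ (0 : ℝ) →
      integrand J (a • p + b • q) y < a * integrand J p y + b * integrand J q y) := by
  rcases eq_or_ne y 0 with rfl | h0
  · simp [integrand_eq, levyFactor_zero_right]
  have hJy := hJ.pos h0
  set s : ℝ := inner ℝ p y
  set t : ℝ := inner ℝ q y
  have hin : (inner ℝ (a • p + b • q) y : ℝ) = a * s + b * t := by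
    simp [inner_add_left, inner_smul_left, s, t]
  have key : a * integrand J p y + b * integrand J q y - integrand J (a • p + b • q) y =
      (a * Real.exp s + b * Real.exp t - Real.exp (a * s + b * t)) * J y := by
    simp only [integrand_eq]
    have hb' : b = 1 - a := by linarith
    rcases lt_or_ge ‖y‖ 1 with hy | hy
    · rw [levyFactor_of_lt hy, levyFactor_of_lt hy, levyFactor_of_lt hy, hin]
      subst hb'; ring
    · rw [levyFactor_of_le hy, levyFactor_of_le hy, levyFactor_of_le hy, hin]
      subst hb'; ring
  constructor
  · have := convexOn_exp.2 (Set.mem_univ s) (Set.mem_univ t) ha.le hb.le hab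
    simp only [smul_eq_mul] at this
    have : 0 ≤ (a * Real.exp s + b * Real.exp t - Real.exp (a * s + b * t)) * J y :=
      mul_nonneg (by linarith) hJy.le
    linarith
  · intro hne
    have hst : s ≠ t := by
      intro h; apply hne; rw [inner_sub_left]; exact sub_eq_zero.2 h
    have := strictConvexOn_exp.2 (Set.mem_univ s) (Set.mem_univ t) hst ha hb hab
    simp only [smul_eq_mul] at this
    have : 0 < (a * Real.exp s + b * Real.exp t - Real.exp (a * s + b * t)) * J y :=
      mul_pos (by linarith) hJy
    linarith

/-- Strict convexity comes from the positivity of the kernel: the exponentials `e^{p·y}` are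
strictly convex in `p` except on a hyperplane of `y`. -/
lemma strictConvexOn_realHam (hA : ∀ v : Fin N → ℝ, 0 ≤ v ⬝ᵥ A.mulVec v) :
    StrictConvexOn ℝ (effDom J) (realHam A B J) := by
  have hmem : ∀ p ∈ effDom J, ∀ q ∈ effDom J, ∀ a b : ℝ, 0 < a → 0 < b → a + b = 1 →
      a • p + b • q ∈ effDom J := fun p hp q hq a b ha hb hab =>
    integrable_of_le_of_le (hJ.aestronglyMeasurable_integrand _)
      (Eventually.of_forall fun y => hJ.neg_kernelTail_le_integrand _ y)
      (Eventually.of_forall fun y => (hJ.integrand_convex p q y ha hb hab).1)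
      hJ.integrable_kernelTail.neg ((hp.const_mul a).add (hq.const_mul b))
  refine ⟨convex_iff_forall_pos.2 fun p hp q hq a b ha hb hab => hmem p hp q hq a b ha hb hab,
    fun p hp q hq hpq a b ha hb hab => ?_⟩
  have hm := hmem p hp q hq a b ha hb hab
  have hI : Integrable fun y => a * integrand J p y + b * integrand J q y :=
    (hp.const_mul a).add (hq.const_mul b)
  set D : E N → ℝ := fun y => a * integrand J p y + b * integrand J q y -
    integrand J (a • p + b • q) y
  have hD : Integrable D := hI.sub hm
  have hD0 : 0 ≤ D := fun y => sub_nonneg.2 (hJ.integrand_convex p q y ha hb hab).1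
  have hpos : 0 < ∫ y, D y := by
    rw [integral_pos_iff_support_of_nonneg hD0 hD]
    have hopen : IsOpen {y : E N | (inner ℝ (p - q) y : ℝ) ≠ 0} :=
      isOpen_ne_fun (by fun_prop) continuous_const
    refine lt_of_lt_of_le (hopen.measure_pos volume ⟨p - q, ?_⟩) (measure_mono fun y hy => ?_)
    · change (inner ℝ (p - q) (p - q) : ℝ) ≠ 0
      rw [real_inner_self_eq_norm_sq]
      exact pow_ne_zero _ (norm_ne_zero_iff.2 (sub_ne_zero.2 hpq))
    · exact (sub_pos.2 ((hJ.integrand_convex p q y ha hb hab).2 hy)).ne'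
  have h1 : ∫ y, D y = a * (∫ y, integrand J p y) + b * (∫ y, integrand J q y) -
      ∫ y, integrand J (a • p + b • q) y := by
    rw [integral_sub hI hm, integral_add (hp.const_mul a) (hq.const_mul b), integral_const_mul,
      integral_const_mul]
  have h2 := quadPart_convex (B := B) hA p q ha.le hb.le hab
  simp only [realHam, smul_eq_mul]
  rw [h1] at hpos
  linarith

/-- The epigraph of the Hamiltonian is closed, by Fatou's lemma. -/
lemma realHam_le_of_tendsto {p : ℕ → E N} {p₀ : E N} {c : ℝ} (hp : ∀ n, p n ∈ effDom J)
    (hlim : Tendsto p atTop (𝓝 p₀)) (hc : Tendsto (fun n => realHam A B J (p n)) atTop (𝓝 c)) :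
    p₀ ∈ effDom J ∧ realHam A B J p₀ ≤ c := by
  set G : E N → E N → ℝ := fun p y => integrand J p y + kernelTail J y
  have hG0 : ∀ p y, 0 ≤ G p y := fun p y => by
    have := hJ.neg_kernelTail_le_integrand p y
    simp only [G]; linarith
  have hT := hJ.integrable_kernelTail
  have hGm : ∀ p, AEStronglyMeasurable (G p) := fun p =>
    (hJ.aestronglyMeasurable_integrand p).add hT.aestronglyMeasurable
  set K := ∫ y, kernelTail J y
  have hGint : ∀ n, ∫ y, G (p n) y = realHam A B J (p n) - quadPart A B (p n) + K := fun n => by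
    have : ∫ y, G (p n) y = (∫ y, integrand J (p n) y) + ∫ y, kernelTail J y :=
      integral_add (hp n) hT
    rw [this, realHam]; ring
  have hlimG : Tendsto (fun n => ∫ y, G (p n) y) atTop (𝓝 (c - quadPart A B p₀ + K)) := by
    simp only [hGint]
    exact (hc.sub ((continuous_quadPart.tendsto p₀).comp hlim)).add_const K
  have hlimit0 : 0 ≤ c - quadPart A B p₀ + K :=
    ge_of_tendsto' hlimG fun n => integral_nonneg (hG0 _)
  have hcont : ∀ y, Continuous fun p => G p y := fun y => by
    simp only [G, integrand_eq]
    rcases lt_or_ge ‖y‖ 1 with hy | hy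
    · simp only [levyFactor_of_lt hy]; fun_prop
    · simp only [levyFactor_of_le hy]; fun_prop
  have hF : ∫⁻ y, ENNReal.ofReal (G p₀ y) ≤ ENNReal.ofReal (c - quadPart A B p₀ + K) := by
    have h1 : ∀ y, ENNReal.ofReal (G p₀ y) =
        liminf (fun n => ENNReal.ofReal (G (p n) y)) atTop := fun y =>
      ((ENNReal.continuous_ofReal.tendsto _).comp
        (((hcont y).tendsto p₀).comp hlim)).liminf_eq.symm
    simp only [h1]
    refine (lintegral_liminf_le' fun n => (hGm (p n)).aemeasurable.ennreal_ofReal).trans ?_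
    have h2 : ∀ n, ∫⁻ y, ENNReal.ofReal (G (p n) y) = ENNReal.ofReal (∫ y, G (p n) y) := fun n =>
      (ofReal_integral_eq_lintegral_ofReal ((hp n).add hT)
        (Eventually.of_forall (hG0 _))).symm
    simp only [h2]
    exact ((ENNReal.continuous_ofReal.tendsto _).comp hlimG).liminf_eq.le
  have hGi : Integrable (G p₀) := by
    refine ⟨hGm _, ?_⟩
    rw [hasFiniteIntegral_iff_ofReal (Eventually.of_forall (hG0 _))]
    exact hF.trans_lt ENNReal.ofReal_lt_top
  have hmem : p₀ ∈ effDom J := by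
    have : integrand J p₀ = G p₀ - kernelTail J := by ext y; simp [G]
    change Integrable (integrand J p₀)
    rw [this]; exact hGi.sub hT
  refine ⟨hmem, ?_⟩
  rw [← ofReal_integral_eq_lintegral_ofReal hGi (Eventually.of_forall (hG0 _)),
    ENNReal.ofReal_le_ofReal_iff hlimit0] at hF
  have : ∫ y, G p₀ y = (∫ y, integrand J p₀ y) + ∫ y, kernelTail J y := integral_add hmem hT
  rw [this] at hF
  rw [realHam]; linarith

end IsCriticalKernel

/-! ### Radial symmetry -/

/-- In the radially symmetric case the Hamiltonian is invariant under isometries. -/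
lemma radial_iff_and_eq (hrad : ∀ y z, ‖y‖ = ‖z‖ → J y = J z) {α : ℝ} {p q : E N}
    (hpq : ‖p‖ = ‖q‖) :
    (p ∈ effDom J ↔ q ∈ effDom J) ∧
    realHam (α • (1 : Matrix (Fin N) (Fin N) ℝ)) 0 J p =
      realHam (α • (1 : Matrix (Fin N) (Fin N) ℝ)) 0 J q := by
  set R : E N ≃ₗᵢ[ℝ] E N := (Submodule.span ℝ {p - q})ᗮ.reflection
  have hR : R p = q := Submodule.reflection_sub hpq
  have hcomp : integrand J p = integrand J q ∘ R := by
    ext y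
    have h1 : (inner ℝ q (R y) : ℝ) = inner ℝ p y := by
      rw [← hR]; exact R.inner_map_map p y
    have h2 : J (R y) = J y := hrad _ _ (R.norm_map y)
    simp only [Function.comp, integrand_eq, h2]
    congr 1
    rcases lt_or_ge ‖y‖ 1 with hy | hy
    · rw [levyFactor_of_lt hy, levyFactor_of_lt (by rwa [R.norm_map]), h1]
    · rw [levyFactor_of_le hy, levyFactor_of_le (by rwa [R.norm_map]), h1]
  have hmp : MeasurePreserving R volume volume := R.measurePreserving
  have hemb : MeasurableEmbedding R := R.toHomeomorph.measurableEmbedding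
  have hquad : ∀ p : E N, quadPart (α • (1 : Matrix (Fin N) (Fin N) ℝ)) 0 p = α * ‖p‖ ^ 2 := by
    intro p
    rw [quadPart_eq, EuclideanSpace.norm_sq_eq]
    simp [Matrix.smul_mulVec, dotProduct, Finset.mul_sum, pow_two, mul_left_comm]
  constructor
  · change Integrable (integrand J p) ↔ Integrable (integrand J q)
    rw [hcomp, hmp.integrable_comp_emb hemb]
  · rw [realHam, realHam, hquad, hquad, hpq, hcomp]
    congr 1
    exact hmp.integral_comp hemb _

/-! ### The Lagrangian -/

/-- The properties of the Hamiltonian on which the theory rests: `H` is the extension by `+∞` of a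
strictly convex function `h` with closed epigraph, bounded below, vanishing at the origin, whose
effective domain `D` lies between the open and the closed unit ball, and which is bounded on smaller
balls. -/
structure IsCriticalHamiltonian (H : E N → EReal) (D : Set (E N)) (h : E N → ℝ) : Prop where
  eq_coe : ∀ p ∈ D, H p = (h p : EReal)
  eq_top : ∀ p, p ∉ D → H p = ⊤
  mem : ∀ p, ‖p‖ < 1 → p ∈ D
  norm_le : ∀ p ∈ D, ‖p‖ ≤ 1
  exists_ge : ∃ c : ℝ, ∀ p ∈ D, c ≤ h p
  exists_le : ∀ ρ : ℝ, ρ < 1 → ∃ C : ℝ, ∀ p, ‖p‖ ≤ ρ → h p ≤ C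
  strictConvexOn : StrictConvexOn ℝ D h
  closed : ∀ (p : ℕ → E N) (p₀ : E N) (c : ℝ), (∀ n, p n ∈ D) → Tendsto p atTop (𝓝 p₀) →
    Tendsto (fun n => h (p n)) atTop (𝓝 c) → p₀ ∈ D ∧ h p₀ ≤ c
  map_zero : h 0 = 0

lemma IsCriticalKernel.isCriticalHamiltonian {A : Matrix (Fin N) (Fin N) ℝ}
    (hA : ∀ v : Fin N → ℝ, 0 ≤ v ⬝ᵥ A.mulVec v) (B : E N) {J : E N → ℝ}
    (hJ : IsCriticalKernel J) :
    IsCriticalHamiltonian (hamiltonian A B J) (effDom J) (realHam A B J) where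
  eq_coe _ hp := hamiltonian_of_mem hp
  eq_top _ hp := hamiltonian_of_notMem hp
  mem _ hp := hJ.mem_effDom hp
  norm_le _ hp := hJ.norm_le_one_of_mem hp
  exists_ge := hJ.exists_le_realHam hA
  exists_le _ hρ := hJ.exists_realHam_le hρ
  strictConvexOn := hJ.strictConvexOn_realHam hA
  closed _ _ _ hp hl hc := hJ.realHam_le_of_tendsto hp hl hc
  map_zero := realHam_zero

open Classical in
/-- The point at which `sup_p {p·q - H(p)}` is attained (`0` if there is none). -/
def maximizer (D : Set (E N)) (h : E N → ℝ) (q : E N) : E N :=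
  if hq : ∃ p ∈ D, ∀ p' ∈ D, (inner ℝ p' q : ℝ) - h p' ≤ inner ℝ p q - h p then hq.choose else 0

/-- The Lagrangian as a real function. -/
def realLag (D : Set (E N)) (h : E N → ℝ) (q : E N) : ℝ :=
  inner ℝ (maximizer D h q) q - h (maximizer D h q)

namespace IsCriticalHamiltonian

variable {H : E N → EReal} {D : Set (E N)} {h : E N → ℝ} (hH : IsCriticalHamiltonian H D h)
include hH

lemma zero_mem : (0 : E N) ∈ D := hH.mem 0 (by simp)

/-- The supremum defining the Lagrangian is attained: the effective domain is bounded and the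
epigraph of the Hamiltonian is closed. -/
lemma exists_maximizer (q : E N) :
    ∃ p ∈ D, ∀ p' ∈ D, (inner ℝ p' q : ℝ) - h p' ≤ inner ℝ p q - h p := by
  obtain ⟨c, hc⟩ := hH.exists_ge
  set S : Set ℝ := (fun p => (inner ℝ p q : ℝ) - h p) '' D
  have hne : S.Nonempty := ⟨_, 0, hH.zero_mem, rfl⟩
  have hbdd : BddAbove S := by
    refine ⟨‖q‖ - c, ?_⟩
    rintro _ ⟨p, hp, rfl⟩
    have h1 := real_inner_le_norm p q
    have h2 : ‖p‖ * ‖q‖ ≤ 1 * ‖q‖ := by gcongr; exact hH.norm_le p hp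
    have := hc p hp
    simp only; linarith
  obtain ⟨u, -, hu, huS⟩ := exists_seq_tendsto_sSup hne hbdd
  choose p hpD hpu using huS
  obtain ⟨p₀, -, φ, hφ, hlim⟩ := (isCompact_closedBall (0 : E N) 1).tendsto_subseq
    (fun n => by simpa using hH.norm_le _ (hpD n) : ∀ n, p n ∈ Metric.closedBall (0 : E N) 1)
  have hh : Tendsto (fun n => h ((p ∘ φ) n)) atTop (𝓝 (inner ℝ p₀ q - sSup S)) := by
    have h1 : (fun n => h ((p ∘ φ) n)) = fun n => (inner ℝ ((p ∘ φ) n) q : ℝ) - u (φ n) := by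
      ext n
      have := hpu (φ n)
      simp only [Function.comp] at this ⊢; linarith
    rw [h1]
    exact (hlim.inner tendsto_const_nhds).sub (hu.comp hφ.tendsto_atTop)
  obtain ⟨hm, hle⟩ := hH.closed _ _ _ (fun n => hpD (φ n)) hlim hh
  refine ⟨p₀, hm, fun p' hp' => ?_⟩
  have := le_csSup hbdd (Set.mem_image_of_mem _ hp' : (inner ℝ p' q : ℝ) - h p' ∈ S)
  linarith

lemma maximizer_mem (q : E N) : maximizer D h q ∈ D := by
  rw [maximizer, dif_pos (hH.exists_maximizer q)]
  exact (hH.exists_maximizer q).choose_spec.1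

/-- The Fenchel inequality. -/
lemma le_realLag {p : E N} (hp : p ∈ D) (q : E N) : (inner ℝ p q : ℝ) - h p ≤ realLag D h q := by
  rw [realLag, maximizer, dif_pos (hH.exists_maximizer q)]
  exact (hH.exists_maximizer q).choose_spec.2 p hp

lemma eq_maximizer {p q : E N} (hp : p ∈ D) (hle : realLag D h q ≤ inner ℝ p q - h p) :
    p = maximizer D h q := by
  by_contra hne
  have hm := hH.maximizer_mem q
  have h1 := hH.strictConvexOn.2 hp hm hne (by norm_num : (0 : ℝ) < 1 / 2)
    (by norm_num : (0 : ℝ) < 1 / 2) (by norm_num)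
  have h2 := hH.le_realLag (hH.strictConvexOn.1 hp hm (by norm_num : (0 : ℝ) ≤ 1 / 2)
    (by norm_num : (0 : ℝ) ≤ 1 / 2) (by norm_num)) q
  rw [inner_add_left, inner_smul_left, inner_smul_left] at h2
  simp only [smul_eq_mul, conj_trivial] at h1 h2
  have h3 : realLag D h q = inner ℝ (maximizer D h q) q - h (maximizer D h q) := rfl
  linarith

lemma lagrangian_eq (q : E N) : lagrangian H q = (realLag D h q : EReal) := by
  refine le_antisymm (iSup_le fun p => ?_) ?_
  · by_cases hp : p ∈ D
    · rw [hH.eq_coe p hp]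
      exact_mod_cast hH.le_realLag hp q
    · rw [hH.eq_top p hp]; simp
  · refine le_trans ?_ (le_iSup (fun p => ((inner ℝ p q : ℝ) : EReal) - H p) (maximizer D h q))
    rw [hH.eq_coe _ (hH.maximizer_mem q), realLag]
    exact_mod_cast le_rfl

/-- The maximizer at `q` is a subgradient of the Lagrangian at `q`. -/
lemma inner_maximizer_le (q q' : E N) :
    (inner ℝ (maximizer D h q) (q' - q) : ℝ) ≤ realLag D h q' - realLag D h q := by
  have h1 := hH.le_realLag (hH.maximizer_mem q) q'
  have h3 : realLag D h q = inner ℝ (maximizer D h q) q - h (maximizer D h q) := rfl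
  rw [inner_sub_right]; linarith

lemma norm_maximizer_le (q : E N) : ‖maximizer D h q‖ ≤ 1 := hH.norm_le _ (hH.maximizer_mem q)

lemma lipschitzWith_realLag : LipschitzWith 1 (realLag D h) := by
  refine LipschitzWith.of_le_add fun q q' => ?_
  have h1 := hH.inner_maximizer_le q q'
  have h2 := (abs_le.1 (abs_real_inner_le_norm (maximizer D h q) (q' - q))).1
  have h3 : ‖maximizer D h q‖ * ‖q' - q‖ ≤ 1 * ‖q' - q‖ := by
    gcongr; exact hH.norm_maximizer_le q
  rw [dist_eq_norm, norm_sub_rev]; linarith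

lemma continuous_maximizer : Continuous (maximizer D h) := by
  rw [continuous_iff_seqContinuous]
  intro q q₀ hq
  refine tendsto_of_subseq_tendsto fun ns hns => ?_
  obtain ⟨p₀, -, φ, hφ, hlim⟩ := (isCompact_closedBall (0 : E N) 1).tendsto_subseq
    (fun n => by simpa using hH.norm_maximizer_le (q (ns n)) :
      ∀ n, maximizer D h (q (ns n)) ∈ Metric.closedBall (0 : E N) 1)
  refine ⟨φ, ?_⟩
  have hq' : Tendsto (fun n => q (ns (φ n))) atTop (𝓝 q₀) :=
    hq.comp (hns.comp hφ.tendsto_atTop)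
  have hh : Tendsto (fun n => h (maximizer D h (q (ns (φ n))))) atTop
      (𝓝 (inner ℝ p₀ q₀ - realLag D h q₀)) := by
    have h1 : (fun n => h (maximizer D h (q (ns (φ n))))) = fun n =>
        (inner ℝ (maximizer D h (q (ns (φ n)))) (q (ns (φ n))) : ℝ) -
          realLag D h (q (ns (φ n))) := by
      ext n; rw [realLag]; ring
    rw [h1]
    exact (hlim.inner hq').sub ((hH.lipschitzWith_realLag.continuous.tendsto q₀).comp hq')
  obtain ⟨hm, hle⟩ := hH.closed _ _ _ (fun n => hH.maximizer_mem _) hlim hh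
  rw [← hH.eq_maximizer hm (q := q₀) (by linarith)]
  exact hlim

/-- As the maximizer is unique, it depends continuously on `q`, and it is the gradient of the
Lagrangian. -/
lemma hasGradientAt_realLag (q : E N) : HasGradientAt (realLag D h) (maximizer D h q) q := by
  rw [hasGradientAt_iff_isLittleO, Asymptotics.isLittleO_iff]
  intro ε hε
  have hc := (Metric.continuous_iff.1 hH.continuous_maximizer) q ε hε
  obtain ⟨δ, hδ, hd⟩ := hc
  filter_upwards [Metric.ball_mem_nhds q hδ] with q' hq'
  have h1 := hH.inner_maximizer_le q q'
  have h2 := hH.inner_maximizer_le q' q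
  have h3 : (inner ℝ (maximizer D h q') (q - q') : ℝ) =
      -inner ℝ (maximizer D h q' - maximizer D h q) (q' - q) -
        inner ℝ (maximizer D h q) (q' - q) := by
    rw [← neg_sub q' q, inner_neg_right, inner_sub_left]; ring
  have h4 := abs_real_inner_le_norm (maximizer D h q' - maximizer D h q) (q' - q)
  have h5 := hd q' hq'
  rw [dist_eq_norm] at h5
  have h6 : ‖maximizer D h q' - maximizer D h q‖ * ‖q' - q‖ ≤ ε * ‖q' - q‖ := by gcongr
  have := abs_le.1 h4
  rw [Real.norm_eq_abs, abs_le]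
  constructor <;> nlinarith [norm_nonneg (q' - q)]

lemma realLag_nonneg (q : E N) : 0 ≤ realLag D h q := by
  have := hH.le_realLag hH.zero_mem q
  rw [hH.map_zero] at this; simpa using this

lemma exists_realLag_le : ∃ C : ℝ, 0 ≤ C ∧ ∀ q, realLag D h q ≤ ‖q‖ + C := by
  refine ⟨realLag D h 0, hH.realLag_nonneg 0, fun q => ?_⟩
  have := (abs_le.1 (hH.lipschitzWith_realLag.dist_le_mul q 0)).2
  simp at this; linarith

lemma exists_le_realLag {ρ : ℝ} (h0 : 0 ≤ ρ) (hρ : ρ < 1) :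
    ∃ C : ℝ, 0 ≤ C ∧ ∀ q, ρ * ‖q‖ - C ≤ realLag D h q := by
  obtain ⟨C, hC⟩ := hH.exists_le ρ hρ
  refine ⟨max C 0, le_max_right _ _, fun q => ?_⟩
  have hn : ‖(ρ / ‖q‖) • q‖ ≤ ρ := by
    rw [norm_smul, norm_div, norm_norm, Real.norm_eq_abs, abs_of_nonneg h0]
    rcases eq_or_ne ‖q‖ 0 with hq | hq
    · simp [hq, h0]
    · field_simp; rfl
  have h1 := hH.le_realLag (hH.mem _ (hn.trans_lt hρ)) q
  have h2 := hC _ hn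
  have h3 : (inner ℝ ((ρ / ‖q‖) • q) q : ℝ) = ρ * ‖q‖ := by
    rw [inner_smul_left, real_inner_self_eq_norm_sq]
    rcases eq_or_ne ‖q‖ 0 with hq | hq
    · simp [hq]
    · simp; field_simp
  linarith [le_max_left C 0]

lemma isEquivalent_realLag :
    Asymptotics.IsEquivalent (Bornology.cobounded (E N)) (realLag D h) (fun q => ‖q‖) := by
  rw [Asymptotics.IsEquivalent, Asymptotics.isLittleO_iff]
  intro ε hε
  obtain ⟨C₁, h1, hC₁⟩ := hH.exists_realLag_le
  set ρ := max 0 (1 - ε / 2)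
  have hρ0 : 0 ≤ ρ := le_max_left _ _
  have hρ : ρ < 1 := max_lt one_pos (by linarith)
  obtain ⟨C₂, h2, hC₂⟩ := hH.exists_le_realLag hρ0 hρ
  have hev : ∀ᶠ q in Bornology.cobounded (E N), (C₁ + C₂) / (ε / 2) ≤ ‖q‖ :=
    tendsto_norm_cobounded_atTop.eventually_ge_atTop _
  filter_upwards [hev] with q hq
  rw [div_le_iff₀ (by linarith)] at hq
  have h3 := hC₁ q
  have h4 := hC₂ q
  have h5 : (1 - ε / 2) * ‖q‖ ≤ ρ * ‖q‖ := by gcongr; exact le_max_right _ _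
  simp only [Pi.sub_apply, norm_norm]
  rw [Real.norm_eq_abs, abs_le]
  constructor <;> nlinarith [norm_nonneg q]

end IsCriticalHamiltonian

/-! ### Derivatives of test functions -/

section Calculus

variable {V : Type*} [NormedAddCommGroup V] [InnerProductSpace ℝ V] [CompleteSpace V]
  {f g : V → ℝ} {p q x : V}

lemma hasGradientAt_add (hf : HasGradientAt f p x) (hg : HasGradientAt g q x) :
    HasGradientAt (fun y => f y + g y) (p + q) x := by
  rw [hasGradientAt_iff_hasFDerivAt] at *
  rw [map_add]; exact hf.add hg

lemma hasGradientAt_add_const (hf : HasGradientAt f p x) (c : ℝ) :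
    HasGradientAt (fun y => f y + c) p x := by
  simpa using hasGradientAt_add hf (hasGradientAt_const x c)

lemma hasGradientAt_comp {k : ℝ → ℝ} {k' : ℝ} (hk : HasDerivAt k k' (f x))
    (hf : HasGradientAt f p x) : HasGradientAt (fun y => k (f y)) (k' • p) x := by
  rw [hasGradientAt_iff_hasFDerivAt] at *
  rw [map_smul]; exact hk.comp_hasFDerivAt x hf

lemma hasGradientAt_inner_left (v x : V) : HasGradientAt (fun y => (inner ℝ v y : ℝ)) v x := by
  rw [hasGradientAt_iff_hasFDerivAt]
  exact (innerSL ℝ v).hasFDerivAt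

lemma hasGradientAt_norm_sub_sq (v x : V) :
    HasGradientAt (fun y => ‖y - v‖ ^ 2) ((2 : ℝ) • (x - v)) x := by
  rw [hasGradientAt_iff_hasFDerivAt]
  have h1 : HasFDerivAt (fun y : V => y - v) (ContinuousLinearMap.id ℝ V) x :=
    (hasFDerivAt_id x).sub_const v
  refine h1.norm_sq.congr_fderiv ?_
  ext w
  simp

end Calculus

lemma timeDeriv_eq {φ : E N × ℝ → ℝ} {z : E N × ℝ} {τ : ℝ}
    (h : HasDerivAt (fun s => φ (z.1, s)) τ z.2) : timeDeriv φ z = τ := h.deriv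

lemma spaceGrad_eq {φ : E N × ℝ → ℝ} {z : E N × ℝ} {p : E N}
    (h : HasGradientAt (fun y => φ (y, z.2)) p z.1) : spaceGrad φ z = p := h.gradient

lemma hasDerivAt_timeDeriv {φ : E N × ℝ → ℝ} (hφ : ContDiff ℝ ∞ φ) (z : E N × ℝ) :
    HasDerivAt (fun s => φ (z.1, s)) (timeDeriv φ z) z.2 := by
  have h : ContDiff ℝ ∞ (fun s => φ (z.1, s)) := hφ.comp (by fun_prop)
  exact ((h.differentiable (by simp)) z.2).hasDerivAt

lemma hasGradientAt_spaceGrad {φ : E N × ℝ → ℝ} (hφ : ContDiff ℝ ∞ φ) (z : E N × ℝ) :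
    HasGradientAt (fun y => φ (y, z.2)) (spaceGrad φ z) z.1 := by
  have h : ContDiff ℝ ∞ (fun y => φ (y, z.2)) := hφ.comp (by fun_prop)
  exact ((h.differentiable (by simp)) z.1).hasGradientAt

lemma le_of_hasDerivAt_of_eventually_le {k : ℝ → ℝ} {k' c : ℝ} (hk : HasDerivAt k k' 0)
    (h : ∀ᶠ s in 𝓝[>] 0, k s - k 0 ≤ s * c) : k' ≤ c := by
  refine le_of_tendsto hk.tendsto_slope_zero_right ?_
  filter_upwards [h, self_mem_nhdsWithin] with s hs hs0
  have hs0 : 0 < s := hs0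
  rw [zero_add, smul_eq_mul, inv_mul_le_iff₀ hs0]
  exact hs

lemma ge_of_hasDerivAt_of_eventually_ge {k : ℝ → ℝ} {k' c : ℝ} (hk : HasDerivAt k k' 0)
    (h : ∀ᶠ s in 𝓝[>] 0, s * c ≤ k s - k 0) : c ≤ k' := by
  refine ge_of_tendsto hk.tendsto_slope_zero_right ?_
  filter_upwards [h, self_mem_nhdsWithin] with s hs hs0
  have hs0 : 0 < s := hs0
  rw [zero_add, smul_eq_mul, le_inv_mul_iff₀ hs0]
  exact hs

lemma hasDerivAt_line {φ : E N → ℝ} {x p : E N} (hφ : HasGradientAt φ p x) (v : E N) :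
    HasDerivAt (fun s : ℝ => φ (x + s • v)) (inner ℝ p v) 0 := by
  have h1 : HasDerivAt (fun s : ℝ => x + s • v) v 0 := by
    simpa using ((hasDerivAt_id (0 : ℝ)).smul_const v).const_add x
  have h2 : HasFDerivAt φ (InnerProductSpace.toDual ℝ (E N) p) (x + (0 : ℝ) • v) := by
    simpa using hφ.hasFDerivAt
  exact h2.comp_hasDerivAt 0 h1

lemma hasDerivAt_spaceTime_line {φ : E N × ℝ → ℝ} (hφ : ContDiff ℝ ∞ φ) (z : E N × ℝ) (v : E N)
    (σ : ℝ) : HasDerivAt (fun s : ℝ => φ (z.1 + s • v, z.2 + s * σ))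
      (inner ℝ (spaceGrad φ z) v + σ * timeDeriv φ z) 0 := by
  have hF : HasFDerivAt φ (fderiv ℝ φ z) z := ((hφ.differentiable (by simp)) z).hasFDerivAt
  have e1 : (inner ℝ (spaceGrad φ z) v : ℝ) = fderiv ℝ φ z (v, 0) := by
    have h1 : HasFDerivAt (fun y : E N => (y, z.2))
        (ContinuousLinearMap.inl ℝ (E N) ℝ) z.1 := hasFDerivAt_prodMk_left z.1 z.2
    have h2 : HasFDerivAt (fun y => φ (y, z.2))
        ((fderiv ℝ φ z).comp (ContinuousLinearMap.inl ℝ (E N) ℝ)) z.1 := hF.comp z.1 h1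
    rw [(hasGradientAt_spaceGrad hφ z).hasFDerivAt.unique h2 |> fun h =>
      show (inner ℝ (spaceGrad φ z) v : ℝ) = _ from congrArg (fun L => L v) h]
    simp
  have e2 : timeDeriv φ z = fderiv ℝ φ z (0, 1) := by
    have h1 : HasDerivAt (fun s : ℝ => (z.1, s)) ((0 : E N), (1 : ℝ)) z.2 :=
      (hasDerivAt_const _ _).prodMk (hasDerivAt_id _)
    exact (hasDerivAt_timeDeriv hφ z).unique (hF.comp_hasDerivAt z.2 h1)
  have h1 : HasDerivAt (fun s : ℝ => (z.1 + s • v, z.2 + s * σ)) (v, σ) 0 := by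
    refine HasDerivAt.prodMk ?_ ?_
    · simpa using ((hasDerivAt_id (0 : ℝ)).smul_const v).const_add z.1
    · simpa using ((hasDerivAt_id (0 : ℝ)).mul_const σ).const_add z.2
  have h2 : HasFDerivAt φ (fderiv ℝ φ z) (z.1 + (0 : ℝ) • v, z.2 + 0 * σ) := by simpa using hF
  refine (h2.comp_hasDerivAt 0 h1).congr_deriv ?_
  rw [e1, e2, ← smul_eq_mul, ← map_smul, ← map_add]
  simp

/-! ### The cylinder and the semicontinuous envelopes -/

lemma mem_cyl {z : E N × ℝ} : z ∈ cyl N ↔ ‖z.1‖ < 1 ∧ 0 < z.2 := by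
  simp [cyl, Set.mem_prod]

lemma mem_closedCyl {z : E N × ℝ} : z ∈ closedCyl N ↔ ‖z.1‖ ≤ 1 ∧ 0 ≤ z.2 := by
  simp [closedCyl, Set.mem_prod]

lemma mem_parBdry {z : E N × ℝ} :
    z ∈ parBdry N ↔ (‖z.1‖ = 1 ∧ 0 ≤ z.2) ∨ (‖z.1‖ < 1 ∧ z.2 = 0) := by
  simp [parBdry, Set.mem_prod]

lemma cyl_subset_closedCyl : cyl N ⊆ closedCyl N := fun z hz => by
  rw [mem_cyl] at hz; exact mem_closedCyl.2 ⟨hz.1.le, hz.2.le⟩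

lemma parBdry_subset_closedCyl : parBdry N ⊆ closedCyl N := fun z hz => by
  rw [mem_parBdry] at hz
  rw [mem_closedCyl]
  rcases hz with h | h
  · exact ⟨h.1.le, h.2⟩
  · exact ⟨h.1.le, h.2.ge⟩

lemma mem_cyl_or_mem_parBdry {z : E N × ℝ} (hz : z ∈ closedCyl N) : z ∈ cyl N ∨ z ∈ parBdry N := by
  rw [mem_closedCyl] at hz
  rw [mem_cyl, mem_parBdry]
  rcases hz.1.lt_or_eq with h | h
  · rcases hz.2.lt_or_eq with h' | h'
    · exact Or.inl ⟨h, h'⟩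
    · exact Or.inr (Or.inr ⟨h, h'.symm⟩)
  · exact Or.inr (Or.inl ⟨h, hz.2⟩)

lemma isOpen_cyl : IsOpen (cyl N) := Metric.isOpen_ball.prod isOpen_Ioi

lemma closure_cyl : closure (cyl N) = closedCyl N := by
  rw [cyl, closure_prod_eq, closure_Ioi, closure_ball _ one_ne_zero]; rfl

lemma neBot_nhdsWithin_cyl {z : E N × ℝ} (hz : z ∈ closedCyl N) : (𝓝[cyl N] z).NeBot := by
  rwa [← mem_closure_iff_nhdsWithin_neBot, closure_cyl]

section Envelopes

variable {u : E N × ℝ → ℝ} {z : E N × ℝ} {c : ℝ}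

lemma isBoundedUnder_le_of_abs (h : ∃ C : ℝ, ∀ᶠ w in 𝓝[cyl N] z, |u w| ≤ C) :
    (𝓝[cyl N] z).IsBoundedUnder (· ≤ ·) u := by
  obtain ⟨C, hC⟩ := h
  exact isBoundedUnder_of_eventually_le (hC.mono fun w hw => (abs_le.1 hw).2)

lemma isBoundedUnder_ge_of_abs (h : ∃ C : ℝ, ∀ᶠ w in 𝓝[cyl N] z, |u w| ≤ C) :
    (𝓝[cyl N] z).IsBoundedUnder (· ≥ ·) u := by
  obtain ⟨C, hC⟩ := h
  exact isBoundedUnder_of_eventually_ge (hC.mono fun w hw => (abs_le.1 hw).1)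

lemma le_upperEnv (h : ∃ C : ℝ, ∀ᶠ w in 𝓝[cyl N] z, |u w| ≤ C) (hz : z ∈ cyl N) :
    u z ≤ upperEnv u z := by
  refine le_limsup_of_le (isBoundedUnder_le_of_abs h) fun b hb => ?_
  exact (eventually_nhdsWithin_iff.1 hb).self_of_nhds hz

lemma lowerEnv_le (h : ∃ C : ℝ, ∀ᶠ w in 𝓝[cyl N] z, |u w| ≤ C) (hz : z ∈ cyl N) :
    lowerEnv u z ≤ u z := by
  refine liminf_le_of_le (isBoundedUnder_ge_of_abs h) fun b hb => ?_
  exact (eventually_nhdsWithin_iff.1 hb).self_of_nhds hz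

lemma upperEnv_le (h : ∃ C : ℝ, ∀ᶠ w in 𝓝[cyl N] z, |u w| ≤ C) (hz : z ∈ closedCyl N)
    (hc : ∀ ε > 0, ∀ᶠ w in 𝓝[cyl N] z, u w ≤ c + ε) : upperEnv u z ≤ c := by
  have := neBot_nhdsWithin_cyl hz
  refine le_of_forall_pos_le_add fun ε hε => ?_
  exact limsup_le_of_le (isBoundedUnder_ge_of_abs h).isCoboundedUnder_le (hc ε hε)

lemma upperEnv_eq_of_tendsto (hz : z ∈ closedCyl N) (h : Tendsto u (𝓝[cyl N] z) (𝓝 c)) :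
    upperEnv u z = c := by
  have := neBot_nhdsWithin_cyl hz
  exact h.limsup_eq

lemma lowerEnv_eq_of_tendsto (hz : z ∈ closedCyl N) (h : Tendsto u (𝓝[cyl N] z) (𝓝 c)) :
    lowerEnv u z = c := by
  have := neBot_nhdsWithin_cyl hz
  exact h.liminf_eq

lemma tendsto_of_envelopes (h : ∃ C : ℝ, ∀ᶠ w in 𝓝[cyl N] z, |u w| ≤ C)
    (h1 : upperEnv u z ≤ c) (h2 : c ≤ lowerEnv u z) : Tendsto u (𝓝[cyl N] z) (𝓝 c) :=
  tendsto_of_le_liminf_of_limsup_le h2 h1 (isBoundedUnder_le_of_abs h)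
    (isBoundedUnder_ge_of_abs h)

end Envelopes

/-! ### Contact with strict barriers -/

namespace IsCriticalHamiltonian

variable {H : E N → EReal} {D : Set (E N)} {h : E N → ℝ} (hH : IsCriticalHamiltonian H D h)
include hH

/-- The gradient constraint provides strictness for `|p| > 1`, so that the Hamiltonian matters only
on the closed unit ball. -/
lemma modOp_pos {τ : ℝ} {p : E N} (hp : p ∈ D → ‖p‖ ≤ 1 → 0 < τ + h p) : 0 < modOp H τ p := by
  refine lt_max_iff.2 ?_
  rcases lt_or_ge 1 ‖p‖ with h1 | h1
  · right
    exact_mod_cast sub_pos.2 h1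
  · left
    by_cases hpD : p ∈ D
    · rw [hH.eq_coe p hpD]
      exact_mod_cast hp hpD h1
    · rw [hH.eq_top p hpD, EReal.coe_add_top]
      exact EReal.zero_lt_top

lemma modOp_neg {τ : ℝ} {p : E N} (hp : ‖p‖ < 1) (hτ : τ + h p < 0) : modOp H τ p < 0 := by
  refine max_lt ?_ ?_
  · rw [hH.eq_coe p (hH.mem p hp)]
    exact_mod_cast hτ
  · exact_mod_cast sub_neg.2 hp

end IsCriticalHamiltonian

variable {F : ℝ → E N → EReal} {f u ψ : E N × ℝ → ℝ}

/-- Contact points of a subsolution with a strict barrier lie on the parabolic boundary, and the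
subsolution does not exceed its data there. -/
lemma IsSubsolution.contact (hu : IsSubsolution F f u) {φ : E N × ℝ → ℝ} (hφ : ContDiff ℝ ∞ φ)
    {z : E N × ℝ} (hz : z ∈ closedCyl N)
    (hmax : IsLocalMaxOn (fun w => u w - φ w) (closedCyl N) z)
    (hF : 0 < F (timeDeriv φ z) (spaceGrad φ z)) : z ∈ parBdry N ∧ u z ≤ f z := by
  obtain ⟨h1, h2⟩ := hu.2 φ hφ z hz hmax
  rcases mem_cyl_or_mem_parBdry hz with hc | hc
  · exact absurd (h1 hc) (not_le.2 hF)
  · refine ⟨hc, ?_⟩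
    rcases min_le_iff.1 (h2 hc) with h3 | h3
    · exact absurd h3 (not_le.2 hF)
    · have : u z - f z ≤ 0 := by exact_mod_cast h3
      linarith

lemma IsSupersolution.contact (hu : IsSupersolution F f u) {φ : E N × ℝ → ℝ}
    (hφ : ContDiff ℝ ∞ φ) {z : E N × ℝ} (hz : z ∈ closedCyl N)
    (hmin : IsLocalMinOn (fun w => u w - φ w) (closedCyl N) z)
    (hF : F (timeDeriv φ z) (spaceGrad φ z) < 0) : z ∈ parBdry N ∧ f z ≤ u z := by
  obtain ⟨h1, h2⟩ := hu.2 φ hφ z hz hmin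
  rcases mem_cyl_or_mem_parBdry hz with hc | hc
  · exact absurd (h1 hc) (not_le.2 hF)
  · refine ⟨hc, ?_⟩
    rcases le_max_iff.1 (h2 hc) with h3 | h3
    · exact absurd h3 (not_le.2 hF)
    · have : 0 ≤ u z - f z := by exact_mod_cast h3
      linarith

lemma isCompact_slab (T : ℝ) : IsCompact (Metric.closedBall (0 : E N) 1 ×ˢ Set.Icc 0 T) :=
  (isCompact_closedBall _ _).prod isCompact_Icc

lemma slab_subset (T : ℝ) : Metric.closedBall (0 : E N) 1 ×ˢ Set.Icc 0 T ⊆ closedCyl N :=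
  Set.prod_mono le_rfl Set.Icc_subset_Ici_self

/-- If `u` lies below the barrier `ψ` at the final time and at every local contact point from above
strictly before the final time, then it lies below `ψ` throughout. -/
lemma le_barrier (hu : UpperSemicontinuousOn u (closedCyl N)) (hψ : Continuous ψ) {T : ℝ}
    (htop : ∀ z ∈ closedCyl N, z.2 = T → u z ≤ ψ z)
    (hcontact : ∀ z ∈ closedCyl N, z.2 < T →
      IsLocalMaxOn (fun w => u w - ψ w) (closedCyl N) z → u z ≤ ψ z)
    {z : E N × ℝ} (hz : z ∈ closedCyl N) (hzT : z.2 ≤ T) : u z ≤ ψ z := by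
  set K := Metric.closedBall (0 : E N) 1 ×ˢ Set.Icc (0 : ℝ) T
  have hzK : z ∈ K := ⟨hz.1, hz.2, hzT⟩
  have husc : UpperSemicontinuousOn (fun w => u w - ψ w) K := by
    simp only [sub_eq_add_neg]
    exact (hu.mono (slab_subset T)).add (hψ.neg.upperSemicontinuous.upperSemicontinuousOn K)
  obtain ⟨m, hmK, hm⟩ := husc.exists_isMaxOn ⟨z, hzK⟩ (isCompact_slab T)
  have hmz : u z - ψ z ≤ u m - ψ m := hm hzK
  have hmc : m ∈ closedCyl N := slab_subset T hmK
  suffices u m ≤ ψ m by linarith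
  rcases hmK.2.2.lt_or_eq with h | h
  · refine hcontact m hmc h ?_
    have hev : ∀ᶠ w : E N × ℝ in 𝓝 m, w.2 < T := (continuous_snd.tendsto m).eventually_lt_const h
    change ∀ᶠ w in 𝓝[closedCyl N] m, _
    filter_upwards [nhdsWithin_le_nhds hev, self_mem_nhdsWithin] with w hw hw'
    exact hm ⟨hw'.1, hw'.2, le_of_lt hw⟩
  · exact htop m hmc h

lemma timeDeriv_neg (ψ : E N × ℝ → ℝ) (z : E N × ℝ) :
    timeDeriv (fun w => -ψ w) z = -timeDeriv ψ z := deriv.fun_neg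

lemma spaceGrad_neg (ψ : E N × ℝ → ℝ) (z : E N × ℝ) :
    spaceGrad (fun w => -ψ w) z = -spaceGrad ψ z := by
  simp only [spaceGrad, gradient, fderiv_fun_neg, map_neg]

/-- The counterpart of `le_barrier` for barriers from below. -/
lemma barrier_le (hu : LowerSemicontinuousOn u (closedCyl N)) (hψ : Continuous ψ) {T : ℝ}
    (htop : ∀ z ∈ closedCyl N, z.2 = T → ψ z ≤ u z)
    (hcontact : ∀ z ∈ closedCyl N, z.2 < T →
      IsLocalMinOn (fun w => u w - ψ w) (closedCyl N) z → ψ z ≤ u z)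
    {z : E N × ℝ} (hz : z ∈ closedCyl N) (hzT : z.2 ≤ T) : ψ z ≤ u z := by
  refine neg_le_neg_iff.1 (le_barrier (u := fun w => -u w) (ψ := fun w => -ψ w) (T := T) ?_ hψ.neg
    (fun w hw hT => neg_le_neg (htop w hw hT)) (fun w hw hT hmax => neg_le_neg
      (hcontact w hw hT ?_)) hz hzT)
  · intro w hw y hy
    have := hu w hw (-y) (by linarith)
    filter_upwards [this] with a ha
    linarith
  · have := IsLocalMaxOn.neg hmax
    refine this.congr (Eventually.of_forall fun a => ?_) hw
    ring

/-- A barrier that does not degenerate in time may be used on an unbounded time interval: adding a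
function of time with positive derivative makes it strict and keeps contact points bounded. -/
lemma le_of_contact (hu : UpperSemicontinuousOn u (closedCyl N)) (hψ : ContDiff ℝ ∞ ψ)
    (hcontact : ∀ φ : E N × ℝ → ℝ, ContDiff ℝ ∞ φ → ∀ z ∈ closedCyl N, ψ z ≤ φ z →
      timeDeriv ψ z < timeDeriv φ z → spaceGrad φ z = spaceGrad ψ z →
      IsLocalMaxOn (fun w => u w - φ w) (closedCyl N) z → u z ≤ ψ z)
    {z : E N × ℝ} (hz : z ∈ closedCyl N) : u z ≤ ψ z := by
  refine le_of_forall_pos_le_add fun ε hε => ?_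
  obtain ⟨M, hM⟩ : ∃ M : ℝ, ∀ w ∈ closedCyl N, w.2 = z.2 + 1 → u w - ψ w ≤ M := by
    have husc : UpperSemicontinuousOn (fun w => u w - ψ w)
        (Metric.closedBall (0 : E N) 1 ×ˢ Set.Icc (0 : ℝ) (z.2 + 1)) := by
      simp only [sub_eq_add_neg]
      exact (hu.mono (slab_subset _)).add
        (hψ.continuous.neg.upperSemicontinuous.upperSemicontinuousOn _)
    obtain ⟨M, hM⟩ := husc.bddAbove_of_isCompact (isCompact_slab _)
    exact ⟨M, fun w hw hwz => hM ⟨w, ⟨hw.1, hw.2, hwz.le⟩, rfl⟩⟩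
  set K := |M| + 1
  have hK : 0 < K := by positivity
  set k : ℝ → ℝ := fun s => ε * Real.exp (K / ε * (s - z.2))
  have hk0 : ∀ s, 0 < k s := fun s => by positivity
  have hk1 : k z.2 = ε := by simp [k]
  have hk2 : M ≤ k (z.2 + 1) := by
    have h1 := Real.add_one_le_exp (K / ε)
    have h2 : ε * (K / ε) ≤ ε * Real.exp (K / ε) := by gcongr; linarith
    have h3 : ε * (K / ε) = K := by field_simp
    have : k (z.2 + 1) = ε * Real.exp (K / ε) := by simp [k]
    rw [this]
    linarith [le_abs_self M]
  have hkd : ∀ s, HasDerivAt k (K * Real.exp (K / ε * (s - z.2))) s := fun s => by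
    have h1 : HasDerivAt (fun s => K / ε * (s - z.2)) (K / ε * 1) s :=
      ((hasDerivAt_id s).sub_const _).const_mul _
    refine (h1.exp.const_mul ε).congr_deriv ?_
    field_simp
  have hφ : ContDiff ℝ ∞ (fun w : E N × ℝ => ψ w + k w.2) := by
    refine hψ.add ?_
    simp only [k]; fun_prop
  have := le_barrier (ψ := fun w => ψ w + k w.2) (T := z.2 + 1) hu hφ.continuous
    (fun w hw hwT => by
      have := hM w hw hwT
      simp only [hwT]; linarith)
    (fun w hw hwT hmax => by
      have h1 : timeDeriv (fun w => ψ w + k w.2) w =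
          timeDeriv ψ w + K * Real.exp (K / ε * (w.2 - z.2)) :=
        timeDeriv_eq ((hasDerivAt_timeDeriv hψ w).add (hkd w.2))
      have h2 : spaceGrad (fun w => ψ w + k w.2) w = spaceGrad ψ w :=
        spaceGrad_eq (hasGradientAt_add_const (hasGradientAt_spaceGrad hψ w) (k w.2))
      have h3 := hcontact _ hφ w hw (by linarith [hk0 w.2])
        (by rw [h1]; linarith [mul_pos hK (Real.exp_pos (K / ε * (w.2 - z.2)))]) h2 hmax
      linarith [hk0 w.2]) hz (by linarith)
  simp only [hk1] at this
  exact this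

/-- The counterpart of `le_of_contact` for barriers from below. -/
lemma ge_of_contact (hu : LowerSemicontinuousOn u (closedCyl N)) (hψ : ContDiff ℝ ∞ ψ)
    (hcontact : ∀ φ : E N × ℝ → ℝ, ContDiff ℝ ∞ φ → ∀ z ∈ closedCyl N, φ z ≤ ψ z →
      timeDeriv φ z < timeDeriv ψ z → spaceGrad φ z = spaceGrad ψ z →
      IsLocalMinOn (fun w => u w - φ w) (closedCyl N) z → ψ z ≤ u z)
    {z : E N × ℝ} (hz : z ∈ closedCyl N) : ψ z ≤ u z := by
  refine neg_le_neg_iff.1 (le_of_contact (u := fun w => -u w) (ψ := fun w => -ψ w) ?_ hψ.neg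
    (fun φ hφ w hw h1 h2 h3 hmax => neg_le_neg
      (hcontact (fun w => -φ w) hφ.neg w hw (by linarith) ?_ ?_ ?_)) hz)
  · intro w hw y hy
    have := hu w hw (-y) (by linarith)
    filter_upwards [this] with a ha
    linarith
  · rw [timeDeriv_neg] at *; linarith
  · rw [spaceGrad_neg] at *; rw [h3, neg_neg]
  · have := IsLocalMaxOn.neg hmax
    refine this.congr (Eventually.of_forall fun a => ?_) hw
    ring

/-! ### Upper bounds near the initial time -/

lemma IsSubsolution.bddAbove_slab {F : ℝ → E N → EReal} {f u : E N × ℝ → ℝ}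
    (hu : IsSubsolution F f u) (T : ℝ) : ∃ M : ℝ, ∀ z ∈ closedCyl N, z.2 ≤ T → u z ≤ M := by
  obtain ⟨M, hM⟩ := (hu.1.mono (slab_subset T)).bddAbove_of_isCompact (isCompact_slab T)
  exact ⟨M, fun w hw hwT => hM ⟨w, ⟨hw.1, hw.2, hwT⟩, rfl⟩⟩

lemma IsSupersolution.bddBelow_slab {F : ℝ → E N → EReal} {f u : E N × ℝ → ℝ}
    (hu : IsSupersolution F f u) (T : ℝ) : ∃ M : ℝ, ∀ z ∈ closedCyl N, z.2 ≤ T → M ≤ u z := by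
  obtain ⟨M, hM⟩ := (hu.1.mono (slab_subset T)).bddBelow_of_isCompact (isCompact_slab T)
  exact ⟨M, fun w hw hwT => hM ⟨w, ⟨hw.1, hw.2, hwT⟩, rfl⟩⟩

/-- A gradient of norm larger than `1` pointing away from `y` keeps this property when a gradient
pointing away from the origin is added, provided the latter is small on `{|x| ≤ |y|}`. -/
lemma one_lt_norm_add {x y : E N} {α β m : ℝ} (hβ : 0 ≤ β) (hm : 1 < m)
    (hα : m ≤ α * ‖x - y‖) (hx : ‖x‖ ≤ 1) (hsmall : ‖x‖ ≤ ‖y‖ → β < m - 1) :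
    1 < ‖α • (x - y) + β • x‖ := by
  have hs : 0 < ‖x - y‖ := by
    by_contra! hs
    have : ‖x - y‖ = 0 := le_antisymm hs (norm_nonneg _)
    rw [this] at hα; linarith
  have hα0 : 0 < α := by
    by_contra! h0
    nlinarith
  rcases le_or_gt ‖x‖ ‖y‖ with hxy | hxy
  · have h1 := norm_sub_le_norm_add (α • (x - y)) (β • x)
    rw [norm_smul, norm_smul, Real.norm_eq_abs, Real.norm_eq_abs, abs_of_pos hα0,
      abs_of_nonneg hβ] at h1
    have h2 := hsmall hxy
    have h3 : β * ‖x‖ ≤ β * 1 := by gcongr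
    linarith
  · have h1 : (inner ℝ (α • (x - y) + β • x) (x - y) : ℝ) =
        α * ‖x - y‖ ^ 2 + β * (‖x‖ ^ 2 - inner ℝ x y) := by
      rw [inner_add_left, inner_smul_left, inner_smul_left, real_inner_self_eq_norm_sq,
        inner_sub_right, real_inner_self_eq_norm_sq]
      simp
    have h2 : (inner ℝ x y : ℝ) ≤ ‖x‖ ^ 2 := by
      have := real_inner_le_norm x y
      nlinarith [norm_nonneg x]
    have h3 := real_inner_le_norm (α • (x - y) + β • x) (x - y)
    rw [h1] at h3
    have h4 : 0 ≤ β * (‖x‖ ^ 2 - inner ℝ x y) := mul_nonneg hβ (by linarith)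
    have h5 : α * ‖x - y‖ ≤ ‖α • (x - y) + β • x‖ := by
      refine le_of_mul_le_mul_right ?_ hs
      nlinarith
    linarith

/-- Exponential weights that vanish away from the lateral boundary, with their gradients. -/
lemma exists_steep_exponential (M : ℝ) {a ε : ℝ} (ha : a < 1) (hε : 0 < ε) :
    ∃ K : ℝ, 0 < K ∧ M * Real.exp (K * (a - 1)) < ε ∧ 2 * M * K * Real.exp (K * (a - 1)) < ε := by
  have hb : 0 < 1 - a := by linarith
  have h1 : Tendsto (fun K : ℝ => M * Real.exp (K * (a - 1))) atTop (𝓝 0) := by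
    have : Tendsto (fun K : ℝ => Real.exp (-(1 - a) * K)) atTop (𝓝 0) :=
      Real.tendsto_exp_atBot.comp (tendsto_id.const_mul_atTop_of_neg (by linarith))
    have := this.const_mul M
    rw [mul_zero] at this
    refine this.congr fun K => ?_
    congr 2; ring
  have h2 : Tendsto (fun K : ℝ => 2 * M * K * Real.exp (K * (a - 1))) atTop (𝓝 0) := by
    have := (tendsto_rpow_mul_exp_neg_mul_atTop_nhds_zero 1 (1 - a) hb).const_mul (2 * M)
    rw [mul_zero] at this
    refine this.congr fun K => ?_
    rw [Real.rpow_one, ← mul_assoc]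
    congr 2; ring
  obtain ⟨K, hK1, hK2, hK3⟩ := ((h1.eventually (gt_mem_nhds hε)).and
    ((h2.eventually (gt_mem_nhds hε)).and (eventually_gt_atTop 0))).exists
  exact ⟨K, hK3, hK1, hK2⟩

namespace IsCriticalHamiltonian

variable {H : E N → EReal} {D : Set (E N)} {h : E N → ℝ} (hH : IsCriticalHamiltonian H D h)
  {f u : E N × ℝ → ℝ}
include hH

/-- Subsolutions assume the initial data in the classical sense: as `H` is bounded below, barriers
that grow fast in time are strict. -/
lemma subsolution_le_initial (hu : IsSubsolution (modOp H) f u)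
    {y : E N} (hy : ‖y‖ < 1)
    (hf : ContinuousWithinAt (fun x => f (x, 0)) (Metric.ball 0 1) y) : u (y, 0) ≤ f (y, 0) := by
  refine le_of_forall_pos_le_add fun η hη => ?_
  obtain ⟨r, hr, hfr⟩ := (Metric.continuousWithinAt_iff.1 hf) η hη
  set ρ := min r (1 - ‖y‖)
  have hρ : 0 < ρ := lt_min hr (by linarith)
  obtain ⟨M, hM⟩ := hu.bddAbove_slab 1
  obtain ⟨c, hc⟩ := hH.exists_ge
  set M' := |M| + |f (y, 0)|
  have hM' : 0 ≤ M' := by positivity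
  have hMM' : M ≤ f (y, 0) + M' := by
    have := neg_abs_le (f (y, 0)); have := le_abs_self M; simp only [M']; linarith
  set K := M' / ρ ^ 2
  have hK : 0 ≤ K := by positivity
  have hKρ : K * ρ ^ 2 = M' := by simp only [K]; field_simp
  set C := M' + |c| + 1
  set ψ : E N × ℝ → ℝ := fun z => f (y, 0) + η + K * ‖z.1 - y‖ ^ 2 + C * z.2
  have hψ : ContDiff ℝ ∞ ψ := by
    have : ContDiff ℝ ∞ (fun z : E N × ℝ => ‖z.1 - y‖ ^ 2) :=
      (contDiff_fst.sub contDiff_const).norm_sq ℝ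
    simp only [ψ]; fun_prop
  have hfar : ∀ z ∈ closedCyl N, z.2 ≤ 1 → ρ ≤ ‖z.1 - y‖ → u z ≤ ψ z := fun z hz hz1 hd => by
    have h1 := hM z hz hz1
    have h2 : K * ρ ^ 2 ≤ K * ‖z.1 - y‖ ^ 2 := by gcongr
    have h3 : 0 ≤ C * z.2 := mul_nonneg (by positivity) hz.2
    simp only [ψ]; linarith
  have key := le_barrier (T := 1) hu.1 hψ.continuous (fun z hz hz1 => by
      have h1 := hM z hz hz1.le
      have h2 : 0 ≤ K * ‖z.1 - y‖ ^ 2 := by positivity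
      simp only [ψ, hz1, C]; linarith [abs_nonneg c])
    (fun z hz hz1 hmax => by
      have hτ : timeDeriv ψ z = C := timeDeriv_eq
        ((((hasDerivAt_id z.2).const_mul C).const_add
          (f (y, 0) + η + K * ‖z.1 - y‖ ^ 2)).congr_deriv (mul_one C))
      have hF : 0 < modOp H (timeDeriv ψ z) (spaceGrad ψ z) := by
        refine hH.modOp_pos fun hp _ => ?_
        have := hc _ hp
        rw [hτ]
        simp only [C]; linarith [neg_abs_le c]
      obtain ⟨hb, hle⟩ := hu.contact hψ hz hmax hF
      rcases le_or_gt ρ ‖z.1 - y‖ with hd | hd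
      · exact hfar z hz hz1.le hd
      rcases mem_parBdry.1 hb with ⟨h1, h2⟩ | ⟨h1, h2⟩
      · exfalso
        have := norm_sub_norm_le z.1 y
        linarith [min_le_right r (1 - ‖y‖)]
      · have h3 := hfr (x := z.1) (by simpa using h1)
          (by rw [dist_eq_norm]; exact hd.trans_le (min_le_left _ _))
        rw [Real.dist_eq] at h3
        have h4 : f z = f (z.1, 0) := by rw [← h2]
        have h5 : 0 ≤ K * ‖z.1 - y‖ ^ 2 := by positivity
        rw [← h4] at h3
        simp only [ψ, h2]
        linarith [(abs_lt.1 h3).2])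
    (z := (y, 0)) (mem_closedCyl.2 ⟨hy.le, le_rfl⟩) zero_le_one
  simpa [ψ] using key

/-- The gradient constraint makes subsolutions `1`-Lipschitz in space; here this is only needed
relative to the initial data. The barrier is a cone with vertex `y`, smoothed at the vertex, steeper
than the constraint allows, and raised near the lateral boundary and away from the time of interest,
where nothing is known about the subsolution. -/
lemma subsolution_le_cone (hu : IsSubsolution (modOp H) f u) {y : E N} (hy : ‖y‖ < 1)
    (hf : ContinuousWithinAt (fun x => f (x, 0)) (Metric.ball 0 1) y) {η : ℝ} (hη : 0 < η) :
    ∃ δ > 0, ∀ z ∈ cyl N, z.2 < δ → u z ≤ f (y, 0) + η + ‖z.1 - y‖ := by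
  set c := f (y, 0)
  have hy0 : ((y, 0) : E N × ℝ) ∈ closedCyl N := mem_closedCyl.2 ⟨hy.le, le_rfl⟩
  have husc := hu.1 (y, 0) hy0 (c + η / 2)
    (by have := hH.subsolution_le_initial hu hy hf; simp only [c]; linarith)
  obtain ⟨r, hr, hur⟩ := Metric.mem_nhdsWithin_iff.1 husc
  set ρ := min r 1
  have hρ : 0 < ρ := lt_min hr one_pos
  obtain ⟨M, hM⟩ := hu.bddAbove_slab 1
  set M₀ := |M| + |c|
  have hM₀ : 0 ≤ M₀ := by positivity
  have hMM₀ : M ≤ c + M₀ := by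
    have := neg_abs_le c; have := le_abs_self M; simp only [M₀]; linarith
  refine ⟨ρ, hρ, ?_⟩
  rintro ⟨x₁, t₁⟩ hz₁ ht₁
  have hx₁ : ‖x₁‖ < 1 := (mem_cyl.1 hz₁).1
  have ht₁0 : 0 < t₁ := (mem_cyl.1 hz₁).2
  simp only at ht₁ ⊢
  -- slope `1 + ε` of the cone, and scale of the smoothing at its vertex
  set ε := min 1 (η / 10)
  have hε : 0 < ε := lt_min one_pos (by linarith)
  have hε1 : ε ≤ 1 := min_le_left _ _
  have hεη : 10 * ε ≤ η := by have := min_le_right 1 (η / 10); simp only [ε]; linarith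
  set m := 1 + ε / 2
  set κ := ρ * (ε / (2 + ε))
  have hκ : 0 < κ := by positivity
  have hκε : κ ≤ ε := by
    have h1 : ε / (2 + ε) ≤ ε := div_le_self hε.le (by linarith)
    calc κ ≤ 1 * ε := mul_le_mul (min_le_right _ _) h1 (by positivity) zero_le_one
      _ = ε := one_mul _
  set a := max (‖y‖ ^ 2) (‖x₁‖ ^ 2)
  have ha : a < 1 := max_lt (by nlinarith [norm_nonneg y]) (by nlinarith [norm_nonneg x₁])
  obtain ⟨K, hK, hK1, hK2⟩ := exists_steep_exponential M₀ ha (half_pos hε)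
  set d := min t₁ (ρ - t₁)
  have hd : 0 < d := lt_min ht₁0 (by linarith)
  set K₂ := M₀ / d ^ 2
  have hK₂ : ∀ s : ℝ, d ≤ |s - t₁| → M₀ ≤ K₂ * (s - t₁) ^ 2 := fun s hs => by
    have h1 : d ^ 2 ≤ (s - t₁) ^ 2 := by rw [← sq_abs (s - t₁)]; gcongr
    calc M₀ = K₂ * d ^ 2 := by simp only [K₂]; field_simp
      _ ≤ _ := by gcongr
  set ψ : E N × ℝ → ℝ := fun z => (c + η / 2) + (1 + ε) * √(‖z.1 - y‖ ^ 2 + κ ^ 2) +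
    M₀ * Real.exp (K * (‖z.1 - 0‖ ^ 2 - 1)) + K₂ * (z.2 - t₁) ^ 2
  have hψ : ContDiff ℝ ∞ ψ := by
    have h1 : ContDiff ℝ ∞ (fun z : E N × ℝ => ‖z.1 - y‖ ^ 2) :=
      (contDiff_fst.sub contDiff_const).norm_sq ℝ
    have h2 : ContDiff ℝ ∞ (fun z : E N × ℝ => ‖z.1 - 0‖ ^ 2) :=
      (contDiff_fst.sub contDiff_const).norm_sq ℝ
    have h3 : ContDiff ℝ ∞ (fun z : E N × ℝ => √(‖z.1 - y‖ ^ 2 + κ ^ 2)) :=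
      (h1.add contDiff_const).sqrt fun z => by positivity
    simp only [ψ]; fun_prop
  have hA : ∀ z : E N × ℝ, 0 ≤ (1 + ε) * √(‖z.1 - y‖ ^ 2 + κ ^ 2) := fun z => by positivity
  have hB : ∀ z : E N × ℝ, 0 ≤ M₀ * Real.exp (K * (‖z.1 - 0‖ ^ 2 - 1)) := fun z => by positivity
  have hC : ∀ z : E N × ℝ, 0 ≤ K₂ * (z.2 - t₁) ^ 2 := fun z => by positivity
  have htime : ∀ z ∈ closedCyl N, z.2 ≤ ρ → d ≤ |z.2 - t₁| → u z ≤ ψ z := fun z hz hzρ hzd => by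
    have h1 := hM z hz (hzρ.trans (min_le_right _ _))
    have h2 := hK₂ _ hzd
    have := hA z; have := hB z
    simp only [ψ]; linarith
  have key := le_barrier (T := ρ) hu.1 hψ.continuous (fun z hz hzT => htime z hz hzT.le (by
      rw [hzT, abs_of_pos (by linarith)]; exact min_le_right _ _))
    (fun z hz hzT hmax => by
      rcases eq_or_lt_of_le (mem_closedCyl.1 hz).2 with h0 | h0
      · refine htime z hz hzT.le ?_
        rw [show z.2 = 0 from h0.symm, zero_sub, abs_neg, abs_of_pos ht₁0]
        exact min_le_left _ _
      rcases eq_or_lt_of_le (mem_closedCyl.1 hz).1 with h1 | h1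
      · have h2 := hM z hz (hzT.le.trans (min_le_right _ _))
        have h3 : M₀ * Real.exp (K * (‖z.1 - 0‖ ^ 2 - 1)) = M₀ := by simp [h1]
        have := hA z; have := hC z
        simp only [ψ]; linarith
      rcases lt_or_ge ‖z.1 - y‖ ρ with hd | hd
      · have h2 : u z < c + η / 2 := by
          refine hur ⟨?_, hz⟩
          rw [Metric.mem_ball, Prod.dist_eq, max_lt_iff, dist_eq_norm, Real.dist_eq]
          refine ⟨hd.trans_le (min_le_left _ _), ?_⟩
          simp only [sub_zero]
          rw [abs_of_pos h0]; exact hzT.trans_le (min_le_left _ _)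
        have := hA z; have := hB z; have := hC z
        simp only [ψ]; linarith
      · exfalso
        set S := √(‖z.1 - y‖ ^ 2 + κ ^ 2)
        have hS : 0 < S := by simp only [S]; positivity
        have hgrad : spaceGrad ψ z = ((1 + ε) / S) • (z.1 - y) +
            (2 * M₀ * K * Real.exp (K * (‖z.1‖ ^ 2 - 1))) • z.1 := by
          refine spaceGrad_eq ?_
          have g1 : HasGradientAt (fun x => (1 + ε) * √(‖x - y‖ ^ 2 + κ ^ 2))
              (((1 + ε) * (1 / (2 * S))) • ((2 : ℝ) • (z.1 - y))) z.1 := by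
            refine hasGradientAt_comp (k := fun s => (1 + ε) * √(s + κ ^ 2)) ?_
              (hasGradientAt_norm_sub_sq y z.1)
            exact (((hasDerivAt_id (‖z.1 - y‖ ^ 2)).add_const (κ ^ 2)).sqrt
              (by simp only [id]; positivity)).const_mul (1 + ε)
          have g2 : HasGradientAt (fun x => M₀ * Real.exp (K * (‖x - 0‖ ^ 2 - 1)))
              ((M₀ * (Real.exp (K * (‖z.1 - 0‖ ^ 2 - 1)) * (K * 1))) • ((2 : ℝ) • (z.1 - 0)))
              z.1 := by
            refine hasGradientAt_comp (k := fun s => M₀ * Real.exp (K * (s - 1))) ?_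
              (hasGradientAt_norm_sub_sq 0 z.1)
            exact ((((hasDerivAt_id (‖z.1 - 0‖ ^ 2)).sub_const 1).const_mul K).exp).const_mul M₀
          have g3 := hasGradientAt_add_const (hasGradientAt_add
            (hasGradientAt_add (hasGradientAt_const z.1 (c + η / 2)) g1) g2) (K₂ * (z.2 - t₁) ^ 2)
          convert g3 using 1
          rw [zero_add, smul_smul, smul_smul, sub_zero]
          congr 2
          · field_simp
          · ring
        have hF : 0 < modOp H (timeDeriv ψ z) (spaceGrad ψ z) := by
          refine hH.modOp_pos fun _ hle => absurd hle (not_le.2 ?_)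
          rw [hgrad]
          refine one_lt_norm_add (m := m) (by positivity) (by simp only [m]; linarith) ?_ h1.le
            fun hxy => ?_
          · have hS2 : S ≤ ‖z.1 - y‖ + κ := by
              refine Real.sqrt_le_iff.2 ⟨by positivity, ?_⟩
              nlinarith [norm_nonneg (z.1 - y)]
            have h3 : κ ≤ ‖z.1 - y‖ * (ε / (2 + ε)) := by
              simp only [κ]; gcongr
            have h4 : ‖z.1 - y‖ + ‖z.1 - y‖ * (ε / (2 + ε)) =
                ‖z.1 - y‖ * (1 + ε) / m := by
              simp only [m]; field_simp; ring
            have h5 : S ≤ ‖z.1 - y‖ * (1 + ε) / m := by linarith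
            rw [le_div_iff₀ (by simp only [m]; linarith)] at h5
            rw [div_mul_eq_mul_div, le_div_iff₀ hS]
            linarith
          · have h3 : ‖z.1‖ ^ 2 ≤ a := le_trans (by gcongr) (le_max_left _ _)
            have h4 : 2 * M₀ * K * Real.exp (K * (‖z.1‖ ^ 2 - 1)) ≤
                2 * M₀ * K * Real.exp (K * (a - 1)) := by gcongr
            simp only [m]; linarith
        obtain ⟨hb, -⟩ := hu.contact hψ hz hmax hF
        rcases mem_parBdry.1 hb with h2 | h2
        · linarith [h2.1]
        · linarith [h2.2])
    (z := (x₁, t₁)) (cyl_subset_closedCyl hz₁) ht₁.le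
  refine key.trans ?_
  have hS2 : √(‖x₁ - y‖ ^ 2 + κ ^ 2) ≤ ‖x₁ - y‖ + κ := by
    refine Real.sqrt_le_iff.2 ⟨by positivity, ?_⟩
    nlinarith [norm_nonneg (x₁ - y)]
  have h1 : ‖x₁ - y‖ ≤ 2 := by linarith [norm_sub_le x₁ y]
  have h2 : M₀ * Real.exp (K * (‖x₁ - 0‖ ^ 2 - 1)) ≤ M₀ * Real.exp (K * (a - 1)) := by
    rw [sub_zero]; gcongr; exact le_max_right _ _
  have h3 : (1 + ε) * √(‖x₁ - y‖ ^ 2 + κ ^ 2) ≤ (1 + ε) * (‖x₁ - y‖ + ε) := by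
    gcongr; linarith
  have h4 : (1 + ε) * (‖x₁ - y‖ + ε) ≤ ‖x₁ - y‖ + 4 * ε := by nlinarith
  simp only [ψ, sub_self]
  linarith

end IsCriticalHamiltonian

/-! ### The initial trace -/

/-- The largest `1`-Lipschitz function below `g` on the closed unit ball. -/
def lipEnvelope (g : E N → ℝ) (x : E N) : ℝ :=
  sInf ((fun y => g y + ‖x - y‖) '' Metric.closedBall 0 1)

section LipEnvelope

variable {g : E N → ℝ} (hg : ContinuousOn g (Metric.closedBall 0 1))
include hg

lemma lipEnvelope_isLeast (x : E N) :
    IsLeast ((fun y => g y + ‖x - y‖) '' Metric.closedBall 0 1) (lipEnvelope g x) := by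
  have hc : IsCompact ((fun y => g y + ‖x - y‖) '' Metric.closedBall (0 : E N) 1) :=
    (isCompact_closedBall _ _).image_of_continuousOn (hg.add (by fun_prop))
  exact hc.isLeast_sInf ⟨_, 0, by simp, rfl⟩

lemma lipEnvelope_le (x : E N) {y : E N} (hy : ‖y‖ ≤ 1) : lipEnvelope g x ≤ g y + ‖x - y‖ :=
  (lipEnvelope_isLeast hg x).2 ⟨y, by simpa using hy, rfl⟩

lemma exists_eq_lipEnvelope (x : E N) : ∃ y : E N, ‖y‖ ≤ 1 ∧ lipEnvelope g x = g y + ‖x - y‖ := by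
  obtain ⟨y, hy, h⟩ := (lipEnvelope_isLeast hg x).1
  exact ⟨y, by simpa using hy, h.symm⟩

lemma lipschitzWith_lipEnvelope : LipschitzWith 1 (lipEnvelope g) := by
  refine LipschitzWith.of_le_add fun x x' => ?_
  obtain ⟨y, hy, h⟩ := exists_eq_lipEnvelope hg x'
  have h1 := lipEnvelope_le hg x hy
  have h2 := norm_sub_le_norm_sub_add_norm_sub x x' y
  rw [dist_eq_norm]; linarith

/-- The Lipschitz envelope solves the obstacle problem: below the obstacle, it decreases with unit
slope in the direction of a point where the infimum is attained. -/
lemma isObstacleSolution_lipEnvelope : IsObstacleSolution g (lipEnvelope g) := by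
  have hlip := lipschitzWith_lipEnvelope hg
  refine ⟨hlip.continuous.continuousOn, fun φ hφ x hx => ⟨fun hmax => ?_, fun hmin => ?_⟩⟩
  · have hx1 : ‖x‖ ≤ 1 := by
      have : ‖x‖ < 1 := by simpa using hx
      exact this.le
    have h1 := lipEnvelope_le hg x hx1
    simp only [sub_self, norm_zero, add_zero] at h1
    refine max_le (by linarith) (sub_nonpos.2 ?_)
    have hd := hasDerivAt_line ((hφ.differentiable (by simp)) x).hasGradientAt (-gradient φ x)
    have h2 := ge_of_hasDerivAt_of_eventually_ge (c := -‖gradient φ x‖) hd (by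
      have htend : Tendsto (fun s : ℝ => x + s • (-gradient φ x)) (𝓝 0) (𝓝 x) := by
        have : Continuous fun s : ℝ => x + s • (-gradient φ x) := by fun_prop
        simpa using this.tendsto 0
      filter_upwards [nhdsWithin_le_nhds (htend.eventually hmax), self_mem_nhdsWithin] with s hs hs0
      have hs0 : 0 < s := hs0
      have h3 := hlip.le_add_mul x (x + s • (-gradient φ x))
      rw [dist_eq_norm, sub_add_cancel_left, norm_neg, norm_smul, norm_neg, Real.norm_eq_abs,
        abs_of_pos hs0, NNReal.coe_one, one_mul] at h3
      simp only [zero_smul, add_zero]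
      linarith)
    rw [inner_neg_right, real_inner_self_eq_norm_sq] at h2
    nlinarith [norm_nonneg (gradient φ x)]
  · by_contra! hlt
    obtain ⟨h1, h2⟩ := max_lt_iff.1 hlt
    obtain ⟨y, hy, hv⟩ := exists_eq_lipEnvelope hg x
    have hne : 0 < ‖x - y‖ := by
      refine (norm_nonneg _).lt_of_ne' fun h0 => ?_
      have : x = y := sub_eq_zero.1 (norm_eq_zero.1 h0)
      rw [h0] at hv
      rw [this] at hv h1
      linarith
    set e := (1 / ‖x - y‖) • (y - x)
    have he : ‖e‖ = 1 := by
      rw [norm_smul, norm_div, norm_one, norm_norm, norm_sub_rev y x]; field_simp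
    have hd := hasDerivAt_line ((hφ.differentiable (by simp)) x).hasGradientAt e
    have h3 := le_of_hasDerivAt_of_eventually_le (c := -1) hd (by
      have htend : Tendsto (fun s : ℝ => x + s • e) (𝓝 0) (𝓝 x) := by
        have : Continuous fun s : ℝ => x + s • e := by fun_prop
        simpa using this.tendsto 0
      filter_upwards [nhdsWithin_le_nhds (htend.eventually hmin), self_mem_nhdsWithin,
        nhdsWithin_le_nhds (gt_mem_nhds hne)] with s hs hs0 hs1
      have hs0 : 0 < s := hs0
      have h4 := lipEnvelope_le hg (x + s • e) hy
      have h5 : x + s • e - y = (1 - s / ‖x - y‖) • (x - y) := by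
        simp only [e]; module
      have h6 : 0 ≤ 1 - s / ‖x - y‖ := by
        rw [sub_nonneg, div_le_one hne]; exact hs1.le
      have h7 : (1 - s / ‖x - y‖) * ‖x - y‖ = ‖x - y‖ - s := by field_simp
      rw [h5, norm_smul, Real.norm_eq_abs, abs_of_nonneg h6, h7] at h4
      simp only [zero_smul, add_zero]
      linarith)
    have h4 := (abs_le.1 (abs_real_inner_le_norm (gradient φ x) e)).1
    rw [he, mul_one] at h4
    linarith

end LipEnvelope

/-- Mollification preserves Lipschitz constants. -/
lemma exists_contDiff_near_lipschitz {v : E N → ℝ} {K : NNReal} (hv : LipschitzWith K v) {ε : ℝ}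
    (hε : 0 < ε) : ∃ φ : E N → ℝ, ContDiff ℝ ∞ φ ∧ LipschitzWith K φ ∧ ∀ x, |φ x - v x| ≤ ε := by
  set r := ε / (K + 1)
  have hr : 0 < r := by positivity
  set b : ContDiffBump (0 : E N) := ⟨r / 2, r, half_pos hr, half_lt_self hr⟩
  set φ : E N → ℝ := convolution (b.normed volume) v (ContinuousLinearMap.lsmul ℝ ℝ) volume
  have hint : ∀ x, Integrable fun t => b.normed volume t * v (x - t) := fun x =>
    ((b.continuous_normed).mul (hv.continuous.comp (by fun_prop))).integrable_of_hasCompactSupport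
      (b.hasCompactSupport_normed.mul_right)
  have hφ : ∀ x, φ x = ∫ t, b.normed volume t * v (x - t) := fun x => rfl
  refine ⟨φ, ?_, ?_, fun x => ?_⟩
  · exact b.hasCompactSupport_normed.contDiff_convolution_left _ b.contDiff_normed
      hv.continuous.locallyIntegrable
  · refine LipschitzWith.of_le_add_mul K fun x y => ?_
    have h1 : ∫ t, b.normed volume t * v (x - t) ≤
        ∫ t, (b.normed volume t * v (y - t) + b.normed volume t * (K * dist x y)) := by
      refine integral_mono (hint x) ((hint y).add (b.integrable_normed.mul_const _)) fun t => ?_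
      have h2 : v (x - t) ≤ v (y - t) + K * dist x y := by
        have := hv.le_add_mul (x - t) (y - t)
        rwa [dist_sub_right] at this
      have := mul_le_mul_of_nonneg_left h2 (b.nonneg_normed (μ := volume) t)
      simp only; linarith
    rw [integral_add (hint y) (b.integrable_normed.mul_const _), integral_mul_const,
      b.integral_normed, one_mul] at h1
    rw [hφ, hφ]; exact h1
  · rw [← Real.dist_eq]
    refine b.dist_normed_convolution_le hv.continuous.aestronglyMeasurable fun y hy => ?_
    have h1 := hv.dist_le_mul y x
    have h2 : dist y x ≤ r := (Metric.mem_ball.1 hy).le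
    calc dist (v y) (v x) ≤ K * r := h1.trans (by gcongr)
      _ ≤ (K + 1) * r := by gcongr; simp
      _ = ε := by simp only [r]; field_simp

lemma norm_gradient_le_of_lipschitzWith {φ : E N → ℝ} {K : NNReal} (hφ : LipschitzWith K φ)
    (x : E N) : ‖gradient φ x‖ ≤ K := by
  rw [gradient, LinearIsometryEquiv.norm_map]
  exact norm_fderiv_le_of_lipschitz ℝ hφ

namespace IsCriticalHamiltonian

variable {H : E N → EReal} {D : Set (E N)} {h : E N → ℝ} (hH : IsCriticalHamiltonian H D h)
  {f u : E N × ℝ → ℝ}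
include hH

/-- Supersolutions lie initially above every smooth function with gradient bounded by `ρ < 1` below
the data: as `H` is bounded above on the ball of radius `ρ`, barriers that decrease fast in time are
strict. -/
lemma le_supersolution_initial (hu : IsSupersolution (modOp H) f u)
    (hf : ContinuousOn f (parBdry N)) {φ : E N → ℝ} (hφ : ContDiff ℝ ∞ φ) {ρ η : ℝ} (hρ : ρ < 1)
    (hη : 0 < η) (hgrad : ∀ x, ‖gradient φ x‖ ≤ ρ) (hle : ∀ x, ‖x‖ ≤ 1 → φ x ≤ f (x, 0) - η)
    {x₀ : E N} (hx₀ : ‖x₀‖ ≤ 1) : φ x₀ ≤ u (x₀, 0) := by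
  have hsub : Metric.sphere (0 : E N) 1 ×ˢ Set.Icc (0 : ℝ) 1 ⊆ parBdry N := fun z hz =>
    Or.inl ⟨hz.1, hz.2.1⟩
  have hunif := ((isCompact_sphere (0 : E N) 1).prod
    (isCompact_Icc (a := (0 : ℝ)) (b := 1))).uniformContinuousOn_of_continuous (hf.mono hsub)
  obtain ⟨δ₀, hδ₀, hδf⟩ := Metric.uniformContinuousOn_iff.1 hunif η hη
  set δ := min δ₀ 1
  have hδ : 0 < δ := lt_min hδ₀ one_pos
  obtain ⟨M, hM⟩ := hu.bddBelow_slab 1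
  obtain ⟨M₁, hM₁⟩ := (isCompact_closedBall (0 : E N) 1).bddAbove_image hφ.continuous.continuousOn
  obtain ⟨c, hc⟩ := hH.exists_le ρ hρ
  set C := |c| + |M₁ - M| / δ + 1
  have hC0 : 0 < C := by positivity
  have hCδ : M₁ - M ≤ C * δ := by
    have h1 : |M₁ - M| / δ * δ = |M₁ - M| := by field_simp
    have h2 : 0 ≤ (|c| + 1) * δ := by positivity
    have : C * δ = (|c| + 1) * δ + |M₁ - M| := by rw [← h1]; simp only [C]; ring
    linarith [le_abs_self (M₁ - M)]
  set ψ : E N × ℝ → ℝ := fun z => φ z.1 - C * z.2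
  have hψ : ContDiff ℝ ∞ ψ := (hφ.comp contDiff_fst).sub (contDiff_const.mul contDiff_snd)
  have key := barrier_le (T := δ) hu.1 hψ.continuous (fun z hz hzT => by
      have h1 := hM z hz (hzT.le.trans (min_le_right _ _))
      have h2 : φ z.1 ≤ M₁ := hM₁ ⟨z.1, hz.1, rfl⟩
      simp only [ψ, hzT]; linarith)
    (fun z hz hzT hmin => by
      have hτ : timeDeriv ψ z = -C := timeDeriv_eq
        ((((hasDerivAt_id z.2).const_mul C).const_sub (φ z.1)).congr_deriv (by simp))
      have hp : spaceGrad ψ z = gradient φ z.1 := spaceGrad_eq (by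
        simpa [ψ, sub_eq_add_neg] using hasGradientAt_add_const
          ((hφ.differentiable (by simp)) z.1).hasGradientAt (-(C * z.2)))
      have hF : modOp H (timeDeriv ψ z) (spaceGrad ψ z) < 0 := by
        rw [hτ, hp]
        refine hH.modOp_neg ((hgrad _).trans_lt hρ) ?_
        have h1 := hc _ (hgrad z.1)
        have h2 : 0 ≤ |M₁ - M| / δ := by positivity
        simp only [C]; linarith [le_abs_self c]
      obtain ⟨hb, hle'⟩ := hu.contact hψ hz hmin hF
      refine le_trans ?_ hle'
      have h1 := hle z.1 (mem_closedCyl.1 hz).1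
      have h2 : 0 ≤ C * z.2 := mul_nonneg hC0.le (mem_closedCyl.1 hz).2
      rcases mem_parBdry.1 hb with ⟨h3, h4⟩ | ⟨h3, h4⟩
      · have h5 := hδf z ⟨by simpa using h3, h4, hzT.le.trans (min_le_right _ _)⟩ (z.1, 0)
          ⟨by simpa using h3, le_rfl, zero_le_one⟩ (by
            rw [Prod.dist_eq, dist_self, Real.dist_eq, sub_zero, abs_of_nonneg h4]
            exact max_lt hδ₀ (hzT.trans_le (min_le_left _ _)))
        rw [Real.dist_eq] at h5
        simp only [ψ]
        linarith [(abs_lt.1 h5).1]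
      · have h5 : f z = f (z.1, 0) := by rw [← h4]
        rw [h5]; simp only [ψ]; linarith)
    (z := (x₀, 0)) (mem_closedCyl.2 ⟨hx₀, le_rfl⟩) hδ.le
  simpa [ψ] using key

theorem exists_initialTrace (hf : ContinuousOn f (parBdry N))
    (hu : IsViscositySolution (modOp H) f u) :
    ∃ u₀ : E N → ℝ,
      (∀ x ∈ Metric.ball (0 : E N) 1, Tendsto u (𝓝[cyl N] (x, 0)) (𝓝 (u₀ x))) ∧
      IsObstacleSolution (fun x => f (x, 0)) u₀ := by
  obtain ⟨hbdd, hsub, hsup⟩ := hu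
  set g : E N → ℝ := fun x => f (x, 0)
  have hg : ContinuousOn g (Metric.closedBall 0 1) := by
    refine hf.comp (by fun_prop) fun x hx => mem_parBdry.2 ?_
    have hx : ‖x‖ ≤ 1 := by simpa using hx
    rcases hx.lt_or_eq with h | h
    · exact Or.inr ⟨h, rfl⟩
    · exact Or.inl ⟨h, le_rfl⟩
  refine ⟨lipEnvelope g, fun x hx => ?_, isObstacleSolution_lipEnvelope hg⟩
  have hx : ‖x‖ < 1 := by simpa using hx
  have hz : ((x, 0) : E N × ℝ) ∈ closedCyl N := mem_closedCyl.2 ⟨hx.le, le_rfl⟩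
  have hlip := lipschitzWith_lipEnvelope hg
  refine tendsto_of_envelopes (hbdd _ hz) ?_ ?_
  · have h1 : ∀ y ∈ Metric.ball (0 : E N) 1, upperEnv u (x, 0) ≤ g y + ‖x - y‖ := fun y hy => by
      have hy1 : ‖y‖ < 1 := by simpa using hy
      refine upperEnv_le (hbdd _ hz) hz fun ε hε => ?_
      obtain ⟨δ, hδ, hcone⟩ := hH.subsolution_le_cone hsub hy1
        ((hg.mono Metric.ball_subset_closedBall) y hy) (half_pos hε)
      have e1 : ∀ᶠ w : E N × ℝ in 𝓝 (x, 0), w.2 < δ :=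
        (continuous_snd.tendsto (x, (0 : ℝ))).eventually_lt_const hδ
      have e2 : ∀ᶠ w : E N × ℝ in 𝓝 (x, 0), ‖w.1 - y‖ < ‖x - y‖ + ε / 2 := by
        have : Continuous fun w : E N × ℝ => ‖w.1 - y‖ := by fun_prop
        exact (this.tendsto (x, (0 : ℝ))).eventually_lt_const (by simp; linarith)
      filter_upwards [nhdsWithin_le_nhds e1, nhdsWithin_le_nhds e2, self_mem_nhdsWithin]
        with w hw1 hw2 hw
      have h2 := hcone w hw hw1
      have h3 := le_upperEnv (hbdd w (cyl_subset_closedCyl hw)) hw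
      simp only [g]; linarith
    obtain ⟨y, hy, hv⟩ := exists_eq_lipEnvelope hg x
    rw [hv]
    have hcl : closure (Metric.ball (0 : E N) 1) = Metric.closedBall 0 1 :=
      closure_ball _ one_ne_zero
    exact le_on_closure h1 continuousOn_const (by rw [hcl]; exact hg.add (by fun_prop))
      (by rw [hcl]; simpa using hy)
  · refine le_of_forall_pos_le_add fun η hη => ?_
    obtain ⟨M, hM⟩ := (isCompact_closedBall (0 : E N) 1).exists_bound_of_continuousOn
      hlip.continuous.continuousOn
    have hM0 : 0 ≤ M := (norm_nonneg _).trans (hM 0 (by simp))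
    -- contract by `1 - θ` to gain a strict gradient bound
    set θ := min (1 / 2) (η / (8 * (M + 1)))
    have hθ : 0 < θ := lt_min (by norm_num) (by positivity)
    have hθ1 : θ ≤ 1 / 2 := min_le_left _ _
    have hθM : θ * M ≤ η / 8 := by
      calc θ * M ≤ η / (8 * (M + 1)) * (M + 1) := by
            gcongr
            · exact min_le_right _ _
            · linarith
        _ = η / 8 := by field_simp
    set K : NNReal := ⟨1 - θ, by linarith⟩
    have hKlip : LipschitzWith K fun x => (1 - θ) * lipEnvelope g x := by
      refine LipschitzWith.of_le_add_mul K fun a b => ?_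
      have h1 := hlip.le_add_mul a b
      have h2 : (K : ℝ) = 1 - θ := rfl
      rw [h2, ← mul_add]
      refine mul_le_mul_of_nonneg_left (by simpa using h1) (by linarith)
    obtain ⟨φ, hφ, hφlip, hφv⟩ := exists_contDiff_near_lipschitz hKlip (ε := η / 8) (by linarith)
    have hφ' : LipschitzWith K fun x => φ x - η / 2 := by
      refine LipschitzWith.of_le_add_mul K fun a b => ?_
      have := hφlip.le_add_mul a b
      linarith
    have habs : ∀ x : E N, ‖x‖ ≤ 1 → |lipEnvelope g x| ≤ M := fun x hx => hM x (by simpa using hx)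
    have key := hH.le_supersolution_initial hsup hf (φ := fun x => φ x - η / 2)
      (hφ.sub contDiff_const) (ρ := 1 - θ) (η := η / 4) (by linarith) (by linarith)
      (fun x => norm_gradient_le_of_lipschitzWith hφ' x) (fun y hy => by
        have h1 := (abs_le.1 (hφv y)).2
        have h2 := (abs_le.1 (habs y hy)).1
        have h3 := lipEnvelope_le hg y hy
        simp only [sub_self, norm_zero, add_zero, g] at h3
        have h4 : θ * -lipEnvelope g y ≤ θ * M := by gcongr; linarith
        linarith) hx.le
    have h1 := (abs_le.1 (hφv x)).1
    have h2 := (abs_le.1 (habs x hx.le)).2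
    have h4 : θ * lipEnvelope g x ≤ θ * M := by gcongr
    linarith

end IsCriticalHamiltonian

/-! ### Radial Hamiltonians and the rate function -/

/-- Invariance of the effective domain and of the Hamiltonian under rotations. -/
def IsRadial (D : Set (E N)) (h : E N → ℝ) : Prop :=
  ∀ p q : E N, ‖p‖ = ‖q‖ → (p ∈ D ↔ q ∈ D) ∧ h p = h q

lemma exists_unit_direction {e : E N} (he : ‖e‖ = 1) (x : E N) :
    ∃ ν : E N, ‖ν‖ = 1 ∧ x = ‖x‖ • ν := by
  rcases eq_or_ne x 0 with rfl | hx
  · exact ⟨e, he, by simp⟩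
  · have : ‖x‖ ≠ 0 := norm_ne_zero_iff.2 hx
    refine ⟨(‖x‖)⁻¹ • x, ?_, ?_⟩
    · rw [norm_smul, norm_inv, norm_norm, inv_mul_cancel₀ this]
    · rw [smul_smul, mul_inv_cancel₀ this, one_smul]

lemma distBdry_eq {e : E N} (he : ‖e‖ = 1) {x : E N} (hx : ‖x‖ ≤ 1) : distBdry x = 1 - ‖x‖ := by
  obtain ⟨ν, hν, hxν⟩ := exists_unit_direction he x
  have hνs : ν ∈ Metric.sphere (0 : E N) 1 := by simpa using hν
  refine le_antisymm ?_ ?_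
  · refine (Metric.infDist_le_dist_of_mem hνs).trans ?_
    have : x - ν = (‖x‖ - 1) • ν := by rw [sub_smul, one_smul, ← hxν]
    rw [dist_eq_norm, this, norm_smul, hν, mul_one, Real.norm_eq_abs, abs_of_nonpos (by linarith)]
    linarith
  · refine (Metric.le_infDist ⟨ν, hνs⟩).2 fun y hy => ?_
    have h1 : ‖y‖ = 1 := by simpa using hy
    have h2 := norm_sub_norm_le y x
    rw [dist_comm, dist_eq_norm]; linarith

/-- The rate function `t L(dist(x; ∂B_1) e / t)`, where `e` is a unit vector. -/
def rateFn (D : Set (E N)) (h : E N → ℝ) (e : E N) (z : E N × ℝ) : ℝ :=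
  z.2 * realLag D h ((distBdry z.1 / z.2) • e)

/-- The continuous extension of the rate function to the closed cylinder. -/
def rateExt (D : Set (E N)) (h : E N → ℝ) (e : E N) (z : E N × ℝ) : ℝ :=
  if 0 < z.2 then rateFn D h e z else 1 - ‖z.1‖

/-- Regularised minimum `g(s)` of `a` and `s`: a smooth function with slope in `[0,1]`. -/
lemma exists_smooth_min (a : ℝ) {ε : ℝ} (hε : 0 < ε) : ∃ g g' : ℝ → ℝ, ContDiff ℝ ∞ g ∧
    (∀ s, HasDerivAt g (g' s) s) ∧ (∀ s, 0 ≤ g' s ∧ g' s ≤ 1) ∧ (∀ s, g s ≤ min a s) ∧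
    ∀ s, min a s - ε ≤ g s := by
  have hpos : ∀ s : ℝ, 0 < √((a - s) ^ 2 + ε ^ 2) := fun s => by positivity
  have hle : ∀ s : ℝ, |a - s| ≤ √((a - s) ^ 2 + ε ^ 2) := fun s =>
    Real.abs_le_sqrt (by nlinarith)
  have hge : ∀ s : ℝ, √((a - s) ^ 2 + ε ^ 2) ≤ |a - s| + ε := fun s => by
    refine Real.sqrt_le_iff.2 ⟨by positivity, ?_⟩
    nlinarith [abs_nonneg (a - s), sq_abs (a - s)]
  refine ⟨fun s => (a + s - √((a - s) ^ 2 + ε ^ 2)) / 2,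
    fun s => (1 + (a - s) / √((a - s) ^ 2 + ε ^ 2)) / 2, ?_, fun s => ?_, fun s => ?_,
    fun s => ?_, fun s => ?_⟩
  · have : ContDiff ℝ ∞ fun s : ℝ => √((a - s) ^ 2 + ε ^ 2) :=
      ContDiff.sqrt (by fun_prop) fun s => by positivity
    fun_prop
  · have h1 : HasDerivAt (fun s : ℝ => (a - s) ^ 2 + ε ^ 2) (2 * (a - s) * (-1)) s := by
      simpa using (((hasDerivAt_id s).const_sub a).pow 2).add_const (ε ^ 2)
    have h2 := h1.sqrt (by positivity)
    refine ((((hasDerivAt_id s).const_add a).sub h2).div_const 2).congr_deriv ?_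
    have := (hpos s).ne'
    field_simp
    ring
  · have h1 := abs_le.1 (hle s)
    have h2 : -1 ≤ (a - s) / √((a - s) ^ 2 + ε ^ 2) := by
      rw [le_div_iff₀ (hpos s)]; linarith
    have h3 : (a - s) / √((a - s) ^ 2 + ε ^ 2) ≤ 1 := by
      rw [div_le_iff₀ (hpos s)]; linarith
    constructor <;> linarith
  · have h1 := abs_le.1 (hle s)
    refine le_min ?_ ?_ <;> linarith
  · have h1 := hge s
    rcases le_total a s with h2 | h2
    · rw [min_eq_left h2]
      rw [abs_of_nonpos (by linarith)] at h1
      linarith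
    · rw [min_eq_right h2]
      rw [abs_of_nonneg (by linarith)] at h1
      linarith

lemma rateExt_of_mem_cyl {D : Set (E N)} {h : E N → ℝ} {e : E N} {z : E N × ℝ}
    (hz : z ∈ cyl N) : rateExt D h e z = rateFn D h e z :=
  if_pos (mem_cyl.1 hz).2

namespace IsCriticalHamiltonian

variable {H : E N → EReal} {D : Set (E N)} {h : E N → ℝ} (hH : IsCriticalHamiltonian H D h)
  (hrad : IsRadial D h) {e : E N} (he : ‖e‖ = 1)

include hH in
lemma smul_mem_and_le {p : E N} (hp : p ∈ D) {μ : ℝ} (h0 : 0 ≤ μ) (h1 : μ ≤ 1) :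
    μ • p ∈ D ∧ h (μ • p) ≤ μ * h p := by
  have hc := hH.strictConvexOn.convexOn
  constructor
  · simpa using hc.1 hp hH.zero_mem h0 (sub_nonneg.2 h1) (by ring)
  · have := hc.2 hp hH.zero_mem h0 (sub_nonneg.2 h1) (by ring)
    simpa [hH.map_zero] using this

include hH hrad in
lemma nonneg_of_mem {p : E N} (hp : p ∈ D) : 0 ≤ h p := by
  obtain ⟨h1, h2⟩ := hrad p (-p) (norm_neg p).symm
  have h3 := hH.strictConvexOn.convexOn.2 hp (h1.1 hp) (by norm_num : (0 : ℝ) ≤ 1 / 2)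
    (by norm_num : (0 : ℝ) ≤ 1 / 2) (by norm_num)
  rw [smul_neg, add_neg_cancel, hH.map_zero, ← h2] at h3
  simp only [smul_eq_mul] at h3
  linarith

include hH hrad he in
/-- Radial convex functions vanishing at `0` are monotone in the norm, with at least linear
growth. -/
lemma mem_and_le_of_norm_le {p : E N} {r μ : ℝ} (hr : 0 ≤ r) (hrD : r • e ∈ D) (h0 : 0 ≤ μ)
    (h1 : μ ≤ 1) (hp : ‖p‖ ≤ μ * r) : p ∈ D ∧ h p ≤ μ * h (r • e) := by
  have hn := hH.nonneg_of_mem hrad hrD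
  rcases eq_or_lt_of_le hr with rfl | hr
  · have : p = 0 := norm_le_zero_iff.1 (by linarith)
    rw [this, hH.map_zero]
    exact ⟨hH.zero_mem, mul_nonneg h0 hn⟩
  · have h2 : ‖p‖ / r ≤ μ := by rwa [div_le_iff₀ hr]
    obtain ⟨h3, h4⟩ := hH.smul_mem_and_le hrD (by positivity : 0 ≤ ‖p‖ / r) (h2.trans h1)
    have h5 : ‖(‖p‖ / r) • r • e‖ = ‖p‖ := by
      rw [smul_smul, norm_smul, he, mul_one, Real.norm_eq_abs, abs_of_nonneg (by positivity)]
      field_simp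
    obtain ⟨h6, h7⟩ := hrad _ _ h5
    refine ⟨h6.1 h3, ?_⟩
    rw [← h7]
    exact h4.trans (by gcongr)

include hH hrad in
lemma realLag_radial {q q' : E N} (hq : ‖q‖ = ‖q'‖) : realLag D h q = realLag D h q' := by
  have key : ∀ q q' : E N, ‖q‖ = ‖q'‖ → realLag D h q ≤ realLag D h q' := fun q q' hq => by
    set R : E N ≃ₗᵢ[ℝ] E N := (Submodule.span ℝ {q - q'})ᗮ.reflection
    have hR : R q = q' := Submodule.reflection_sub hq
    set p := maximizer D h q
    obtain ⟨h1, h2⟩ := hrad p (R p) (R.norm_map p).symm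
    have h3 := hH.le_realLag (h1.1 (hH.maximizer_mem q)) q'
    rw [← h2, ← hR, R.inner_map_map] at h3
    exact hR ▸ h3
  exact le_antisymm (key q q' hq) (key q' q hq.symm)

include hH he in
lemma radius_le {r s : ℝ} (hrD : r • e ∈ D) : r * s - h (r • e) ≤ realLag D h (s • e) := by
  have := hH.le_realLag hrD (s • e)
  rw [inner_smul_left, inner_smul_right, real_inner_self_eq_norm_sq, he] at this
  simpa using this

include hH hrad he in
/-- In the radial case the Lagrangian at `s e` is the one-dimensional supremum over multiples of
`e`, and it is attained. -/
lemma exists_radius {s : ℝ} (hs : 0 ≤ s) :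
    ∃ r : ℝ, 0 ≤ r ∧ r ≤ 1 ∧ r • e ∈ D ∧ realLag D h (s • e) = r * s - h (r • e) := by
  set p := maximizer D h (s • e)
  have hp : p ∈ D := hH.maximizer_mem _
  obtain ⟨h1, h2⟩ := hrad p (‖p‖ • e) (by simp [norm_smul, he])
  refine ⟨‖p‖, norm_nonneg _, hH.norm_le p hp, h1.1 hp, ?_⟩
  refine le_antisymm ?_ (hH.radius_le he (h1.1 hp))
  have h3 : (inner ℝ p (s • e) : ℝ) ≤ ‖p‖ * s := by
    have := real_inner_le_norm p (s • e)
    rwa [norm_smul, he, mul_one, Real.norm_eq_abs, abs_of_nonneg hs] at this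
  rw [← h2, realLag]
  linarith

include hH he in
lemma le_rateFn {z : E N × ℝ} (hz : z ∈ cyl N) {r : ℝ} (hrD : r • e ∈ D) :
    r * (1 - ‖z.1‖) - z.2 * h (r • e) ≤ rateFn D h e z := by
  obtain ⟨h1, h2⟩ := mem_cyl.1 hz
  have := mul_le_mul_of_nonneg_left (hH.radius_le he (s := distBdry z.1 / z.2) hrD) h2.le
  rw [distBdry_eq he h1.le] at this
  rw [rateFn, distBdry_eq he h1.le]
  refine le_trans (le_of_eq ?_) this
  field_simp

include hH hrad he in
lemma exists_rateFn_eq {z : E N × ℝ} (hz : z ∈ cyl N) : ∃ r : ℝ, 0 ≤ r ∧ r ≤ 1 ∧ r • e ∈ D ∧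
    rateFn D h e z = r * (1 - ‖z.1‖) - z.2 * h (r • e) := by
  obtain ⟨h1, h2⟩ := mem_cyl.1 hz
  obtain ⟨r, hr0, hr1, hrD, hr⟩ := hH.exists_radius hrad he (s := (1 - ‖z.1‖) / z.2)
    (div_nonneg (by linarith) h2.le)
  refine ⟨r, hr0, hr1, hrD, ?_⟩
  rw [rateFn, distBdry_eq he h1.le, hr]
  field_simp

include hH hrad he in
lemma rateFn_le {z : E N × ℝ} (hz : z ∈ cyl N) : rateFn D h e z ≤ 1 - ‖z.1‖ := by
  obtain ⟨h1, h2⟩ := mem_cyl.1 hz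
  obtain ⟨r, hr0, hr1, hrD, hr⟩ := hH.exists_rateFn_eq hrad he hz
  have h3 := mul_nonneg h2.le (hH.nonneg_of_mem hrad hrD)
  have h4 : r * (1 - ‖z.1‖) ≤ 1 * (1 - ‖z.1‖) := by gcongr
  linarith

include hH in
lemma rateFn_nonneg {z : E N × ℝ} (hz : 0 ≤ z.2) : 0 ≤ rateFn D h e z :=
  mul_nonneg hz (hH.realLag_nonneg _)

include hH hrad he in
lemma rateExt_of_sphere {z : E N × ℝ} (hz : ‖z.1‖ = 1) : rateExt D h e z = 0 := by
  rw [rateExt]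
  split_ifs with h0
  · rw [rateFn, distBdry_eq he hz.le, hz, sub_self, zero_div, zero_smul]
    obtain ⟨r, -, -, hrD, hr⟩ := hH.exists_radius hrad he le_rfl
    rw [zero_smul, mul_zero, zero_sub] at hr
    have h1 := hH.nonneg_of_mem hrad hrD
    have h2 := hH.realLag_nonneg (0 : E N)
    have : realLag D h (0 : E N) = 0 := le_antisymm (by linarith) h2
    rw [this, mul_zero]
  · linarith

include hH hrad he in
/-- The rate function extends continuously to the closed cylinder; at the initial time this follows
from `L(q) ~ |q|`. -/
lemma tendsto_rateFn {z : E N × ℝ} (hz : z ∈ closedCyl N) :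
    Tendsto (rateFn D h e) (𝓝[cyl N] z) (𝓝 (rateExt D h e z)) := by
  obtain ⟨hz1, hz2⟩ := mem_closedCyl.1 hz
  rcases eq_or_lt_of_le hz2 with h0 | h0
  · rw [rateExt, if_neg (by linarith), Metric.tendsto_nhds]
    intro ε hε
    set ρ := max 0 (1 - ε / 3)
    have hρ0 : 0 ≤ ρ := le_max_left _ _
    have hρ1 : ρ < 1 := max_lt one_pos (by linarith)
    have hρε : 1 - ε / 3 ≤ ρ := le_max_right _ _
    have hmem : ρ • e ∈ D := hH.mem _ (by
      rw [norm_smul, he, mul_one, Real.norm_eq_abs, abs_of_nonneg hρ0]; exact hρ1)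
    have e1 : ∀ᶠ w : E N × ℝ in 𝓝 z, |‖w.1‖ - ‖z.1‖| < ε / 3 := by
      have : Continuous fun w : E N × ℝ => |‖w.1‖ - ‖z.1‖| := by fun_prop
      exact (this.tendsto z).eventually_lt_const (by simp; linarith)
    have e2 : ∀ᶠ w : E N × ℝ in 𝓝 z, w.2 * h (ρ • e) < ε / 3 := by
      have : Continuous fun w : E N × ℝ => w.2 * h (ρ • e) := by fun_prop
      exact (this.tendsto z).eventually_lt_const (by rw [← h0]; simp; linarith)
    filter_upwards [nhdsWithin_le_nhds e1, nhdsWithin_le_nhds e2, self_mem_nhdsWithin]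
      with w hw1 hw2 hw
    have h3 := hH.rateFn_le hrad he hw
    have h4 := hH.le_rateFn he hw hmem
    have h5 : (1 - ε / 3) * (1 - ‖w.1‖) ≤ ρ * (1 - ‖w.1‖) := by
      gcongr; linarith [(mem_cyl.1 hw).1]
    have h6 := norm_nonneg w.1
    rw [abs_lt] at hw1
    rw [Real.dist_eq, abs_lt]
    constructor <;> nlinarith
  · rw [rateExt, if_pos h0]
    have hc : ContinuousAt (rateFn D h e) z := by
      have h1 : Continuous (realLag D h) := hH.lipschitzWith_realLag.continuous
      have h2 : Continuous (distBdry : E N → ℝ) := Metric.continuous_infDist_pt _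
      have h3 : ContinuousAt (fun w : E N × ℝ => (distBdry w.1 / w.2) • e) z :=
        ((h2.comp continuous_fst).continuousAt.div continuous_snd.continuousAt h0.ne').smul
          continuousAt_const
      exact continuous_snd.continuousAt.mul (h1.continuousAt.comp h3)
    exact hc.tendsto.mono_left nhdsWithin_le_nhds

/-! ### Comparison with the rate function -/

variable {f u : E N × ℝ → ℝ} {a : ℝ}


include hH hrad he in
/-- Supersolutions lie above the conical waves `min (a, r (1 - |x|) - t H(r))`, `r < 1`: the
regularised waves are classical subsolutions, as `H` is convex, radial and vanishes at `0`. -/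
lemma wave_le_supersolution (hu : IsSupersolution (modOp H) f u)
    (hlat : ∀ z : E N × ℝ, ‖z.1‖ = 1 → 0 ≤ z.2 → 0 ≤ f z)
    (hbot : ∀ x : E N, ‖x‖ < 1 → min a (1 - ‖x‖) ≤ f (x, 0))
    {r : ℝ} (hr0 : 0 ≤ r) (hr1 : r < 1) {z : E N × ℝ} (hz : z ∈ closedCyl N) :
    min a (r * (1 - ‖z.1‖) - z.2 * h (r • e)) ≤ u z := by
  have hrD : r • e ∈ D := hH.mem _ (by
    rw [norm_smul, he, mul_one, Real.norm_eq_abs, abs_of_nonneg hr0]; exact hr1)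
  have hn := hH.nonneg_of_mem hrad hrD
  refine le_of_forall_pos_le_add fun ε' hε' => ?_
  set ε := ε' / 2
  have hε : 0 < ε := half_pos hε'
  obtain ⟨g, g', hg, hgd, hg', hgle, hgge⟩ := exists_smooth_min a hε
  set S : E N → ℝ := fun x => √(‖x - 0‖ ^ 2 + ε ^ 2)
  have hS0 : ∀ x, 0 < S x := fun x => by positivity
  have hSle : ∀ x : E N, ‖x‖ ≤ S x := fun x => Real.le_sqrt_of_sq_le (by simp; positivity)
  have hSge : ∀ x : E N, S x ≤ ‖x‖ + ε := fun x => by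
    refine Real.sqrt_le_iff.2 ⟨by positivity, ?_⟩
    rw [sub_zero]
    nlinarith [norm_nonneg x]
  set W : E N × ℝ → ℝ := fun w => r * (1 - S w.1) - w.2 * h (r • e)
  have hW : ContDiff ℝ ∞ W := by
    have h1 : ContDiff ℝ ∞ (fun z : E N × ℝ => ‖z.1 - 0‖ ^ 2) :=
      (contDiff_fst.sub contDiff_const).norm_sq ℝ
    have h3 : ContDiff ℝ ∞ (fun z : E N × ℝ => S z.1) :=
      (h1.add contDiff_const).sqrt fun z => by positivity
    exact (contDiff_const.mul (contDiff_const.sub h3)).sub (contDiff_snd.mul contDiff_const)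
  have hWle : ∀ w, W w ≤ r * (1 - ‖w.1‖) - w.2 * h (r • e) := fun w => by
    have := mul_le_mul_of_nonneg_left (hSle w.1) hr0
    simp only [W]; linarith
  have key := ge_of_contact (ψ := fun w => g (W w)) hu.1 (hg.comp hW)
      (fun φ hφ w hw _ hτ hp hmin => by
    have hτ' : timeDeriv (fun w => g (W w)) w = g' (W w) * (-h (r • e)) := by
      refine timeDeriv_eq ?_
      have h1 : HasDerivAt (fun s => W (w.1, s)) (-h (r • e)) w.2 :=
        (((hasDerivAt_id w.2).mul_const (h (r • e))).const_sub
          (r * (1 - S w.1))).congr_deriv (by simp)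
      exact (hgd (W w)).comp w.2 h1
    have hp' : spaceGrad (fun w => g (W w)) w = (-(g' (W w) * (r / S w.1))) • w.1 := by
      refine spaceGrad_eq ?_
      have h1 : HasGradientAt (fun x => W (x, w.2))
          ((r * -(1 / (2 * S w.1))) • (2 : ℝ) • (w.1 - 0)) w.1 := by
        refine hasGradientAt_comp (k := fun s => r * (1 - √(s + ε ^ 2)) - w.2 * h (r • e)) ?_
          (hasGradientAt_norm_sub_sq 0 w.1)
        exact ((((hasDerivAt_id (‖w.1 - 0‖ ^ 2)).add_const (ε ^ 2)).sqrt
          (by simp only [id]; positivity)).const_sub 1).const_mul r |>.sub_const _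
      have h2 := hasGradientAt_comp (k := g) (f := fun x => W (x, w.2)) (hgd (W w)) h1
      convert h2 using 1
      rw [sub_zero, smul_smul, smul_smul]
      congr 1
      have := (hS0 w.1).ne'
      field_simp
    obtain ⟨hg0, hg1⟩ := hg' (W w)
    have hnorm : ‖spaceGrad φ w‖ ≤ g' (W w) * r := by
      rw [hp, hp', norm_smul, norm_neg, Real.norm_eq_abs,
        abs_of_nonneg (mul_nonneg hg0 (div_nonneg hr0 (hS0 _).le)), mul_assoc, div_mul_eq_mul_div]
      refine mul_le_mul_of_nonneg_left ?_ hg0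
      rw [div_le_iff₀ (hS0 _)]
      exact mul_le_mul_of_nonneg_left (hSle _) hr0
    obtain ⟨hpD, hple⟩ := hH.mem_and_le_of_norm_le hrad he hr0 hrD hg0 hg1 hnorm
    have hF : modOp H (timeDeriv φ w) (spaceGrad φ w) < 0 := by
      refine hH.modOp_neg (hnorm.trans_lt ?_) ?_
      · exact (mul_le_of_le_one_left hr0 hg1).trans_lt hr1
      · rw [hτ'] at hτ; linarith
    obtain ⟨hb, hle⟩ := hu.contact hφ hw hmin hF
    refine le_trans ?_ hle
    refine (hgle _).trans ((min_le_min_left a (hWle w)).trans ?_)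
    rcases mem_parBdry.1 hb with ⟨h1, h2⟩ | ⟨h1, h2⟩
    · refine (min_le_right _ _).trans (le_trans ?_ (hlat w h1 h2))
      rw [h1]
      have := mul_nonneg h2 hn
      linarith
    · have h3 : f w = f (w.1, 0) := by rw [← h2]
      rw [h3]
      refine le_trans (min_le_min_left a ?_) (hbot w.1 h1)
      rw [h2]
      have : r * (1 - ‖w.1‖) ≤ 1 * (1 - ‖w.1‖) := by gcongr
      linarith) hz
  have h1 : r * (1 - ‖z.1‖) - z.2 * h (r • e) ≤ W z + ε := by
    have h2 := mul_le_mul_of_nonneg_left (hSge z.1) hr0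
    have h3 : r * ε ≤ 1 * ε := by gcongr
    simp only [W]; linarith
  have h2 : min a (r * (1 - ‖z.1‖) - z.2 * h (r • e)) ≤ min a (W z) + ε :=
    (min_le_min_left a h1).trans (by
      rw [← min_add_add_right]; exact min_le_min_right _ (by linarith))
  have h3 := hgge (W z)
  have h4 : ε' = ε + ε := by simp [ε]
  linarith

include hH hrad he in
lemma rateFn_le_supersolution (hu : IsSupersolution (modOp H) f u) (ha : 0 ≤ a)
    (hlat : ∀ z : E N × ℝ, ‖z.1‖ = 1 → 0 ≤ z.2 → 0 ≤ f z)
    (hbot : ∀ x : E N, ‖x‖ < 1 → min a (1 - ‖x‖) ≤ f (x, 0))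
    {z : E N × ℝ} (hz : z ∈ cyl N) : min a (rateFn D h e z) ≤ u z := by
  obtain ⟨r, hr0, hr1, hrD, hr⟩ := hH.exists_rateFn_eq hrad he hz
  have h0 := hH.rateFn_nonneg (e := e) (mem_cyl.1 hz).2.le
  have hle1 : min a (rateFn D h e z) ≤ 1 :=
    (min_le_right _ _).trans ((hH.rateFn_le hrad he hz).trans (by linarith [norm_nonneg z.1]))
  have hm0 : 0 ≤ min a (rateFn D h e z) := le_min ha h0
  -- the optimal radius may be `1`, so it is approached from below
  have key : ∀ ρ : ℝ, 0 ≤ ρ → ρ < 1 → ρ * min a (rateFn D h e z) ≤ u z := fun ρ hρ0 hρ1 => by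
    have h1 := hH.wave_le_supersolution hrad he hu hlat hbot (mul_nonneg hρ0 hr0)
      ((mul_le_of_le_one_right hρ0 hr1).trans_lt hρ1) (cyl_subset_closedCyl hz)
    refine le_trans (le_min ?_ ?_) h1
    · calc ρ * min a (rateFn D h e z) ≤ 1 * min a (rateFn D h e z) := by gcongr
        _ ≤ a := by rw [one_mul]; exact min_le_left _ _
    · have h2 := (hH.smul_mem_and_le hrD hρ0 hρ1.le).2
      rw [smul_smul] at h2
      have h3 := mul_le_mul_of_nonneg_left h2 (mem_cyl.1 hz).2.le
      have h4 : ρ * min a (rateFn D h e z) ≤ ρ * rateFn D h e z := by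
        gcongr; exact min_le_right _ _
      have h5 : ρ * rateFn D h e z = ρ * r * (1 - ‖z.1‖) - z.2 * (ρ * h (r • e)) := by
        rw [hr]; ring
      linarith
  refine le_of_forall_pos_le_add fun ε hε => ?_
  have h1 := key (1 - min 1 ε) (by simp) (by simp [hε])
  have h2 : min 1 ε * min a (rateFn D h e z) ≤ ε * 1 := by
    gcongr; exact min_le_right _ _
  linarith

include hH in
lemma subsolution_le_const (hu : IsSubsolution (modOp H) f u)
    (hf : ∀ z ∈ parBdry N, f z ≤ a) {z : E N × ℝ} (hz : z ∈ closedCyl N) : u z ≤ a := by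
  refine le_of_contact (ψ := fun _ => a) hu.1 contDiff_const (fun φ hφ w hw _ hτ hp hmax => ?_) hz
  have h1 : timeDeriv (fun _ : E N × ℝ => a) w = 0 := timeDeriv_eq (hasDerivAt_const _ _)
  have h2 : spaceGrad (fun _ : E N × ℝ => a) w = 0 := spaceGrad_eq (hasGradientAt_const _ _)
  rw [h1] at hτ
  rw [h2] at hp
  obtain ⟨hb, hle⟩ := hu.contact hφ hw hmax (hH.modOp_pos fun _ _ => by
    rw [hp, hH.map_zero]; linarith)
  exact hle.trans (hf w hb)

include hH he in
/-- The gradient constraint and the lateral data bound subsolutions by the distance to the lateral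
boundary; the barriers are affine functions of slope larger than `1`. -/
lemma subsolution_le_dist (hu : IsSubsolution (modOp H) f u) (ha : 0 ≤ a)
    (hf : ∀ z ∈ parBdry N, f z ≤ a) (hlat : ∀ z : E N × ℝ, ‖z.1‖ = 1 → 0 ≤ z.2 → f z ≤ 0)
    {z : E N × ℝ} (hz : z ∈ cyl N) : u z ≤ 1 - ‖z.1‖ := by
  obtain ⟨hz1, hz2⟩ := mem_cyl.1 hz
  obtain ⟨ν, hν, hzν⟩ := exists_unit_direction he z.1
  refine le_of_forall_pos_le_add fun ε hε => ?_
  set K := a / z.2 ^ 2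
  have hK : K * z.2 ^ 2 = a := by simp only [K]; field_simp
  have hK0 : 0 ≤ K := by positivity
  set ψ : E N × ℝ → ℝ := fun w => (1 + ε) * (1 + inner ℝ (-ν) w.1) + K * (w.2 - z.2) ^ 2
  have hψ : ContDiff ℝ ∞ ψ := by
    have : ContDiff ℝ ∞ fun w : E N × ℝ => (inner ℝ (-ν) w.1 : ℝ) :=
      contDiff_const.inner ℝ contDiff_fst
    simp only [ψ]; fun_prop
  have hpos : ∀ w ∈ closedCyl N, 0 ≤ (1 + ε) * (1 + (inner ℝ (-ν) w.1 : ℝ)) := fun w hw => by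
    have h1 := (abs_le.1 (abs_real_inner_le_norm (-ν) w.1)).1
    rw [norm_neg, hν, one_mul] at h1
    exact mul_nonneg (by linarith) (by linarith [(mem_closedCyl.1 hw).1])
  have key := le_barrier (T := 2 * z.2) hu.1 hψ.continuous (fun w hw hwT => by
      have h1 := hH.subsolution_le_const hu hf hw
      have h2 := hpos w hw
      have h3 : K * (w.2 - z.2) ^ 2 = a := by rw [hwT, ← hK]; ring
      simp only [ψ]; linarith)
    (fun w hw hwT hmax => by
      have hp : spaceGrad ψ w = (1 + ε) • (-ν) := by
        have h1 := hasGradientAt_add_const (hasGradientAt_comp (k := fun s => (1 + ε) * (1 + s))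
          (((hasDerivAt_id (inner ℝ (-ν) w.1 : ℝ)).const_add 1).const_mul (1 + ε))
          (hasGradientAt_inner_left (-ν) w.1)) (K * (w.2 - z.2) ^ 2)
        rw [mul_one] at h1
        exact spaceGrad_eq h1
      obtain ⟨hb, hle⟩ := hu.contact hψ hw hmax (hH.modOp_pos fun _ h1 => absurd h1 (not_le.2 (by
        rw [hp, norm_smul, norm_neg, hν, Real.norm_eq_abs, abs_of_pos (by linarith)]; linarith)))
      have h2 := hpos w hw
      rcases mem_parBdry.1 hb with ⟨h3, h4⟩ | ⟨h3, h4⟩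
      · have h5 := hlat w h3 h4
        have h6 : 0 ≤ K * (w.2 - z.2) ^ 2 := by positivity
        simp only [ψ]; linarith
      · have h5 := hf w hb
        have h6 : K * (w.2 - z.2) ^ 2 = a := by rw [h4, ← hK]; ring
        simp only [ψ]; linarith)
    (cyl_subset_closedCyl hz) (by linarith)
  have h1 : (inner ℝ (-ν) z.1 : ℝ) = -‖z.1‖ := by
    have h2 : (inner ℝ (-ν) z.1 : ℝ) = inner ℝ (-ν) (‖z.1‖ • ν) := by rw [← hzν]
    rw [h2, inner_neg_left, inner_smul_right, real_inner_self_eq_norm_sq, hν]; ring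
  simp only [ψ, sub_self, h1] at key
  nlinarith [norm_nonneg z.1]

include hH hrad he in
/-- Subsolutions with initial values below the distance to the lateral boundary lie below the rate
function. The barrier is `t L(q)` plus a smooth convex function transported with the velocity `q`
of the straight path from the nearest lateral boundary point to the point of interest; it is a
classical supersolution by the Fenchel inequality. -/
lemma subsolution_le_rateFn (hu : IsSubsolution (modOp H) f u)
    (hlat : ∀ z : E N × ℝ, ‖z.1‖ = 1 → 0 ≤ z.2 → f z ≤ 0)
    (hbot : ∀ x : E N, ‖x‖ < 1 → u (x, 0) ≤ 1 - ‖x‖)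
    {z : E N × ℝ} (hz : z ∈ cyl N) : u z ≤ rateFn D h e z := by
  obtain ⟨hz1, hz2⟩ := mem_cyl.1 hz
  obtain ⟨ν, hν, hzν⟩ := exists_unit_direction he z.1
  set q : E N := (-((1 - ‖z.1‖) / z.2)) • ν
  set L := realLag D h q
  have hL : rateFn D h e z = z.2 * L := by
    rw [rateFn, distBdry_eq he hz1.le]
    congr 1
    refine hH.realLag_radial hrad ?_
    simp [q, norm_smul, he, hν]
  refine le_of_forall_pos_le_add fun ε hε => ?_
  set ψ : E N × ℝ → ℝ := fun w => w.2 * L + (1 / (2 * ε) * ‖w.1 - (w.2 • q + ν)‖ ^ 2 + ε / 2)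
  have hψ : ContDiff ℝ ∞ ψ := by
    have : ContDiff ℝ ∞ fun w : E N × ℝ => ‖w.1 - (w.2 • q + ν)‖ ^ 2 :=
      (contDiff_fst.sub ((contDiff_snd.smul contDiff_const).add contDiff_const)).norm_sq ℝ
    simp only [ψ]; fun_prop
  have key := le_of_contact hu.1 hψ (fun φ hφ w hw _ hτ hp hmax => by
    set p := (1 / ε) • (w.1 - (w.2 • q + ν))
    have hp' : spaceGrad ψ w = p := by
      refine spaceGrad_eq ?_
      have h1 := hasGradientAt_comp (f := fun y => ‖y - (w.2 • q + ν)‖ ^ 2)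
        (k := fun s => w.2 * L + (1 / (2 * ε) * s + ε / 2))
        ((((hasDerivAt_id (‖w.1 - (w.2 • q + ν)‖ ^ 2)).const_mul (1 / (2 * ε))).add_const
          (ε / 2)).const_add (w.2 * L)) (hasGradientAt_norm_sub_sq (w.2 • q + ν) w.1)
      convert h1 using 1
      rw [smul_smul]
      simp only [p]
      congr 1
      field_simp
    have hτ' : timeDeriv ψ w = L - inner ℝ p q := by
      refine timeDeriv_eq ?_
      have h1 : HasDerivAt (fun s : ℝ => w.1 - (s • q + ν)) (-q) w.2 := by
        simpa using (((hasDerivAt_id w.2).smul_const q).add_const ν).const_sub w.1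
      have h2 := (((h1.norm_sq).const_mul (1 / (2 * ε))).add_const (ε / 2))
      refine (((hasDerivAt_id w.2).mul_const L).add h2).congr_deriv ?_
      simp only [p, inner_neg_right, inner_smul_left, conj_trivial]
      field_simp
      ring
    rw [hp'] at hp
    rw [hτ'] at hτ
    obtain ⟨hb, hle⟩ := hu.contact hφ hw hmax (hH.modOp_pos fun hpD _ => by
      rw [hp] at hpD ⊢
      have := hH.le_realLag hpD q
      linarith)
    have h0 : 0 ≤ 1 / (2 * ε) * ‖w.1 - (w.2 • q + ν)‖ ^ 2 := by positivity
    have hL0 : 0 ≤ L := hH.realLag_nonneg q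
    rcases mem_parBdry.1 hb with ⟨h1, h2⟩ | ⟨h1, h2⟩
    · have h3 := hlat w h1 h2
      have h4 := mul_nonneg h2 hL0
      simp only [ψ]; linarith
    · have h3 := hbot w.1 h1
      have h4 : u w = u (w.1, 0) := by rw [← h2]
      have h5 := norm_sub_norm_le ν w.1
      rw [hν, norm_sub_rev] at h5
      have h6 : ‖w.1 - ν‖ ≤ 1 / (2 * ε) * ‖w.1 - ν‖ ^ 2 + ε / 2 := by
        have : 1 / (2 * ε) * ‖w.1 - ν‖ ^ 2 + ε / 2 - ‖w.1 - ν‖ = (‖w.1 - ν‖ - ε) ^ 2 / (2 * ε) := by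
          field_simp; ring
        have h7 : 0 ≤ (‖w.1 - ν‖ - ε) ^ 2 / (2 * ε) := by positivity
        linarith
      simp only [ψ, h2, zero_smul, zero_add, zero_mul]
      linarith) (cyl_subset_closedCyl hz)
  have h1 : z.1 - (z.2 • q + ν) = 0 := by
    have h2 : z.2 * (-((1 - ‖z.1‖) / z.2)) = ‖z.1‖ - 1 := by field_simp; ring
    simp only [q]
    rw [smul_smul, h2, sub_smul, one_smul, sub_add_cancel, ← hzν, sub_self]
  simp only [ψ, h1, norm_zero] at key
  rw [hL]
  linarith

include hH hrad he in
/-- Every solution of the modified equation with vanishing lateral data and with initial data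
between `min (a, dist)` and `a` is the minimum of `a` and the rate function. -/
theorem viscositySolution_eq (ha : 0 ≤ a) (hu : IsViscositySolution (modOp H) f u)
    (hlat : ∀ z : E N × ℝ, ‖z.1‖ = 1 → 0 ≤ z.2 → f z = 0)
    (hbot : ∀ x : E N, ‖x‖ < 1 → min a (1 - ‖x‖) ≤ f (x, 0) ∧ f (x, 0) ≤ a)
    {z : E N × ℝ} (hz : z ∈ cyl N) : u z = min a (rateFn D h e z) := by
  obtain ⟨hbdd, hsub, hsup⟩ := hu
  have hle := le_upperEnv (hbdd z (cyl_subset_closedCyl hz)) hz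
  have hge := lowerEnv_le (hbdd z (cyl_subset_closedCyl hz)) hz
  have hf : ∀ z ∈ parBdry N, f z ≤ a := fun w hw => by
    rcases mem_parBdry.1 hw with ⟨h1, h2⟩ | ⟨h1, h2⟩
    · rw [hlat w h1 h2]; exact ha
    · have : f w = f (w.1, 0) := by rw [← h2]
      rw [this]; exact (hbot w.1 h1).2
  have hlat' : ∀ z : E N × ℝ, ‖z.1‖ = 1 → 0 ≤ z.2 → f z ≤ 0 := fun w h1 h2 => (hlat w h1 h2).le
  have hinit : ∀ x : E N, ‖x‖ < 1 → upperEnv u (x, 0) ≤ 1 - ‖x‖ := fun x hx => by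
    have hx0 : ((x, 0) : E N × ℝ) ∈ closedCyl N := mem_closedCyl.2 ⟨hx.le, le_rfl⟩
    refine upperEnv_le (hbdd _ hx0) hx0 fun ε hε => ?_
    have e1 : ∀ᶠ w : E N × ℝ in 𝓝 (x, 0), 1 - ‖w.1‖ < 1 - ‖x‖ + ε := by
      have : Continuous fun w : E N × ℝ => 1 - ‖w.1‖ := by fun_prop
      exact (this.tendsto (x, (0 : ℝ))).eventually_lt_const (by simp; linarith)
    filter_upwards [nhdsWithin_le_nhds e1, self_mem_nhdsWithin] with w hw1 hw
    have h1 := le_upperEnv (hbdd w (cyl_subset_closedCyl hw)) hw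
    have h2 := hH.subsolution_le_dist he hsub ha hf hlat' hw
    linarith
  refine le_antisymm (le_min ?_ ?_) ?_
  · exact hle.trans (hH.subsolution_le_const hsub hf (cyl_subset_closedCyl hz))
  · exact hle.trans (hH.subsolution_le_rateFn hrad he hsub hlat' hinit hz)
  · exact (hH.rateFn_le_supersolution hrad he hsup ha (fun w h1 h2 => (hlat w h1 h2).ge)
      (fun x hx => (hbot x hx).1) hz).trans hge

end IsCriticalHamiltonian

/-! ### Existence -/

section Congruence

variable {u v : E N × ℝ → ℝ}

lemma upperEnv_congr (huv : Set.EqOn u v (cyl N)) : upperEnv u = upperEnv v := by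
  ext z
  refine limsup_congr ?_
  filter_upwards [self_mem_nhdsWithin] with w hw using huv hw

lemma lowerEnv_congr (huv : Set.EqOn u v (cyl N)) : lowerEnv u = lowerEnv v := by
  ext z
  refine liminf_congr ?_
  filter_upwards [self_mem_nhdsWithin] with w hw using huv hw

lemma IsViscositySolution.congr {F : ℝ → E N → EReal} {f : E N × ℝ → ℝ}
    (hu : IsViscositySolution F f u) (huv : Set.EqOn u v (cyl N)) : IsViscositySolution F f v := by
  obtain ⟨h1, h2, h3⟩ := hu
  refine ⟨fun z hz => ?_, ?_, ?_⟩
  · obtain ⟨C, hC⟩ := h1 z hz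
    refine ⟨C, ?_⟩
    filter_upwards [hC, self_mem_nhdsWithin] with w hw hw'
    rwa [← huv hw']
  · rwa [← upperEnv_congr huv]
  · rwa [← lowerEnv_congr huv]

end Congruence

lemma tendsto_spaceTime_line (z : E N × ℝ) (v : E N) (σ : ℝ) :
    Tendsto (fun s : ℝ => (z.1 + s • v, z.2 + s * σ)) (𝓝 0) (𝓝 z) := by
  have : Continuous fun s : ℝ => (z.1 + s • v, z.2 + s * σ) := by fun_prop
  simpa using this.tendsto 0

lemma le_mul_min_zero {s b c : ℝ} (hs : 0 ≤ s) (h : min 0 (s * b) ≤ c) : s * min 0 b ≤ c := by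
  rwa [mul_min_of_nonneg _ _ hs, mul_zero]

lemma distData_eq {e : E N} (he : ‖e‖ = 1) {z : E N × ℝ} (hz : z ∈ parBdry N) :
    distData z = 1 - ‖z.1‖ := by
  rw [distData]
  rcases mem_parBdry.1 hz with ⟨h1, h2⟩ | ⟨h1, h2⟩
  · rw [if_neg (by simp [h1]), h1, sub_self]
  · rw [if_pos (by simpa using h1), distBdry_eq he h1.le]

namespace IsCriticalHamiltonian

variable {H : E N → EReal} {D : Set (E N)} {h : E N → ℝ} (hH : IsCriticalHamiltonian H D h)
  (hrad : IsRadial D h) {e : E N} (he : ‖e‖ = 1) {a : ℝ}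

include hH hrad he in
/-- At a point where `φ` touches `min (a, I)` from above, it also touches from above the minimum of
`a` and the conical wave attaining the supremum in the definition of `I`. The supergradients of the
latter are subsolutions of the equation, as `H` is convex, radial and vanishes at `0`. -/
lemma supergradient_rateFn {φ : E N × ℝ → ℝ} (hφ : ContDiff ℝ ∞ φ) {z : E N × ℝ} (hz : z ∈ cyl N)
    (hmax : ∀ᶠ w in 𝓝 z, min a (rateFn D h e w) - φ w ≤ min a (rateFn D h e z) - φ z) :
    spaceGrad φ z ∈ D ∧ timeDeriv φ z + h (spaceGrad φ z) ≤ 0 := by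
  obtain ⟨r, hr0, hr1, hrD, hr⟩ := hH.exists_rateFn_eq hrad he hz
  have hn := hH.nonneg_of_mem hrad hrD
  set p := spaceGrad φ z
  set τ := timeDeriv φ z
  set k := h (r • e)
  have key : ∀ (v : E N) (σ : ℝ), min 0 (-(r * ‖v‖) - σ * k) ≤ inner ℝ p v + σ * τ := fun v σ => by
    refine ge_of_hasDerivAt_of_eventually_ge (hasDerivAt_spaceTime_line hφ z v σ) ?_
    have htend := tendsto_spaceTime_line z v σ
    filter_upwards [nhdsWithin_le_nhds (htend.eventually hmax), self_mem_nhdsWithin,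
      nhdsWithin_le_nhds (htend.eventually (isOpen_cyl.mem_nhds hz))] with s hs hs0 hsc
    have hs0 : 0 < s := hs0
    refine le_mul_min_zero hs0.le ?_
    have h1 := hH.le_rateFn he hsc hrD
    simp only at h1
    have h2 : ‖z.1 + s • v‖ ≤ ‖z.1‖ + s * ‖v‖ := by
      refine (norm_add_le _ _).trans ?_
      rw [norm_smul, Real.norm_eq_abs, abs_of_pos hs0]
    have h3 := mul_le_mul_of_nonneg_left h2 hr0
    have h4 : rateFn D h e z + s * (-(r * ‖v‖) - σ * k) ≤
        rateFn D h e (z.1 + s • v, z.2 + s * σ) := by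
      rw [hr]; linarith
    have h5 : min 0 (s * (-(r * ‖v‖) - σ * k)) + min a (rateFn D h e z) ≤
        min a (rateFn D h e (z.1 + s • v, z.2 + s * σ)) := by
      refine le_min ?_ ?_
      · linarith [min_le_left 0 (s * (-(r * ‖v‖) - σ * k)), min_le_left a (rateFn D h e z)]
      · linarith [min_le_right 0 (s * (-(r * ‖v‖) - σ * k)), min_le_right a (rateFn D h e z)]
    simp only [zero_smul, zero_mul, add_zero]
    linarith
  have hpr : ‖p‖ ≤ r := by
    have h1 := key (-p) 0
    rw [norm_neg, zero_mul, zero_mul, sub_zero, add_zero, inner_neg_right,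
      real_inner_self_eq_norm_sq, min_eq_right (by nlinarith [norm_nonneg p])] at h1
    by_contra! h2
    nlinarith [norm_nonneg p]
  rcases eq_or_lt_of_le (norm_nonneg p) with hp0 | hp0
  · have hp : p = 0 := norm_eq_zero.1 hp0.symm
    have h1 := key 0 (-1)
    rw [norm_zero, inner_zero_right, min_eq_left (by linarith)] at h1
    rw [hp, hH.map_zero]
    exact ⟨hH.zero_mem, by linarith⟩
  · have hr : 0 < r := hp0.trans_le hpr
    obtain ⟨h1, h2⟩ := hH.mem_and_le_of_norm_le hrad he hr0 hrD (μ := ‖p‖ / r) (by positivity)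
      ((div_le_one hr).2 hpr) (le_of_eq (by field_simp))
    refine ⟨h1, ?_⟩
    -- the wave is constant to first order along this direction
    have h3 := key ((-(k / (r * ‖p‖))) • p) (-1)
    rw [norm_smul, norm_neg, Real.norm_eq_abs, abs_of_nonneg (by positivity), inner_smul_right,
      real_inner_self_eq_norm_sq] at h3
    have h4 : -(r * (k / (r * ‖p‖) * ‖p‖)) - -1 * k = 0 := by field_simp; ring
    rw [h4, min_self] at h3
    have h5 : -(k / (r * ‖p‖)) * ‖p‖ ^ 2 = -(‖p‖ / r * k) := by field_simp
    rw [h5] at h3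
    linarith

include hH hrad he in
/-- At a point where `φ` touches `min (a, I)` from below, either the constraint `a` is active and
`φ` does not increase in time, or one follows backwards the optimal path to the nearest point of
the lateral boundary, along which `I` is linear, and concludes by the Fenchel inequality. -/
lemma subgradient_rateFn {φ : E N × ℝ → ℝ} (hφ : ContDiff ℝ ∞ φ) {z : E N × ℝ} (hz : z ∈ cyl N)
    (hmin : ∀ᶠ w in 𝓝 z, min a (rateFn D h e z) - φ z ≤ min a (rateFn D h e w) - φ w)
    (hp : spaceGrad φ z ∈ D) : 0 ≤ timeDeriv φ z + h (spaceGrad φ z) := by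
  obtain ⟨hz1, hz2⟩ := mem_cyl.1 hz
  set p := spaceGrad φ z
  set τ := timeDeriv φ z
  rcases le_or_gt a (rateFn D h e z) with hcase | hcase
  · have h0 := hH.nonneg_of_mem hrad hp
    have h1 := le_of_hasDerivAt_of_eventually_le (c := 0)
      (hasDerivAt_spaceTime_line hφ z 0 (-1)) (by
      filter_upwards [nhdsWithin_le_nhds ((tendsto_spaceTime_line z 0 (-1)).eventually hmin)]
        with s hs
      rw [min_eq_left hcase] at hs
      have h2 := min_le_left a (rateFn D h e (z.1 + s • (0 : E N), z.2 + s * -1))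
      simp only [smul_zero, add_zero, zero_mul, mul_zero] at hs h2 ⊢
      linarith)
    rw [inner_zero_right] at h1
    linarith
  · obtain ⟨ν, hν, hzν⟩ := exists_unit_direction he z.1
    set b := (1 - ‖z.1‖) / z.2
    have hb0 : 0 ≤ b := div_nonneg (by linarith) hz2.le
    have hbz : b * z.2 = 1 - ‖z.1‖ := by simp only [b]; field_simp
    have h1 := le_of_hasDerivAt_of_eventually_le (c := -realLag D h (b • e))
      (hasDerivAt_spaceTime_line hφ z (b • ν) (-1)) (by
      have htend := tendsto_spaceTime_line z (b • ν) (-1)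
      filter_upwards [nhdsWithin_le_nhds (htend.eventually hmin), self_mem_nhdsWithin,
        nhdsWithin_le_nhds (htend.eventually (isOpen_cyl.mem_nhds hz))] with s hs hs0 hsc
      have hs0 : 0 < s := hs0
      rw [min_eq_right hcase.le] at hs
      have h2 := min_le_right a (rateFn D h e (z.1 + s • b • ν, z.2 + s * -1))
      obtain ⟨hc1, hc2⟩ := mem_cyl.1 hsc
      simp only at hc1 hc2
      have h3 : ‖z.1 + s • b • ν‖ = ‖z.1‖ + s * b := by
        have : z.1 + s • b • ν = (‖z.1‖ + s * b) • ν := by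
          rw [add_smul, ← hzν, smul_smul]
        rw [this, norm_smul, hν, mul_one, Real.norm_eq_abs, abs_of_nonneg (by positivity)]
      have h4 : rateFn D h e (z.1 + s • b • ν, z.2 + s * -1) =
          (z.2 - s) * realLag D h (b • e) := by
        rw [rateFn, distBdry_eq he hc1.le, h3]
        have h5 : (1 - (‖z.1‖ + s * b)) / (z.2 + s * -1) = b := by
          rw [div_eq_iff hc2.ne']; linarith
        simp only [h5]; ring
      have h6 : rateFn D h e z = z.2 * realLag D h (b • e) := by
        rw [rateFn, distBdry_eq he hz1.le]
      simp only [zero_smul, zero_mul, add_zero]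
      rw [h4] at h2 hs
      rw [h6] at hs
      linarith)
    have h2 := hH.le_realLag hp (-(b • ν))
    have h3 : realLag D h (-(b • ν)) = realLag D h (b • e) :=
      hH.realLag_radial hrad (by simp [norm_smul, he, hν])
    rw [h3, inner_neg_right] at h2
    linarith

include hH hrad he in
/-- A criterion for `min (a, I)` to solve an equation in the cylinder that is equivalent to
`u_t + H(Du) = 0` there, given the boundary inequalities for its continuous extension. -/
lemma isViscositySolution_min_rateFn {F : ℝ → E N → EReal} {f : E N × ℝ → ℝ} (ha : 0 ≤ a)
    (hFle : ∀ τ p, p ∈ D → τ + h p ≤ 0 → F τ p ≤ 0)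
    (hFge : ∀ τ p, (p ∈ D → 0 ≤ τ + h p) → 0 ≤ F τ p)
    (hbsub : ∀ z ∈ parBdry N, min a (rateExt D h e z) ≤ f z)
    (hbsup : ∀ φ : E N × ℝ → ℝ, ContDiff ℝ ∞ φ → ∀ z ∈ parBdry N,
      IsLocalMinOn (fun w => min a (rateExt D h e w) - φ w) (closedCyl N) z →
      f z ≤ min a (rateExt D h e z) ∨ 0 ≤ F (timeDeriv φ z) (spaceGrad φ z)) :
    IsViscositySolution F f (fun z => min a (rateFn D h e z)) := by
  set U : E N × ℝ → ℝ := fun z => min a (rateFn D h e z)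
  set G : E N × ℝ → ℝ := fun z => min a (rateExt D h e z)
  have hlim : ∀ z ∈ closedCyl N, Tendsto U (𝓝[cyl N] z) (𝓝 (G z)) := fun z hz =>
    tendsto_const_nhds.min (hH.tendsto_rateFn hrad he hz)
  have hup : ∀ z ∈ closedCyl N, upperEnv U z = G z := fun z hz =>
    upperEnv_eq_of_tendsto hz (hlim z hz)
  have hlo : ∀ z ∈ closedCyl N, lowerEnv U z = G z := fun z hz =>
    lowerEnv_eq_of_tendsto hz (hlim z hz)
  have hUG : Set.EqOn U G (cyl N) := fun z hz => by
    simp only [U, G, rateExt_of_mem_cyl hz]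
  have hcont : ContinuousOn G (closedCyl N) := by
    refine fun z hz => ?_
    have h1 : ContinuousOn (extendFrom (cyl N) U) (closedCyl N) :=
      continuousOn_extendFrom (by rw [closure_cyl]) fun w hw => ⟨_, hlim w hw⟩
    refine (h1 z hz).congr (fun w hw => ?_) ?_
    · exact (extendFrom_eq (by rwa [closure_cyl]) (hlim w hw)).symm
    · exact (extendFrom_eq (by rwa [closure_cyl]) (hlim z hz)).symm
  have hint : ∀ z ∈ cyl N, closedCyl N ∈ 𝓝 z := fun z hz =>
    mem_of_superset (isOpen_cyl.mem_nhds hz) cyl_subset_closedCyl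
  refine ⟨fun z _ => ⟨a, ?_⟩, ⟨?_, fun φ hφ z hz hmax => ⟨fun hzc => ?_, fun hzb => ?_⟩⟩,
    ⟨?_, fun φ hφ z hz hmin => ⟨fun hzc => ?_, fun hzb => ?_⟩⟩⟩
  · filter_upwards [self_mem_nhdsWithin] with w hw
    rw [abs_of_nonneg (le_min ha (hH.rateFn_nonneg (mem_cyl.1 hw).2.le))]
    exact min_le_left _ _
  · refine fun z hz y hy => ?_
    simp only [hup z hz] at hy
    filter_upwards [hcont.upperSemicontinuousOn z hz y hy, self_mem_nhdsWithin] with w hw hw'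
    simpa only [hup w hw'] using hw
  · have h1 := hH.supergradient_rateFn hrad he (a := a) hφ hzc (by
      have h2 : ∀ᶠ w in 𝓝 z, upperEnv U w - φ w ≤ upperEnv U z - φ z := by
        have := hmax
        rwa [IsLocalMaxOn, IsMaxFilter, nhdsWithin_eq_nhds.2 (hint z hzc)] at this
      filter_upwards [h2, isOpen_cyl.mem_nhds hzc] with w hw hwc
      rw [hup z hz, hup w (cyl_subset_closedCyl hwc), ← hUG hwc, ← hUG hzc] at hw
      exact hw)
    exact hFle _ _ h1.1 h1.2
  · refine min_le_of_right_le ?_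
    rw [hup z hz]
    exact_mod_cast sub_nonpos.2 (hbsub z hzb)
  · refine fun z hz y hy => ?_
    simp only [hlo z hz] at hy
    filter_upwards [hcont.lowerSemicontinuousOn z hz y hy, self_mem_nhdsWithin] with w hw hw'
    simpa only [hlo w hw'] using hw
  · refine hFge _ _ fun hpD => hH.subgradient_rateFn hrad he (a := a) hφ hzc ?_ hpD
    have h2 : ∀ᶠ w in 𝓝 z, lowerEnv U z - φ z ≤ lowerEnv U w - φ w := by
      have := hmin
      rwa [IsLocalMinOn, IsMinFilter, nhdsWithin_eq_nhds.2 (hint z hzc)] at this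
    filter_upwards [h2, isOpen_cyl.mem_nhds hzc] with w hw hwc
    rw [hlo z hz, hlo w (cyl_subset_closedCyl hwc), ← hUG hwc, ← hUG hzc] at hw
    exact hw
  · rcases hbsup φ hφ z hzb (by
      refine hmin.congr ?_ hz
      filter_upwards [self_mem_nhdsWithin] with w hw
      rw [hlo w hw]) with h1 | h1
    · refine le_max_of_le_right ?_
      rw [hlo z hz]
      exact_mod_cast sub_nonneg.2 h1
    · exact le_max_of_le_left h1

include hH in
lemma hjOp_nonpos {τ : ℝ} {p : E N} (hp : p ∈ D) (hτ : τ + h p ≤ 0) : hjOp H τ p ≤ 0 := by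
  rw [hjOp, hH.eq_coe p hp]; exact_mod_cast hτ

include hH in
lemma hjOp_nonneg {τ : ℝ} {p : E N} (hτ : p ∈ D → 0 ≤ τ + h p) : 0 ≤ hjOp H τ p := by
  rw [hjOp]
  by_cases hp : p ∈ D
  · rw [hH.eq_coe p hp]; exact_mod_cast hτ hp
  · rw [hH.eq_top p hp, EReal.coe_add_top]; exact le_top

include hH in
/-- The gradient constraint is implicit in `u_t + H(Du) ≤ 0`, as `H = +∞` off the closed unit
ball. -/
lemma modOp_nonpos_of_hjOp {τ : ℝ} {p : E N} (h0 : hjOp H τ p ≤ 0) : modOp H τ p ≤ 0 := by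
  refine max_le h0 ?_
  have hp : p ∈ D := by
    by_contra hp
    rw [hjOp, hH.eq_top p hp, EReal.coe_add_top] at h0
    exact absurd h0 (not_le.2 EReal.zero_lt_top)
  exact_mod_cast sub_nonpos.2 (hH.norm_le p hp)

include hH in
lemma modOp_solution_of_hjOp {f u : E N × ℝ → ℝ} (hu : IsViscositySolution (hjOp H) f u) :
    IsViscositySolution (modOp H) f u := by
  obtain ⟨h1, h2, h3⟩ := hu
  refine ⟨h1, ⟨h2.1, fun φ hφ z hz hm => ?_⟩, ⟨h3.1, fun φ hφ z hz hm => ?_⟩⟩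
  · obtain ⟨h4, h5⟩ := h2.2 φ hφ z hz hm
    refine ⟨fun hc => hH.modOp_nonpos_of_hjOp (h4 hc), fun hb => ?_⟩
    rcases min_le_iff.1 (h5 hb) with h6 | h6
    · exact min_le_of_left_le (hH.modOp_nonpos_of_hjOp h6)
    · exact min_le_of_right_le h6
  · obtain ⟨h4, h5⟩ := h3.2 φ hφ z hz hm
    refine ⟨fun hc => le_max_of_le_left (h4 hc), fun hb => (h5 hb).trans ?_⟩
    exact max_le_max_right _ (le_max_left _ _)

include hH hrad he in
lemma rateExt_of_mem_parBdry {z : E N × ℝ} (hz : z ∈ parBdry N) :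
    rateExt D h e z = 1 - ‖z.1‖ := by
  rcases mem_parBdry.1 hz with ⟨h1, h2⟩ | ⟨h1, h2⟩
  · rw [hH.rateExt_of_sphere hrad he h1, h1, sub_self]
  · rw [rateExt, if_neg (by rw [h2]; exact lt_irrefl _)]

include hH hrad he in
lemma eqOn_min_rateFn (ha : 1 ≤ a) :
    Set.EqOn (fun z => min a (rateFn D h e z)) (rateFn D h e) (cyl N) := fun z hz =>
  min_eq_right ((hH.rateFn_le hrad he hz).trans (by linarith [norm_nonneg z.1]))

include hH hrad he in
theorem isViscositySolution_rateFn : IsViscositySolution (hjOp H) distData (rateFn D h e) := by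
  have hb : ∀ z ∈ parBdry N, min 1 (rateExt D h e z) = distData z := fun z hz => by
    rw [distData_eq he hz, hH.rateExt_of_mem_parBdry hrad he hz]
    exact min_eq_right (by linarith [norm_nonneg z.1])
  exact (hH.isViscositySolution_min_rateFn hrad he zero_le_one
    (fun τ p hp hτ => hH.hjOp_nonpos hp hτ) (fun τ p hτ => hH.hjOp_nonneg hτ)
    (fun z hz => (hb z hz).le) (fun φ hφ z hz _ => Or.inl (hb z hz).ge)).congr
    (hH.eqOn_min_rateFn hrad he le_rfl)

include hH hrad he in
/-- At initial points where the data `a` is not attained, the gradient constraint is active: the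
solution has slope `1` towards the lateral boundary. -/
theorem isViscositySolution_min (ha : 0 ≤ a) :
    IsViscositySolution (modOp H) (constData a) (fun z => min a (rateFn D h e z)) := by
  refine hH.isViscositySolution_min_rateFn hrad he ha
    (fun τ p hp hτ => hH.modOp_nonpos_of_hjOp (hH.hjOp_nonpos hp hτ))
    (fun τ p hτ => le_max_of_le_left (hH.hjOp_nonneg hτ)) (fun z hz => ?_)
    (fun φ hφ z hz hmin => ?_)
  · rcases mem_parBdry.1 hz with ⟨h1, h2⟩ | ⟨h1, h2⟩
    · rw [constData, if_neg (by simp [h1]), hH.rateExt_of_sphere hrad he h1]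
      exact min_le_right _ _
    · rw [constData, if_pos (by simpa using h1)]
      exact min_le_left _ _
  · rcases mem_parBdry.1 hz with ⟨h1, h2⟩ | ⟨h1, h2⟩
    · left
      rw [constData, if_neg (by simp [h1]), hH.rateExt_of_sphere hrad he h1]
      exact le_min ha le_rfl
    · rw [constData, if_pos (by simpa using h1), hH.rateExt_of_mem_parBdry hrad he hz]
      rcases le_or_gt a (1 - ‖z.1‖) with hc | hc
      · left; exact le_min le_rfl hc
      · right
        refine le_max_of_le_right ?_
        obtain ⟨ν, hν, hzν⟩ := exists_unit_direction he z.1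
        have h3 := le_of_hasDerivAt_of_eventually_le (c := -1)
          (hasDerivAt_spaceTime_line hφ z ν 0) (by
          have hev := eventually_nhdsWithin_iff.1 hmin
          filter_upwards [nhdsWithin_le_nhds ((tendsto_spaceTime_line z ν 0).eventually hev),
            self_mem_nhdsWithin, nhdsWithin_le_nhds (gt_mem_nhds (sub_pos.2 h1))] with s hs hs0 hs1
          have hs0 : 0 < s := hs0
          have h4 : ‖z.1 + s • ν‖ = ‖z.1‖ + s := by
            have : z.1 + s • ν = (‖z.1‖ + s) • ν := by rw [add_smul, ← hzν]
            rw [this, norm_smul, hν, mul_one, Real.norm_eq_abs, abs_of_nonneg (by positivity)]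
          have h5 : (z.1 + s • ν, z.2 + s * 0) ∈ parBdry N :=
            mem_parBdry.2 (Or.inr ⟨by simp only; rw [h4]; linarith, by simp [h2]⟩)
          have h6 := hs (parBdry_subset_closedCyl h5)
          rw [hH.rateExt_of_mem_parBdry hrad he hz, hH.rateExt_of_mem_parBdry hrad he h5,
            min_eq_right hc.le] at h6
          have h7 := min_le_right a (1 - ‖z.1 + s • ν‖)
          simp only [zero_smul, add_zero, mul_zero] at h6 h7 ⊢
          rw [h4] at h6 h7
          linarith)
        have h4 := (abs_le.1 (abs_real_inner_le_norm (spaceGrad φ z) ν)).1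
        rw [hν, mul_one] at h4
        rw [zero_mul, add_zero] at h3
        exact_mod_cast (by linarith : (0 : ℝ) ≤ ‖spaceGrad φ z‖ - 1)

end IsCriticalHamiltonian

end CriticalHJ

end

theorem mainTheorem6 (N : ℕ) (hN : 1 ≤ N)
    (A : Matrix (Fin N) (Fin N) ℝ) (hA : ∀ v : Fin N → ℝ, 0 ≤ v ⬝ᵥ A.mulVec v)
    (B : CriticalHJ.E N) (J : CriticalHJ.E N → ℝ) (hJ : CriticalHJ.IsCriticalKernel J)
    (H : CriticalHJ.E N → EReal) (hH : H = CriticalHJ.hamiltonian A B J) :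
    -- the initial trace
    (∀ f u : CriticalHJ.E N × ℝ → ℝ, ContinuousOn f (CriticalHJ.parBdry N) →
      CriticalHJ.IsViscositySolution (CriticalHJ.modOp H) f u →
      ∃ u₀ : CriticalHJ.E N → ℝ,
        (∀ x ∈ Metric.ball (0 : CriticalHJ.E N) 1,
          Tendsto u (𝓝[CriticalHJ.cyl N] (x, 0)) (𝓝 (u₀ x))) ∧
        CriticalHJ.IsObstacleSolution (fun x => f (x, 0)) u₀) ∧
    -- the Lagrangian
    (∃ L : CriticalHJ.E N → ℝ,
      (∀ q, CriticalHJ.lagrangian H q = (L q : EReal)) ∧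
      Differentiable ℝ L ∧
      ({p | H p ≠ ⊤} = Metric.ball 0 1 → ∀ q, ‖gradient L q‖ < 1) ∧
      Asymptotics.IsEquivalent (Bornology.cobounded (CriticalHJ.E N)) L (fun q => ‖q‖) ∧
      -- the rate function, in the radially symmetric case
      ((∀ y z, ‖y‖ = ‖z‖ → J y = J z) → (∃ α : ℝ, A = α • (1 : Matrix (Fin N) (Fin N) ℝ)) →
        B = 0 →
        ∃ Lbar : ℝ → ℝ, (∀ q, L q = Lbar ‖q‖) ∧
          ∃ I : CriticalHJ.E N × ℝ → ℝ,
            (∀ x t, I (x, t) = t * Lbar (CriticalHJ.distBdry x / t)) ∧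
            -- it is the unique solution with data `dist(x; ∂B_1)` and `0`
            CriticalHJ.IsViscositySolution (CriticalHJ.hjOp H) CriticalHJ.distData I ∧
            (∀ u, CriticalHJ.IsViscositySolution (CriticalHJ.hjOp H) CriticalHJ.distData u →
              Set.EqOn u I (CriticalHJ.cyl N)) ∧
            -- it is the limit of the solutions with data `a` and `0` as `a → ∞`
            (∀ a : ℝ, 0 < a →
              (∃ u, CriticalHJ.IsViscositySolution (CriticalHJ.modOp H)
                (CriticalHJ.constData a) u) ∧
              (∀ u v,
                CriticalHJ.IsViscositySolution (CriticalHJ.modOp H) (CriticalHJ.constData a) u →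
                CriticalHJ.IsViscositySolution (CriticalHJ.modOp H) (CriticalHJ.constData a) v →
                Set.EqOn u v (CriticalHJ.cyl N))) ∧
            (∀ U : ℝ → CriticalHJ.E N × ℝ → ℝ,
              (∀ a : ℝ, 0 < a → CriticalHJ.IsViscositySolution (CriticalHJ.modOp H)
                (CriticalHJ.constData a) (U a)) →
              ∀ z ∈ CriticalHJ.cyl N, Tendsto (fun a => U a z) atTop (𝓝 (I z))))) := by
  have hcrit : CriticalHJ.IsCriticalHamiltonian H (CriticalHJ.effDom J)
      (CriticalHJ.realHam A B J) := hH ▸ hJ.isCriticalHamiltonian hA B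
  refine ⟨fun f u hf hu => hcrit.exists_initialTrace hf hu,
    CriticalHJ.realLag (CriticalHJ.effDom J) (CriticalHJ.realHam A B J), hcrit.lagrangian_eq,
    fun q => (hcrit.hasGradientAt_realLag q).differentiableAt, fun hdom q => ?_,
    hcrit.isEquivalent_realLag, fun hradJ hα hB => ?_⟩
  · rw [(hcrit.hasGradientAt_realLag q).gradient]
    have hmem : CriticalHJ.maximizer (CriticalHJ.effDom J) (CriticalHJ.realHam A B J) q ∈
        {p | H p ≠ ⊤} := by
      change H _ ≠ ⊤
      rw [hcrit.eq_coe _ (hcrit.maximizer_mem q)]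
      exact EReal.coe_ne_top _
    rw [hdom] at hmem
    simpa using hmem
  obtain ⟨α, rfl⟩ := hα
  subst hB
  have hrad : CriticalHJ.IsRadial (CriticalHJ.effDom J)
      (CriticalHJ.realHam (α • (1 : Matrix (Fin N) (Fin N) ℝ)) 0 J) :=
    fun p q hpq => CriticalHJ.radial_iff_and_eq hradJ hpq
  set D := CriticalHJ.effDom J
  set h := CriticalHJ.realHam (α • (1 : Matrix (Fin N) (Fin N) ℝ)) 0 J
  set e : CriticalHJ.E N := EuclideanSpace.single ⟨0, hN⟩ 1
  have he : ‖e‖ = 1 := by simp [e]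
  have hdist : ∀ u, CriticalHJ.IsViscositySolution (CriticalHJ.hjOp H) CriticalHJ.distData u →
      Set.EqOn u (CriticalHJ.rateFn D h e) (CriticalHJ.cyl N) := fun u hu z hz => by
    rw [hcrit.viscositySolution_eq hrad he zero_le_one (hcrit.modOp_solution_of_hjOp hu)
      (fun w h1 h2 => ?_) (fun x hx => ?_) hz]
    · exact hcrit.eqOn_min_rateFn hrad he le_rfl hz
    · rw [CriticalHJ.distData_eq he
        (CriticalHJ.mem_parBdry.2 (Or.inl ⟨h1, h2⟩)), h1, sub_self]
    · have hx0 : ((x, 0) : CriticalHJ.E N × ℝ) ∈ CriticalHJ.parBdry N :=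
        CriticalHJ.mem_parBdry.2 (Or.inr ⟨hx, rfl⟩)
      rw [CriticalHJ.distData_eq he hx0]
      exact ⟨min_le_right _ _, by simp⟩
  have hconst : ∀ a : ℝ, 0 < a → ∀ u, CriticalHJ.IsViscositySolution (CriticalHJ.modOp H)
      (CriticalHJ.constData a) u → ∀ z ∈ CriticalHJ.cyl N,
      u z = min a (CriticalHJ.rateFn D h e z) := fun a ha u hu z hz => by
    refine hcrit.viscositySolution_eq hrad he ha.le hu (fun w h1 h2 => ?_) (fun x hx => ?_) hz
    · rw [CriticalHJ.constData, if_neg (by simp [h1])]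
    · rw [CriticalHJ.constData, if_pos (by simpa using hx)]
      exact ⟨min_le_left _ _, le_rfl⟩
  refine ⟨fun s => CriticalHJ.realLag D h (s • e), fun q => hcrit.realLag_radial hrad (by
      simp [norm_smul, he]), CriticalHJ.rateFn D h e, fun x t => rfl,
    hcrit.isViscositySolution_rateFn hrad he, hdist, fun a ha => ⟨⟨_,
      hcrit.isViscositySolution_min hrad he ha.le⟩, fun u v hu hv z hz => ?_⟩,
    fun U hU z hz => ?_⟩
  · rw [hconst a ha u hu z hz, hconst a ha v hv z hz]
  -- for `a ≥ 1` the solution is the rate function itself, since the latter is bounded by `1`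
  · refine tendsto_const_nhds.congr' ?_
    filter_upwards [eventually_ge_atTop 1] with a ha
    have ha0 : 0 < a := by linarith
    rw [hconst a ha0 (U a) (hU a ha0) z hz]
    exact (hcrit.eqOn_min_rateFn hrad he ha hz).symm
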